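/- A graph is a finite undirected multigraph: multiple edges and loops are allowed. Choose an orientation of every edge, write $E^+$ for the set of edges so oriented, and $h(e), t(e)$ for the head and the tail of $e\in E^+$. Every edge, loops included, gives two oriented edges ($e$ and its reverse $-e$). The degree of a vertex $v$ is the number of oriented edges that start at $v$ (so a loop counts twice), $G$ is regular if all its vertices have the same degree, and the entry $(u,v)$ of the adjacency matrix $A_G$ is the number of oriented edges from $u$ to $v$ (so a loop contributes $2$ to the diagonal). The eigenvalues of $G$ are those of $A_G$, with multiplicity. For $r\ge 1$ and a family of permutations $\sigma=(\sigma_e)_{e\in E^+}$ in the symmetric group $S_r$, the corresponding $r$-covering $H$ of $G$ has vertex set $V(G)\times\{1,\dots,r\}$, and for every $e\in E^+$ the $r$ edges that connect $(h(e),i)$ to $(t(e),\sigma_e(i))$, $1\le i\le r$. The multiset of eigenvalues of $H$ contains that of $G$; the eigenvalues that remain after the eigenvalues of $G$ have been removed (with multiplicity) are the new eigenvalues of $H$. For a vertex $v$ of $G$ let $T_v$ be the universal covering tree of the connected component of $v$: its vertices are the non-backtracking walks in $G$ that start at $v$, and two walks are adjacent if one extends the other by one step. Let $\rho(T_v)$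 be the spectral radius of the adjacency operator $(Af)(x)=\sum_{y\sim x}f(y)$ on $\ell^2(V(T_v))$, and let $\rho(G)=\max_v\rho(T_v)$ (and $0$ if $G$ has no vertices). If $G$ is connected, all the $T_v$ are isomorphic, and $\rho(G)$ is the spectral radius of the universal covering tree of $G$. An $r$-covering of $G$ is one-sided Ramanujan if all its new eigenvalues are at most $\rho(G)$. **Proposition.** Let $G$ be a regular finite graph, possibly with loops and multiple edges. Then for every $r\ge 1$, $G$ has a one-sided Ramanujan $r$-covering. -/

import Mathlib

/-- A multigraph with vertex set `V`, possibly with loops and multiple edges, in which one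
orientation of every edge has been chosen; `E` is the set of (positively oriented) edges. -/
structure MGraph (V E : Type*) where
  tail : E → V
  head : E → V

namespace MGraph

variable {V E : Type*}

/-- An oriented edge: the pair `(e, true)` is `e` with the chosen orientation, and `(e, false)` is
`e` with the opposite one. In particular every loop gives two oriented edges. -/
abbrev Dart (_G : MGraph V E) : Type _ := E × Bool

/-- The vertex at which an oriented edge starts. -/
def src (G : MGraph V E) (d : G.Dart) : V := if d.2 then G.tail d.1 else G.head d.1

/-- The vertex at which an oriented edge ends. -/
def tgt (G : MGraph V E) (d : G.Dart) : V := if d.2 then G.head d.1 else G.tail d.1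

/-- The same edge with the opposite orientation. -/
def rev (G : MGraph V E) (d : G.Dart) : G.Dart := (d.1, !d.2)

section Finite

variable [DecidableEq V] [Fintype E]

/-- The degree of a vertex; a loop counts twice. -/
def degree (G : MGraph V E) (v : V) : ℕ :=
  (Finset.univ.filter fun d : G.Dart => G.src d = v).card

/-- All vertices have the same degree. -/
def IsRegular (G : MGraph V E) : Prop := ∃ k : ℕ, ∀ v, G.degree v = k

/-- The adjacency matrix; the entry `(u, v)` is the number of oriented edges from `u` to `v`
(so a loop contributes `2` to the diagonal). -/
def adjMatrix (G : MGraph V E) : Matrix V V ℝ :=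
  Matrix.of fun u v =>
    ((Finset.univ.filter fun d : G.Dart => G.src d = u ∧ G.tgt d = v).card : ℝ)

/-- The multiset of eigenvalues of the (real symmetric) adjacency matrix, with multiplicities. -/
noncomputable def spec [Fintype V] (G : MGraph V E) : Multiset ℝ := G.adjMatrix.charpoly.roots

end Finite

/-- The `r`-covering of `G` given by a permutation of `r` letters for every positively oriented
edge: over each edge `e` there are the `r` edges between the vertices `(head e, i)` and
`(tail e, σ e i)`. -/
def lift (G : MGraph V E) {r : ℕ} (σ : E → Equiv.Perm (Fin r)) :
    MGraph (V × Fin r) (E × Fin r) where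
  tail e := (G.tail e.1, σ e.1 e.2)
  head e := (G.head e.1, e.2)

/-! ### The universal covering tree -/

/-- `l` lists, last step first, the oriented edges of a walk that starts at `v` and never
backtracks. -/
def IsReducedWalk (G : MGraph V E) (v : V) : List G.Dart → Prop
  | [] => True
  | [d] => G.src d = v
  | d :: d' :: l => G.src d = G.tgt d' ∧ d ≠ G.rev d' ∧ G.IsReducedWalk v (d' :: l)

/-- The vertices of the universal covering tree of (the connected component of `v` in) `G`:
the non-backtracking walks from `v`. -/
abbrev TreeVertex (G : MGraph V E) (v : V) : Type _ := {l : List G.Dart // G.IsReducedWalk v l}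

/-- The universal covering tree of (the connected component of `v` in) `G`: two non-backtracking
walks from `v` are adjacent if one of them extends the other by one step. -/
def universalCover (G : MGraph V E) (v : V) : SimpleGraph (G.TreeVertex v) where
  Adj p q := ∃ d, q.1 = d :: p.1 ∨ p.1 = d :: q.1
  symm := ⟨fun _ _ ⟨d, h⟩ => ⟨d, h.symm⟩⟩
  loopless := ⟨fun p ⟨d, h⟩ => by
    have : p.1 = d :: p.1 := by rcases h with h | h <;> exact h
    simpa using congrArg List.length this⟩

end MGraph

/-! ### The adjacency operator of an infinite graph of bounded degree -/

section Operator

open scoped ENNReal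

variable {X : Type*} (T : SimpleGraph X) [T.LocallyFinite]

theorem SimpleGraph.sum_norm_adj_le {D : ℕ} (hD : ∀ x, T.degree x ≤ D)
    (f : lp (fun _ : X => ℂ) 2) (s : Finset X) :
    ∑ x ∈ s, ‖∑ y ∈ T.neighborFinset x, f y‖ ^ (2 : ℝ≥0∞).toReal
      ≤ (D * ‖f‖) ^ (2 : ℝ≥0∞).toReal := by
  classical
  have h2 : (2 : ℝ≥0∞).toReal = ((2 : ℕ) : ℝ) := by norm_num
  have hf := fun u : Finset X => lp.sum_rpow_le_norm_rpow (p := 2) (by norm_num) f u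
  simp only [h2, Real.rpow_natCast] at hf ⊢
  have h1 : ∀ x ∈ s, ‖∑ y ∈ T.neighborFinset x, f y‖ ^ 2
      ≤ D * ∑ y ∈ T.neighborFinset x, ‖f y‖ ^ 2 := fun x _ => by
    calc ‖∑ y ∈ T.neighborFinset x, f y‖ ^ 2
        ≤ (∑ y ∈ T.neighborFinset x, ‖f y‖) ^ 2 := by gcongr; exact norm_sum_le _ _
      _ ≤ (T.neighborFinset x).card * ∑ y ∈ T.neighborFinset x, ‖f y‖ ^ 2 :=
          sq_sum_le_card_mul_sum_sq
      _ ≤ D * ∑ y ∈ T.neighborFinset x, ‖f y‖ ^ 2 := by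
          gcongr
          exact hD x
  have h3 : ∑ x ∈ s, ∑ y ∈ T.neighborFinset x, ‖f y‖ ^ 2
      = ∑ y ∈ s.biUnion fun x => T.neighborFinset x,
          ∑ _x ∈ s ∩ T.neighborFinset y, ‖f y‖ ^ 2 := by
    refine Finset.sum_comm' fun x y => ?_
    simp only [SimpleGraph.mem_neighborFinset, Finset.mem_inter, Finset.mem_biUnion]
    exact ⟨fun h => ⟨⟨h.1, h.2.symm⟩, x, h⟩, fun h => ⟨h.1.1, h.1.2.symm⟩⟩
  calc ∑ x ∈ s, ‖∑ y ∈ T.neighborFinset x, f y‖ ^ 2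
      ≤ ∑ x ∈ s, D * ∑ y ∈ T.neighborFinset x, ‖f y‖ ^ 2 := Finset.sum_le_sum h1
    _ = D * ∑ y ∈ s.biUnion fun x => T.neighborFinset x,
          ∑ _x ∈ s ∩ T.neighborFinset y, ‖f y‖ ^ 2 := by rw [← Finset.mul_sum, h3]
    _ ≤ D * ∑ y ∈ s.biUnion fun x => T.neighborFinset x, D * ‖f y‖ ^ 2 := by
        gcongr with y _
        rw [Finset.sum_const, nsmul_eq_mul]
        gcongr
        exact (Finset.card_le_card Finset.inter_subset_right).trans (hD y)
    _ ≤ D * (D * ‖f‖ ^ 2) := by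
        rw [← Finset.mul_sum]
        gcongr
        exact hf _
    _ = (D * ‖f‖) ^ 2 := by ring

/-- The adjacency operator `(A f) x = ∑_{y ∼ x} f y` on `ℓ²` of the vertex set, for a graph whose
degrees are at most `D`. -/
noncomputable def SimpleGraph.adjOperator {D : ℕ} (hD : ∀ x, T.degree x ≤ D) :
    lp (fun _ : X => ℂ) 2 →L[ℂ] lp (fun _ : X => ℂ) 2 :=
  LinearMap.mkContinuous
    { toFun := fun f => ⟨fun x => ∑ y ∈ T.neighborFinset x, f y,
        memℓp_gen' (T.sum_norm_adj_le hD f)⟩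
      map_add' := fun f g => by
        ext x
        exact Finset.sum_add_distrib
      map_smul' := fun c f => by
        ext x
        simp [Finset.mul_sum] }
    D fun f => lp.norm_le_of_forall_sum_le (by norm_num) (by positivity)
      (T.sum_norm_adj_le hD f)

end Operator

namespace MGraph

variable {V E : Type*}

theorem neighborSet_subset (G : MGraph V E) (v : V) (p : G.TreeVertex v) :
    Subtype.val '' (G.universalCover v).neighborSet p ⊆
      insert p.1.tail (Set.range fun d : G.Dart => d :: p.1) := by
  rintro _ ⟨q, ⟨d, h | h⟩, rfl⟩
  · exact Or.inr ⟨d, h.symm⟩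
  · exact Or.inl (by rw [h]; rfl)

noncomputable instance [Finite E] (G : MGraph V E) (v : V) :
    (G.universalCover v).LocallyFinite := fun p =>
  (Set.Finite.of_finite_image
    (((Set.finite_range fun d : G.Dart => d :: p.1).insert p.1.tail).subset
      (G.neighborSet_subset v p)) Subtype.val_injective.injOn).fintype

theorem degree_universalCover_le [Fintype E] (G : MGraph V E) (v : V) (p : G.TreeVertex v) :
    (G.universalCover v).degree p ≤ 2 * Fintype.card E + 1 := by
  classical
  have h : ((G.universalCover v).neighborFinset p).image Subtype.val ⊆
      insert p.1.tail (Finset.univ.image fun d : G.Dart => d :: p.1) := by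
    intro l hl
    have := G.neighborSet_subset v p (a := l) (by simpa using hl)
    simpa using this
  have h' := Finset.card_le_card h
  rw [Finset.card_image_of_injective _ Subtype.val_injective,
    SimpleGraph.card_neighborFinset_eq_degree] at h'
  refine h'.trans ((Finset.card_insert_le _ _).trans ?_)
  gcongr
  refine Finset.card_image_le.trans ?_
  simp [mul_comm]

/-- `ρ(G)`: the spectral radius of the adjacency operator of the universal covering tree of `G`
(the largest one over the connected components, if `G` is not connected; in a connected graph the
trees at different base points `v` are isomorphic). -/
noncomputable def rho [Fintype E] (G : MGraph V E) : ℝ :=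
  ⨆ v : V, (spectralRadius ℂ
    ((G.universalCover v).adjOperator (G.degree_universalCover_le v))).toReal

section Finite

variable [Fintype V] [DecidableEq V] [Fintype E]

/-- The new eigenvalues, with multiplicities, of the `r`-covering of `G` given by `σ`: its
eigenvalues without those of `G` (a submultiset of them when `r` is positive). -/
noncomputable def newSpec (G : MGraph V E) {r : ℕ} (σ : E → Equiv.Perm (Fin r)) : Multiset ℝ :=
  (G.lift σ).spec - G.spec

/-- All new eigenvalues of the `r`-covering of `G` given by `σ` are at most `ρ(G)`. -/
def IsOneSidedRamanujan (G : MGraph V E) {r : ℕ} (σ : E → Equiv.Perm (Fin r)) : Prop :=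
  ∀ μ ∈ G.newSpec σ, μ ≤ G.rho

end Finite

end MGraph

/-! Let `k` be the degree of `G`, and let `treeBound k` be `2√(k-1)`, or `k` if `k ≤ 1`. Two facts
suffice: some covering has all its new eigenvalues at most `treeBound k`
(`MGraph.exists_newSpec_le_treeBound`), and `treeBound k ≤ rho` (`MGraph.treeBound_le_rho`). The
first is proved by the method of interlacing families of polynomials.

Write `r = d + 1` and let `π` be the standard representation of `S_r`, of dimension `d`. The new
eigenvalues are those of a sum of block matrices, one for each edge. An edge that is not a loop
contributes the blocks `π(σ)` and `π(σ)ᵀ`, which arise from the case `σ = 1` by conjugation with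
`π(σ)` in the block of one end. A loop is given a conjugate `σ c σ⁻¹` of a fixed `r`-cycle `c`, so
its matrix is conjugated by `π(σ)` as well. The uniform distribution on `S_r` is a product of biased
random swaps (`uniformPerm_mem_closure`), swaps act as reflections, and conjugation by a reflection
adds one positive and subtracts one positive rank-one matrix. The two outcomes of a swap therefore
have a common interlacer. Consequently the averaged characteristic polynomial is real-rooted, and
some choice of permutations has no root beyond the largest root of the average
(`realRootedMixture_averageOn`).

To bound that root, the symmetric group is exchanged for the group of signed permutation matrices.
Along a circle of reflections, `det (N - g A gᵀ)` is a trigonometric polynomial of degree at most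
two, and each group contains enough reflections to integrate these exactly. Both averages are thus
invariant under all reflections, and so they agree (`ReflHom.sumDet_stdRep`).

Averaging over signs turns each ordinary edge into `d` edges with independent random signs. For a
loop, in a suitable orthonormal basis, `π(c) + π(c)ᵀ` is the adjacency matrix of a path minus a
positive rank-one matrix (`exists_isStdBasis`). Adding this matrix back can only raise the largest
root, and the signs that a random diagonal sign matrix induces on the edges of a path are
independent. What remains is the expected characteristic polynomial of a randomly signed loopless
graph with degrees at most `k`, which the Heilmann–Lieb recursion bounds (`signingSum_pos`).

For the second fact, truncations of the radial function `(k-1)^(-m/2)` are approximate eigenvectors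
of the tree (`MGraph.treeBound_mem_spectrum`).

The polynomials compared are monic, so the statement that no root exceeds `b` is expressed
throughout as positivity to the right of `b`. -/

set_option linter.unusedSectionVars false

/-! ### Real-rooted pencils of polynomials -/

open Polynomial in
/-- The real polynomial `p` has no zeros in the open upper half plane. -/
def NoUpperRoot (p : ℝ[X]) : Prop := ∀ z : ℂ, 0 < z.im → aeval z p ≠ 0

/-- `h / q` maps the open upper half plane to the open lower one, or is zero. -/
def LowerRatio (q h : Polynomial ℝ) : Prop :=
  ∀ z : ℂ, 0 < z.im → h ≠ 0 →
    (Polynomial.aeval z h * starRingEnd ℂ (Polynomial.aeval z q)).im < 0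

section RealRooted

open Polynomial

/-- By conjugation all complex roots are real, so each linear factor grows in modulus along a
vertical ray that leaves the real axis. -/
theorem NoUpperRoot.norm_aeval_le {p : ℝ[X]} (hp : NoUpperRoot p) (x : ℝ) {y y' : ℝ}
    (h0 : 0 ≤ y') (h : y' ≤ y) :
    ‖aeval (⟨x, y'⟩ : ℂ) p‖ ≤ ‖aeval (⟨x, y⟩ : ℂ) p‖ := by
  have key : ∀ z : ℂ, ‖aeval z p‖ = ‖(p.map (algebraMap ℝ ℂ)).leadingCoeff‖ *
      ((p.map (algebraMap ℝ ℂ)).roots.map fun a => ‖z - a‖).prod := by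
    intro z
    rw [aeval_def, ← eval_map]
    conv_lhs => rw [(IsAlgClosed.splits (p.map (algebraMap ℝ ℂ))).eq_prod_roots]
    rw [eval_mul, eval_C, norm_mul, eval_multiset_prod, Multiset.map_map]
    congr 1
    have := map_multiset_prod (normHom (α := ℂ))
      (Multiset.map (fun x => eval z (X - C x)) (p.map (algebraMap ℝ ℂ)).roots)
    simpa [Multiset.map_map, Function.comp_def] using this
  rw [key, key]
  refine mul_le_mul_of_nonneg_left ?_ (norm_nonneg _)
  refine Multiset.prod_map_le_prod_map₀ _ _ (fun _ _ => norm_nonneg _) fun a ha => ?_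
  have ha' : aeval a p = 0 := by
    rw [aeval_def, ← eval_map]
    exact (mem_roots'.1 ha).2
  have him : a.im = 0 := by
    rcases lt_trichotomy a.im 0 with h | h | h
    · refine absurd ?_ (hp (starRingEnd ℂ a) (by simpa using h))
      rw [aeval_conj, ha', map_zero]
    · exact h
    · exact absurd ha' (hp a h)
  rw [Complex.norm_def, Complex.norm_def]
  apply Real.sqrt_le_sqrt
  simp only [Complex.normSq_apply, Complex.sub_re, Complex.sub_im, him, sub_zero]
  have := mul_self_le_mul_self h0 h
  linarith

/-- At a zero of `h` the value of `q - t h` does not depend on `t`, and its modulus bounds `q - t h`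
on the vertical segment down to the real axis. Letting `t` grow forces `h` to vanish on that
segment. -/
theorem noUpperRoot_of_pencil {q h : ℝ[X]} (hh : h ≠ 0)
    (hq : ∀ t : ℝ, NoUpperRoot (q - C t * h)) : NoUpperRoot h := by
  rintro ⟨x, y⟩ hy hz
  replace hy : 0 < y := hy
  refine hh ?_
  have hinj : Function.Injective (algebraMap ℝ ℂ) := Complex.ofReal_injective
  rw [← Polynomial.map_eq_zero_iff hinj]
  refine eq_zero_of_infinite_isRoot _ (Set.Infinite.mono (s := (fun y' : ℝ => (⟨x, y'⟩ : ℂ)) ''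
    Set.Icc 0 y) ?_ ((Set.Icc_infinite hy).image ?_))
  · rintro _ ⟨y', ⟨h0, h1⟩, rfl⟩
    rw [Set.mem_ofPred_eq, IsRoot, eval_map, ← aeval_def]
    by_contra hne
    have hpos : 0 < ‖aeval (⟨x, y'⟩ : ℂ) h‖ := norm_pos_iff.2 hne
    obtain ⟨t, ht⟩ := exists_gt ((‖aeval (⟨x, y⟩ : ℂ) q‖ + ‖aeval (⟨x, y'⟩ : ℂ) q‖) /
      ‖aeval (⟨x, y'⟩ : ℂ) h‖)
    rw [div_lt_iff₀ hpos] at ht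
    have ht0 : 0 ≤ |t| := abs_nonneg t
    have h3 := (hq t).norm_aeval_le x h0 h1
    simp only [map_sub, map_mul, aeval_C, hz, mul_zero, sub_zero] at h3
    have h4 := norm_sub_norm_le ((algebraMap ℝ ℂ t) * aeval (⟨x, y'⟩ : ℂ) h)
      (aeval (⟨x, y'⟩ : ℂ) q)
    rw [norm_sub_rev, norm_mul] at h4
    have h5 : ‖(algebraMap ℝ ℂ t)‖ = |t| := by simp
    rw [h5] at h4
    have := mul_le_mul_of_nonneg_right (le_abs_self t) hpos.le
    linarith
  · intro a _ b _ hab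
    simpa using congrArg Complex.im hab

/-- A real value of `q / h` in the upper half plane would be a parameter `t` that contradicts `hq`.
So the imaginary part never vanishes, and its sign can be read off at infinity, where `h / q`
behaves like a positive multiple of `1 / z`. -/
theorem lowerRatio_of_pencil {q h : ℝ[X]} (hq1 : q.Monic)
    (hdeg : h ≠ 0 → h.natDegree + 1 = q.natDegree ∧ 0 < h.leadingCoeff)
    (hq : ∀ t : ℝ, NoUpperRoot (q - C t * h)) : LowerRatio q h := by
  intro z hz hh
  obtain ⟨hd, hl⟩ := hdeg hh
  have hh' := noUpperRoot_of_pencil hh hq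
  have hne : ∀ z : ℂ, 0 < z.im → (aeval z h * starRingEnd ℂ (aeval z q)).im ≠ 0 := by
    intro z hz h0
    set a := aeval z h with ha
    set b := aeval z q with hb
    have ha0 : a ≠ 0 := hh' z hz
    have hre : a * starRingEnd ℂ b = ((a * starRingEnd ℂ b).re : ℂ) :=
      Complex.ext (by simp) (by simp [h0])
    have hb2 : starRingEnd ℂ b ≠ 0 := by
      rw [ne_eq, map_eq_zero]
      simpa [hb] using hq 0 z hz
    have hb3 : b ≠ 0 := by simpa using hb2
    set c := (a * starRingEnd ℂ b).re
    have hc0 : (c : ℂ) ≠ 0 := by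
      rw [← hre]
      exact mul_ne_zero ha0 hb2
    refine hq (Complex.normSq b / c) z hz ?_
    simp only [map_sub, map_mul, aeval_C, ← ha, ← hb]
    have : (algebraMap ℝ ℂ) (Complex.normSq b / c) = b * starRingEnd ℂ b / (c : ℂ) := by
      rw [Complex.mul_conj]
      simp
    rw [this]
    field_simp
    rw [← hre]
    ring
  -- For `s > 0` this is, up to a positive factor, the quantity in question at `z / s`. Reversed
  -- polynomials extend it continuously to `s = 0`, which stands for the point at infinity.
  set ψ : ℝ → ℝ := fun s => (z⁻¹ * (eval₂ (algebraMap ℝ ℂ) ((s : ℂ) * z⁻¹) h.reverse *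
    starRingEnd ℂ (eval₂ (algebraMap ℝ ℂ) ((s : ℂ) * z⁻¹) q.reverse))).im with hψ
  have hz0 : z ≠ 0 := by
    rintro rfl
    simp at hz
  have hcont : Continuous ψ := by
    have h1 : ∀ p : ℝ[X], Continuous fun s : ℝ =>
        eval₂ (algebraMap ℝ ℂ) ((s : ℂ) * z⁻¹) p := fun p => by
      simp only [← eval_map]
      exact (Polynomial.continuous _).comp (by fun_prop)
    exact Complex.continuous_im.comp
      (continuous_const.mul ((h1 _).mul (Complex.continuous_conj.comp (h1 _))))
  have hrel : ∀ s : ℝ, 0 < s → ∃ c : ℝ, 0 < c ∧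
      (aeval (z / s) h * starRingEnd ℂ (aeval (z / s) q)).im = c * ψ s := by
    intro s hs
    have hs' : (s : ℂ) ≠ 0 := by exact_mod_cast hs.ne'
    have hx : z / s ≠ 0 := div_ne_zero hz0 hs'
    let _ := invertibleOfNonzero hx
    have hw : (s : ℂ) * z⁻¹ = ⅟(z / s) := by
      rw [invOf_eq_inv]
      field_simp
    refine ⟨s * Complex.normSq (z / s) ^ q.natDegree, ?_, ?_⟩
    · have := Complex.normSq_pos.2 hx
      positivity
    · simp only [hψ]
      rw [hw, aeval_def, aeval_def, ← eval₂_reverse_mul_pow (algebraMap ℝ ℂ) (z / s) h,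
        ← eval₂_reverse_mul_pow (algebraMap ℝ ℂ) (z / s) q]
      set a := eval₂ (algebraMap ℝ ℂ) (⅟(z / s)) h.reverse
      set b := eval₂ (algebraMap ℝ ℂ) (⅟(z / s)) q.reverse
      have : a * (z / s) ^ h.natDegree * starRingEnd ℂ (b * (z / s) ^ q.natDegree) =
          ((s * Complex.normSq (z / s) ^ q.natDegree : ℝ) : ℂ) *
            (z⁻¹ * (a * starRingEnd ℂ b)) := by
        push_cast
        rw [← Complex.mul_conj, mul_pow, map_mul, map_pow]
        have h6 : (z / s) ^ q.natDegree = (z / s) ^ h.natDegree * (z / s) := by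
          rw [← hd, pow_succ]
        have h7 : (s : ℂ) * z⁻¹ * (z / s) = 1 := by field_simp
        rw [h6]
        linear_combination (- (a * (z / s) ^ h.natDegree * starRingEnd ℂ b *
          (starRingEnd ℂ (z / s)) ^ q.natDegree)) * h7
      rw [this, Complex.im_ofReal_mul]
  have h0 : ψ 0 < 0 := by
    simp only [hψ, Complex.ofReal_zero, zero_mul, eval₂_at_zero, coeff_zero_reverse,
      hq1.leadingCoeff, map_one, mul_one]
    change (z⁻¹ * ((h.leadingCoeff : ℝ) : ℂ)).im < 0
    rw [Complex.im_mul_ofReal, Complex.inv_im]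
    have := Complex.normSq_pos.2 hz0
    rw [neg_div, neg_mul]
    have : 0 < z.im / Complex.normSq z * h.leadingCoeff := by positivity
    linarith
  have h1 : ψ 1 < 0 := by
    by_contra hcon
    push Not at hcon
    obtain ⟨s, ⟨hs0, hs1⟩, hs⟩ := intermediate_value_Icc (zero_le_one (α := ℝ))
      hcont.continuousOn ⟨h0.le, hcon⟩
    have hs2 : 0 < s := lt_of_le_of_ne hs0 (by rintro rfl; linarith)
    obtain ⟨c, -, hc⟩ := hrel s hs2
    refine hne (z / s) ?_ (by rw [hc, hs, mul_zero])
    rw [Complex.div_ofReal_im]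
    positivity
  obtain ⟨c, hc, hc'⟩ := hrel 1 one_pos
  simp only [Complex.ofReal_one, div_one] at hc'
  rw [hc']
  exact mul_neg_of_pos_of_neg hc h1

/-- Where the combination vanishes, nonnegative multiples of `h₁ / q` and `h₂ / q` add up to `1`.
Neither has positive imaginary part, so both must be zero, which is absurd. This is how a common
interlacer makes convex combinations real-rooted. -/
theorem noUpperRoot_sub_of_lowerRatio {q h₁ h₂ : ℝ[X]} (hq : NoUpperRoot q)
    (H₁ : LowerRatio q h₁) (H₂ : LowerRatio q h₂) {a b : ℝ} (ha : 0 ≤ a) (hb : 0 ≤ b) :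
    NoUpperRoot (q - C a * h₁ - C b * h₂) := by
  intro z hz h0
  simp only [map_sub, map_mul, aeval_C] at h0
  have hle : ∀ {h : ℝ[X]}, LowerRatio q h → ∀ {c : ℝ}, 0 ≤ c →
      ((algebraMap ℝ ℂ c * aeval z h) * starRingEnd ℂ (aeval z q)).im ≤ 0 ∧
      (((algebraMap ℝ ℂ c * aeval z h) * starRingEnd ℂ (aeval z q)).im = 0 →
        algebraMap ℝ ℂ c * aeval z h = 0) := by
    intro h H c hc
    rw [mul_assoc]
    change ((c : ℂ) * _).im ≤ 0 ∧ (((c : ℂ) * _).im = 0 → (c : ℂ) * _ = 0)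
    rw [Complex.im_ofReal_mul]
    by_cases hh : h = 0
    · simp [hh]
    · have := H z hz hh
      refine ⟨mul_nonpos_of_nonneg_of_nonpos hc this.le, fun h1 => ?_⟩
      rcases mul_eq_zero.1 h1 with h1 | h1
      · simp [h1]
      · exact absurd h1 this.ne
  obtain ⟨h1, h1'⟩ := hle H₁ ha
  obtain ⟨h2, h2'⟩ := hle H₂ hb
  have hs : (aeval z q) * starRingEnd ℂ (aeval z q) =
      (algebraMap ℝ ℂ a * aeval z h₁) * starRingEnd ℂ (aeval z q) +
      (algebraMap ℝ ℂ b * aeval z h₂) * starRingEnd ℂ (aeval z q) := by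
    linear_combination starRingEnd ℂ (aeval z q) * h0
  have him := congrArg Complex.im hs
  rw [Complex.mul_conj, Complex.add_im, Complex.ofReal_im] at him
  rw [h1' (by linarith), h2' (by linarith)] at h0
  exact hq z hz (by simpa using h0)

/-- The imaginary part of `h(x + iy) q(x - iy)` vanishes at `y = 0` and is nonpositive for `y > 0`;
the left-hand side is its derivative at `0`. -/
theorem LowerRatio.derivative_le {q h : ℝ[X]} (H : LowerRatio q h) (x : ℝ) :
    (derivative h).eval x * q.eval x - h.eval x * (derivative q).eval x ≤ 0 := by
  by_cases hh : h = 0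
  · simp [hh]
  have hof : ∀ p : ℝ[X], aeval (x : ℂ) p = ((p.eval x : ℝ) : ℂ) := fun p => by
    have := aeval_algebraMap_apply ℂ x p
    simpa [aeval_def] using this
  set g : ℝ → ℂ := fun y => aeval ((x : ℂ) + y * Complex.I) h *
    aeval ((x : ℂ) - y * Complex.I) q with hg
  have hd : HasDerivAt g (Complex.I * (((derivative h).eval x * q.eval x
      - h.eval x * (derivative q).eval x : ℝ) : ℂ)) 0 := by
    have h1 : HasDerivAt (fun y : ℝ => (x : ℂ) + y * Complex.I) Complex.I 0 := by
      have := (Complex.ofRealCLM.hasDerivAt (x := (0 : ℝ))).mul_const Complex.I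
      simpa using this.const_add (x : ℂ)
    have h2 : HasDerivAt (fun y : ℝ => (x : ℂ) - y * Complex.I) (-Complex.I) 0 := by
      have := (Complex.ofRealCLM.hasDerivAt (x := (0 : ℝ))).mul_const Complex.I
      simpa using this.const_sub (x : ℂ)
    have h3 := (Polynomial.hasDerivAt_aeval h ((x : ℂ) + (0 : ℝ) * Complex.I)).comp
      (0 : ℝ) h1
    have h4 := (Polynomial.hasDerivAt_aeval q ((x : ℂ) - (0 : ℝ) * Complex.I)).comp
      (0 : ℝ) h2
    have h5 := h3.mul h4
    have e1 : (x : ℂ) + ((0 : ℝ) : ℂ) * Complex.I = x := by simp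
    have e2 : (x : ℂ) - ((0 : ℝ) : ℂ) * Complex.I = x := by simp
    refine h5.congr_deriv ?_
    simp only [Function.comp, e1, e2, hof]
    push_cast
    ring
  have hd2 := (Complex.imCLM.hasFDerivAt.comp_hasDerivAt (0 : ℝ) hd)
  simp only [Complex.imCLM_apply, Complex.I_mul_im, Complex.ofReal_re] at hd2
  have hneg : ∀ y : ℝ, 0 < y → (g y).im ≤ 0 := by
    intro y hy
    have := H ((x : ℂ) + y * Complex.I) (by simpa using hy) hh
    rw [← aeval_conj] at this
    simpa [hg, sub_eq_add_neg] using this.le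
  have hg0 : (g 0).im = 0 := by simp [hg, hof, ← Complex.ofReal_mul]
  have hlim := hd2.tendsto_slope_zero_right
  refine le_of_tendsto hlim ?_
  filter_upwards [self_mem_nhdsWithin] with y hy
  simp only [Function.comp, zero_add, Complex.imCLM_apply, hg0, sub_zero, smul_eq_mul]
  exact mul_nonpos_of_nonneg_of_nonpos (inv_nonneg.2 (le_of_lt hy)) (hneg y hy)

theorem LowerRatio.antitoneOn {q h : ℝ[X]} (H : LowerRatio q h) {μ : ℝ}
    (hμ : ∀ x, μ < x → 0 < q.eval x) :
    AntitoneOn (fun x => h.eval x / q.eval x) (Set.Ioi μ) := by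
  have hd : ∀ x ∈ Set.Ioi μ, HasDerivAt (fun x => h.eval x / q.eval x)
      (((derivative h).eval x * q.eval x - h.eval x * (derivative q).eval x) / q.eval x ^ 2) x :=
    fun x hx => (h.hasDerivAt x).div (q.hasDerivAt x) (hμ x hx).ne'
  refine antitoneOn_of_deriv_nonpos (convex_Ioi μ)
    (fun x hx => (hd x hx).continuousAt.continuousWithinAt) ?_ ?_
  · rw [interior_Ioi]
    exact fun x hx => (hd x hx).differentiableAt.differentiableWithinAt
  · rw [interior_Ioi]
    intro x hx
    rw [(hd x hx).deriv]
    exact div_nonpos_of_nonpos_of_nonneg (H.derivative_le x) (sq_nonneg _)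

/-- To the right of `μ` the ratio `h / q` decreases to its limit `0` at infinity, so it is
nonnegative there; `μ` itself follows by continuity. -/
theorem LowerRatio.eval_nonneg {q h : ℝ[X]} (H : LowerRatio q h) (hdeg : h.degree < q.degree)
    {μ : ℝ} (hμ : ∀ x, μ < x → 0 < q.eval x) : 0 ≤ h.eval μ := by
  have h1 : ∀ x, μ < x → 0 ≤ h.eval x := by
    intro x hx
    have ht := Polynomial.div_tendsto_atTop_zero_of_degree_lt h q hdeg
    have : 0 ≤ h.eval x / q.eval x := by
      refine le_of_tendsto ht ?_
      filter_upwards [Filter.eventually_ge_atTop x] with y hy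
      exact H.antitoneOn hμ hx (lt_of_lt_of_le hx hy) hy
    rwa [le_div_iff₀ (hμ x hx), zero_mul] at this
  have hc : Filter.Tendsto (fun x => h.eval x) (nhdsWithin μ (Set.Ioi μ)) (nhds (h.eval μ)) :=
    h.continuous.continuousWithinAt
  refine ge_of_tendsto hc ?_
  filter_upwards [self_mem_nhdsWithin] with x hx using h1 x hx

theorem Polynomial.Monic.exists_largest_root {q : ℝ[X]} (hq : q.Monic) {x : ℝ}
    (hx : q.eval x ≤ 0) : ∃ μ, x ≤ μ ∧ q.eval μ = 0 ∧ ∀ y, μ < y → 0 < q.eval y := by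
  have hroots : ∃ μ, x ≤ μ ∧ q.eval μ = 0 := by
    by_cases hd : q.natDegree = 0
    · rw [eq_one_of_monic_natDegree_zero hq hd] at hx
      simp at hx
      linarith
    · have ht : Filter.Tendsto (fun x => q.eval x) Filter.atTop Filter.atTop :=
        q.tendsto_atTop_of_leadingCoeff_nonneg
          (natDegree_pos_iff_degree_pos.1 (Nat.pos_of_ne_zero hd)) (by rw [hq]; exact zero_le_one)
      obtain ⟨y, hy, hxy⟩ := ((ht.eventually_ge_atTop 0).and
        (Filter.eventually_ge_atTop x)).exists
      obtain ⟨μ, ⟨h1, -⟩, h2⟩ := intermediate_value_Icc hxy q.continuous.continuousOn ⟨hx, hy⟩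
      exact ⟨μ, h1, h2⟩
  obtain ⟨μ0, hμ0, hμ0'⟩ := hroots
  have hne : q.roots.toFinset.Nonempty :=
    ⟨μ0, by simpa [hq.ne_zero] using hμ0'⟩
  set μ := q.roots.toFinset.max' hne
  have hμ : q.eval μ = 0 := by
    have := q.roots.toFinset.max'_mem hne
    simpa [hq.ne_zero] using this
  have hmax : ∀ y, q.eval y = 0 → y ≤ μ := fun y hy =>
    q.roots.toFinset.le_max' y (by simpa [hq.ne_zero] using hy)
  refine ⟨μ, hμ0.trans (hmax _ hμ0'), hμ, fun y hy => ?_⟩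
  by_contra hcon
  push Not at hcon
  have hd : q.natDegree ≠ 0 := by
    intro hd
    rw [eq_one_of_monic_natDegree_zero hq hd] at hμ
    simp at hμ
  have ht : Filter.Tendsto (fun x => q.eval x) Filter.atTop Filter.atTop :=
    q.tendsto_atTop_of_leadingCoeff_nonneg
      (natDegree_pos_iff_degree_pos.1 (Nat.pos_of_ne_zero hd)) (by rw [hq]; exact zero_le_one)
  obtain ⟨w, hw, hyw⟩ := ((ht.eventually_ge_atTop 0).and
    (Filter.eventually_ge_atTop y)).exists
  obtain ⟨ν, ⟨h1, -⟩, h2⟩ := intermediate_value_Icc hyw q.continuous.continuousOn ⟨hcon, hw⟩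
  linarith [hmax ν h2]

/-- At the largest root of `q` the value of `q - h` is `-h ≤ 0`. -/
theorem LowerRatio.pos_of_sub_pos {q h : ℝ[X]} (hq : q.Monic) (H : LowerRatio q h)
    (hdeg : h.degree < q.degree) {b : ℝ} (hp : ∀ x, b < x → 0 < (q - h).eval x) :
    ∀ x, b < x → 0 < q.eval x := by
  intro x hx
  by_contra hcon
  obtain ⟨μ, h1, h2, h3⟩ := hq.exists_largest_root (not_lt.1 hcon)
  have := hp μ (by linarith)
  have h4 := H.eval_nonneg hdeg h3
  rw [eval_sub, h2] at this
  linarith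

/-- If both alternatives fail, both polynomials are nonpositive at one common point beyond `b`,
which contradicts `hp`. That point is the largest root of `q` if this lies to the right of `x₁` or
`x₂`. Otherwise `q` is positive from slightly before `min x₁ x₂` on, the sets `h₁ / q ≥ 1` and `h₂ /
q ≥ 1` extend to the left by monotonicity, and the point is `min x₁ x₂`. -/
theorem LowerRatio.pos_or_pos {q h₁ h₂ : ℝ[X]} (hq : q.Monic) (H₁ : LowerRatio q h₁)
    (H₂ : LowerRatio q h₂) (hd₁ : h₁.degree < q.degree) (hd₂ : h₂.degree < q.degree)
    {a₁ a₂ b : ℝ} (h1 : 0 ≤ a₁) (h2 : 0 ≤ a₂)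
    (hp : ∀ x, b < x → 0 < a₁ * (q - h₁).eval x + a₂ * (q - h₂).eval x) :
    (∀ x, b < x → 0 < (q - h₁).eval x) ∨ (∀ x, b < x → 0 < (q - h₂).eval x) := by
  by_contra! hcon
  obtain ⟨⟨x₁, hb₁, hx₁⟩, ⟨x₂, hb₂, hx₂⟩⟩ := hcon
  have key : ∀ y, b < y → (q - h₁).eval y ≤ 0 → (q - h₂).eval y ≤ 0 → False := by
    intro y hy e1 e2
    have := hp y hy
    have := mul_nonpos_of_nonneg_of_nonpos h1 e1
    have := mul_nonpos_of_nonneg_of_nonpos h2 e2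
    linarith
  by_cases hx : ∃ x, min x₁ x₂ ≤ x ∧ q.eval x ≤ 0
  · obtain ⟨x, hx, hx'⟩ := hx
    obtain ⟨μ, e1, e2, e3⟩ := hq.exists_largest_root hx'
    have e4 := H₁.eval_nonneg hd₁ e3
    have e5 := H₂.eval_nonneg hd₂ e3
    refine key μ ((lt_min hb₁ hb₂).trans_le (hx.trans e1)) ?_ ?_ <;>
    · rw [eval_sub, e2]
      linarith
  · push Not at hx
    obtain ⟨ν, hν, hpos⟩ : ∃ ν, ν < min x₁ x₂ ∧ ∀ x, ν < x → 0 < q.eval x := by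
      have h0 := hx _ le_rfl
      obtain ⟨ν, hν, hν'⟩ := (Metric.continuousAt_iff.1 (q.continuous.continuousAt
        (x := min x₁ x₂))) _ h0
      refine ⟨min x₁ x₂ - ν, by linarith, fun x hx' => ?_⟩
      rcases le_total (min x₁ x₂) x with h | h
      · exact hx x h
      · have := @hν' x (by rw [Real.dist_eq, abs_lt]; constructor <;> linarith)
        rw [Real.dist_eq, abs_lt] at this
        linarith
    have mono : ∀ {h : ℝ[X]}, LowerRatio q h → ∀ {x y : ℝ}, ν < x → x ≤ y →
        (q - h).eval y ≤ 0 → (q - h).eval x ≤ 0 := by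
      intro h H x y hx hxy hy
      have := H.antitoneOn hpos hx (hx.trans_le hxy) hxy
      simp only [eval_sub, sub_nonpos] at hy ⊢
      have hy' := (one_le_div (hpos y (hx.trans_le hxy))).2 hy
      exact (one_le_div (hpos x hx)).1 (hy'.trans this)
    exact key _ (lt_min hb₁ hb₂) (mono H₁ hν (min_le_left _ _) hx₁)
      (mono H₂ hν (min_le_right _ _) hx₂)

end RealRooted

/-! ### Convex combinations of characteristic polynomials of conjugates -/

section Mixture

open Polynomial Matrix

variable {n E : Type*} [Fintype n] [DecidableEq n] [Fintype E] [DecidableEq E]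

/-- `g` is an orthogonal matrix. -/
def IsOrth (g : Matrix n n ℝ) : Prop := gᵀ * g = 1

theorem IsOrth.mul_transpose {g : Matrix n n ℝ} (hg : IsOrth g) : g * gᵀ = 1 :=
  mul_eq_one_comm.1 hg

theorem IsOrth.transpose {g : Matrix n n ℝ} (hg : IsOrth g) : IsOrth gᵀ := by
  rw [IsOrth, transpose_transpose]
  exact hg.mul_transpose

theorem isOrth_one : IsOrth (1 : Matrix n n ℝ) := by simp [IsOrth]

theorem IsOrth.mul {g h : Matrix n n ℝ} (hg : IsOrth g) (hh : IsOrth h) : IsOrth (g * h) := by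
  rw [IsOrth, transpose_mul, Matrix.mul_assoc, ← Matrix.mul_assoc gᵀ, hg, Matrix.one_mul, hh]

theorem Matrix.IsSymm.conj {A : Matrix n n ℝ} (hA : A.IsSymm) (g : Matrix n n ℝ) :
    (g * A * gᵀ).IsSymm := by
  rw [IsSymm, transpose_mul, transpose_mul, transpose_transpose, hA.eq, Matrix.mul_assoc]

theorem Matrix.isSymm_vecMulVec (v : n → ℝ) : (vecMulVec v v).IsSymm := by
  ext i j
  simp [vecMulVec_apply, mul_comm]

/-- The reflection in the hyperplane orthogonal to the unit vector `u`. -/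
noncomputable def reflMat (u : n → ℝ) : Matrix n n ℝ := 1 - (2 : ℝ) • vecMulVec u u

theorem reflMat_transpose (u : n → ℝ) : (reflMat u)ᵀ = reflMat u := by
  rw [reflMat, transpose_sub, transpose_smul, (isSymm_vecMulVec u).eq, transpose_one]

theorem reflMat_mul_self {u : n → ℝ} (hu : u ⬝ᵥ u = 1) : reflMat u * reflMat u = 1 := by
  simp only [reflMat, Matrix.sub_mul, Matrix.mul_sub, Matrix.one_mul, Matrix.mul_one,
    Matrix.smul_mul, Matrix.mul_smul, vecMulVec_mul_vecMulVec, hu, one_smul]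
  module

theorem isOrth_reflMat {u : n → ℝ} (hu : u ⬝ᵥ u = 1) : IsOrth (reflMat u) := by
  rw [IsOrth, reflMat_transpose, reflMat_mul_self hu]

theorem reflMat_conj {A : Matrix n n ℝ} (hA : A.IsSymm) (u : n → ℝ) :
    reflMat u * A * reflMat u =
      A - vecMulVec u ((2 : ℝ) • (A *ᵥ u) - (2 * (u ⬝ᵥ A *ᵥ u)) • u)
        - vecMulVec ((2 : ℝ) • (A *ᵥ u) - (2 * (u ⬝ᵥ A *ᵥ u)) • u) u := by
  have h : u ᵥ* A = A *ᵥ u := by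
    conv_lhs => rw [← hA.eq]
    exact vecMul_transpose A u
  simp only [reflMat, Matrix.sub_mul, Matrix.mul_sub, Matrix.one_mul, Matrix.mul_one,
    Matrix.smul_mul, Matrix.mul_smul, vecMulVec_mul, mul_vecMulVec, h]
  ext i j
  have h2 : (A *ᵥ u) ⬝ᵥ u = u ⬝ᵥ A *ᵥ u := dotProduct_comm _ _
  simp [vecMulVec_apply, sub_mulVec, smul_mulVec, vecMulVec_mulVec, h2]
  ring

/-- Conjugation changes `A` by `-(u rᵀ + r uᵀ)`, and polarization writes this as a difference of two
squares. -/
theorem exists_reflMat_conj_eq {A : Matrix n n ℝ} (hA : A.IsSymm) (u : n → ℝ) :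
    ∃ a b : n → ℝ, reflMat u * A * (reflMat u)ᵀ = A + vecMulVec a a - vecMulVec b b := by
  set r := (2 : ℝ) • (A *ᵥ u) - (2 * (u ⬝ᵥ A *ᵥ u)) • u with hr
  refine ⟨(2⁻¹ : ℝ) • (u - (2 : ℝ) • r), (2⁻¹ : ℝ) • (u + (2 : ℝ) • r), ?_⟩
  rw [reflMat_transpose, reflMat_conj hA u, ← hr]
  ext i j
  simp [vecMulVec_apply]
  ring

/-- By the Schur complement this is the determinant of a bordered matrix in which `t` occurs in one
row only, and affinely. -/
theorem Matrix.det_add_smul_vecMulVec {R : Type*} [CommRing R] (N : Matrix n n R) (u v : n → R)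
    (t : R) : (N + t • vecMulVec u v).det = N.det - t * (N.det - (N + vecMulVec u v).det) := by
  have key : ∀ t : R, (N + t • vecMulVec u v).det =
      ((fromBlocks 1 0 (replicateCol Unit u) N).updateRow (Sum.inl ())
        (Sum.elim (1 : Unit → R) (-(t • v)))).det := by
    intro t
    have : (fromBlocks 1 0 (replicateCol Unit u) N).updateRow (Sum.inl ())
        (Sum.elim (1 : Unit → R) (-(t • v))) =
        fromBlocks 1 (replicateRow Unit (-(t • v))) (replicateCol Unit u) N := by
      ext (i | i) (j | j) <;> simp [updateRow_apply]
    rw [this, det_fromBlocks_one₁₁]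
    congr 1
    ext i j
    simp [vecMulVec_apply, Matrix.mul_apply, Finset.univ_unique]
    ring
  have h0 := key 0
  have h1 := key 1
  rw [zero_smul, add_zero] at h0
  rw [one_smul] at h1
  rw [key t, h0, h1]
  have hrow : Sum.elim (1 : Unit → R) (-(t • v)) =
      (1 - t) • Sum.elim (1 : Unit → R) (-((0 : R) • v)) +
        t • Sum.elim (1 : Unit → R) (-((1 : R) • v)) := by
    ext (i | i) <;> simp
  rw [hrow, det_updateRow_add, det_updateRow_smul, det_updateRow_smul]
  simp only [one_smul]
  ring

theorem Matrix.charpoly_add_smul_vecMulVec (M : Matrix n n ℝ) (w : n → ℝ) (t : ℝ) :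
    (M + t • vecMulVec w w).charpoly =
      M.charpoly - C t * (M.charpoly - (M + vecMulVec w w).charpoly) := by
  have key : ∀ t : ℝ, charmatrix (M + t • vecMulVec w w) =
      charmatrix M + C t • vecMulVec (fun i => C (w i)) (fun i => -C (w i)) := by
    intro t
    ext1 i j
    simp [charmatrix_apply, vecMulVec_apply]
    ring
  have h1 := key 1
  rw [one_smul, C_1, one_smul] at h1
  rw [charpoly, key, det_add_smul_vecMulVec, charpoly, charpoly, h1]

theorem Matrix.IsSymm.noUpperRoot_charpoly {M : Matrix n n ℝ} (hM : M.IsSymm) :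
    NoUpperRoot M.charpoly := by
  have hM' : M.IsHermitian := by
    rw [IsHermitian, conjTranspose_eq_transpose_of_trivial]
    exact hM
  intro z hz h0
  rw [hM'.charpoly_eq, map_prod] at h0
  obtain ⟨i, -, hi⟩ := Finset.prod_eq_zero_iff.1 h0
  have := congrArg Complex.im hi
  simp at this
  linarith

variable (n E) in
/-- Convex combinations of the functions `A ↦ charpoly (∑ e, g e * A e * (g e)ᵀ)` with orthogonal
matrices `g e`. -/
inductive Mixture : ((E → Matrix n n ℝ) → ℝ[X]) → Prop
  | conj (g : E → Matrix n n ℝ) (hg : ∀ e, IsOrth (g e)) :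
      Mixture fun A => (∑ e, g e * A e * (g e)ᵀ).charpoly
  | convex {F G : (E → Matrix n n ℝ) → ℝ[X]} {p : ℝ} (h0 : 0 ≤ p) (h1 : p ≤ 1)
      (hF : Mixture F) (hG : Mixture G) : Mixture fun A => C (1 - p) * F A + C p * G A

namespace Mixture

variable {F : (E → Matrix n n ℝ) → ℝ[X]}

theorem comp_conj (hF : Mixture n E F) (e : E) {s : Matrix n n ℝ} (hs : IsOrth s) :
    Mixture n E fun A => F (Function.update A e (s * A e * sᵀ)) := by
  induction hF with
  | conj g hg =>
    convert Mixture.conj (Function.update g e (g e * s)) ?_ using 3 with A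
    · refine Finset.sum_congr rfl fun e' _ => ?_
      by_cases h : e' = e
      · subst h
        simp [transpose_mul, Matrix.mul_assoc]
      · simp [h]
    · intro e'
      by_cases h : e' = e
      · subst h
        simpa using (hg e').mul hs
      · simpa [h] using hg e'
  | convex h0 h1 _ _ ihF ihG => exact ihF.convex h0 h1 ihG

theorem natDegree_le_and_coeff (hF : Mixture n E F) (A : E → Matrix n n ℝ) :
    (F A).natDegree ≤ Fintype.card n ∧ (F A).coeff (Fintype.card n) = 1 := by
  induction hF with
  | conj g hg =>
    have := charpoly_monic (∑ e, g e * A e * (g e)ᵀ)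
    have h2 := charpoly_natDegree_eq_dim (∑ e, g e * A e * (g e)ᵀ)
    refine ⟨h2.le, ?_⟩
    rw [← h2]
    exact this
  | @convex F G p h0 h1 _ _ ihF ihG =>
    refine ⟨(natDegree_add_le _ _).trans (max_le ?_ ?_), ?_⟩
    · exact (natDegree_C_mul_le _ _).trans ihF.1
    · exact (natDegree_C_mul_le _ _).trans ihG.1
    · rw [coeff_add, coeff_C_mul, coeff_C_mul, ihF.2, ihG.2]
      ring

theorem monic (hF : Mixture n E F) (A : E → Matrix n n ℝ) : (F A).Monic :=
  monic_of_natDegree_le_of_coeff_eq_one _ (hF.natDegree_le_and_coeff A).1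
    (hF.natDegree_le_and_coeff A).2

theorem natDegree_eq (hF : Mixture n E F) (A : E → Matrix n n ℝ) :
    (F A).natDegree = Fintype.card n :=
  natDegree_eq_of_le_of_coeff_ne_zero (hF.natDegree_le_and_coeff A).1
    (by rw [(hF.natDegree_le_and_coeff A).2]; exact one_ne_zero)

/-- Orthogonal conjugation preserves traces, so this coefficient is the same for every component of
the mixture. It provides the leading coefficient of the `h` in the pencils below. -/
theorem coeff_eq [Nonempty n] (hF : Mixture n E F) (A : E → Matrix n n ℝ) :
    (F A).coeff (Fintype.card n - 1) = -∑ e, (A e).trace := by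
  induction hF with
  | conj g hg =>
    have := trace_eq_neg_charpoly_coeff (∑ e, g e * A e * (g e)ᵀ)
    rw [← neg_eq_iff_eq_neg.2 this, trace_sum]
    congr 1
    refine Finset.sum_congr rfl fun e _ => ?_
    rw [trace_mul_comm, ← Matrix.mul_assoc, hg e, Matrix.one_mul]
  | convex h0 h1 _ _ ihF ihG =>
    rw [coeff_add, coeff_C_mul, coeff_C_mul, ihF, ihG]
    ring

theorem add_smul_vecMulVec (hF : Mixture n E F) (A : E → Matrix n n ℝ) (e : E) (v : n → ℝ)
    (t : ℝ) : F (Function.update A e (A e + t • vecMulVec v v)) =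
      F A - C t * (F A - F (Function.update A e (A e + vecMulVec v v))) := by
  induction hF with
  | conj g hg =>
    have key : ∀ t : ℝ, ∑ e', g e' * Function.update A e (A e + t • vecMulVec v v) e' * (g e')ᵀ =
        ∑ e', g e' * A e' * (g e')ᵀ + t • vecMulVec (g e *ᵥ v) (g e *ᵥ v) := by
      intro t
      rw [← Finset.add_sum_erase _ _ (Finset.mem_univ e),
        ← Finset.add_sum_erase _ (fun e' => g e' * A e' * (g e')ᵀ) (Finset.mem_univ e)]
      have : ∑ x ∈ Finset.univ.erase e,
          g x * Function.update A e (A e + t • vecMulVec v v) x * (g x)ᵀ =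
          ∑ x ∈ Finset.univ.erase e, g x * A x * (g x)ᵀ :=
        Finset.sum_congr rfl fun x hx => by
          rw [Function.update_of_ne (Finset.ne_of_mem_erase hx)]
      rw [this, Function.update_self, Matrix.mul_add, Matrix.add_mul, Matrix.mul_smul,
        Matrix.smul_mul, mul_vecMulVec, vecMulVec_mul, vecMul_transpose]
      abel
    have h1 := key 1
    rw [one_smul, one_smul] at h1
    beta_reduce
    rw [key, charpoly_add_smul_vecMulVec, h1]
  | @convex F G p h0 h1 _ _ ihF ihG =>
    simp only
    rw [ihF, ihG]
    ring

end Mixture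

variable (n E) in
/-- The mixtures all of whose values at symmetric matrices are real-rooted. -/
structure RealRootedMixture (F : (E → Matrix n n ℝ) → ℝ[X]) : Prop where
  mixture : Mixture n E F
  noUpperRoot : ∀ A, (∀ e, (A e).IsSymm) → NoUpperRoot (F A)

theorem realRootedMixture_charpoly :
    RealRootedMixture n E fun A => (∑ e, A e).charpoly where
  mixture := by
    convert Mixture.conj (n := n) (E := E) (fun _ => 1) (fun _ => isOrth_one) using 3 with A
    simp
  noUpperRoot A hA := by
    refine IsSymm.noUpperRoot_charpoly ?_
    rw [IsSymm, transpose_sum]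
    exact Finset.sum_congr rfl fun e _ => hA e

namespace RealRootedMixture

variable {F : (E → Matrix n n ℝ) → ℝ[X]} {A : E → Matrix n n ℝ}

theorem isSymm_update (hA : ∀ e, (A e).IsSymm) {e : E} {B : Matrix n n ℝ} (hB : B.IsSymm)
    (e' : E) : (Function.update A e B e').IsSymm := by
  by_cases h : e' = e
  · subst h
    simpa using hB
  · simpa [h] using hA e'

/-- Along the line `A e + t v vᵀ` the mixture is the pencil `F A - t h`, which is real-rooted for
every real `t`. Unless `h = 0`, its degree is one less than that of `F A`, with leading coefficient
the trace `v ⬝ᵥ v` of the added matrix. -/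
theorem exists_lowerRatio (hF : RealRootedMixture n E F) (hA : ∀ e, (A e).IsSymm) (e : E)
    (v : n → ℝ) : LowerRatio (F A) (F A - F (Function.update A e (A e + vecMulVec v v))) ∧
      (F A - F (Function.update A e (A e + vecMulVec v v))).degree < (F A).degree := by
  set h := F A - F (Function.update A e (A e + vecMulVec v v)) with hh
  have hm := hF.mixture
  have hdeg : h.degree < (F A).degree := by
    refine degree_sub_lt_left ?_ (hm.monic A).ne_zero ?_
    · rw [degree_eq_natDegree (hm.monic _).ne_zero, degree_eq_natDegree (hm.monic _).ne_zero,
        hm.natDegree_eq, hm.natDegree_eq]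
    · rw [(hm.monic _).leadingCoeff, (hm.monic _).leadingCoeff]
  refine ⟨lowerRatio_of_pencil (hm.monic A) (fun h0 => ?_) (fun t => ?_), hdeg⟩
  · have hlt : h.natDegree < Fintype.card n := by
      rw [← hm.natDegree_eq A]
      exact natDegree_lt_natDegree h0 hdeg
    have : Nonempty n := Fintype.card_pos_iff.1 (by omega)
    have hc : h.coeff (Fintype.card n - 1) = v ⬝ᵥ v := by
      rw [hh, coeff_sub, hm.coeff_eq, hm.coeff_eq,
        ← Finset.add_sum_erase _ _ (Finset.mem_univ e),
        ← Finset.add_sum_erase _ (fun e' => (Function.update A e _ e').trace) (Finset.mem_univ e)]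
      have : ∑ x ∈ Finset.univ.erase e,
          (Function.update A e (A e + vecMulVec v v) x).trace =
          ∑ x ∈ Finset.univ.erase e, (A x).trace :=
        Finset.sum_congr rfl fun x hx => by
          rw [Function.update_of_ne (Finset.ne_of_mem_erase hx)]
      rw [this, Function.update_self, trace_add, trace_vecMulVec]
      ring
    have hv : 0 < v ⬝ᵥ v := by
      refine lt_of_le_of_ne (Finset.sum_nonneg fun i _ => mul_self_nonneg (v i)) fun hv => h0 ?_
      have hv0 : v = 0 := dotProduct_self_eq_zero.1 hv.symm
      simp [hh, hv0]
    have hnd : h.natDegree = Fintype.card n - 1 :=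
      le_antisymm (by omega) (le_natDegree_of_ne_zero (by rw [hc]; exact hv.ne'))
    refine ⟨by rw [hm.natDegree_eq]; omega, ?_⟩
    rw [leadingCoeff, hnd, hc]
    exact hv
  · rw [← hm.add_smul_vecMulVec A e v t]
    exact hF.noUpperRoot _ (isSymm_update hA
      ((hA e).add (by rw [IsSymm, transpose_smul, (isSymm_vecMulVec v).eq])))

/-- Both configurations are one positive rank-one step away from `A e - b bᵀ`, and the value there
is the common `q`. -/
theorem exists_common (hF : RealRootedMixture n E F) (hA : ∀ e, (A e).IsSymm) (e : E)
    (u : n → ℝ) : ∃ q h₁ h₂ : ℝ[X], q.Monic ∧ NoUpperRoot q ∧ LowerRatio q h₁ ∧ LowerRatio q h₂ ∧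
      h₁.degree < q.degree ∧ h₂.degree < q.degree ∧ F A = q - h₁ ∧
      F (Function.update A e (reflMat u * A e * (reflMat u)ᵀ)) = q - h₂ := by
  obtain ⟨a, b, hab⟩ := exists_reflMat_conj_eq (hA e) u
  set A' := Function.update A e (A e - vecMulVec b b) with hA'
  have hA'e : A' e = A e - vecMulVec b b := by simp [hA']
  have hS : ∀ e, (A' e).IsSymm := isSymm_update hA ((hA e).sub (isSymm_vecMulVec b))
  obtain ⟨h1, h1'⟩ := hF.exists_lowerRatio hS e b
  obtain ⟨h2, h2'⟩ := hF.exists_lowerRatio hS e a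
  refine ⟨_, _, _, hF.mixture.monic A', hF.noUpperRoot _ hS, h1, h2, h1', h2', ?_, ?_⟩
  · rw [sub_sub_cancel, hA'e, sub_add_cancel, hA']
    simp
  · rw [sub_sub_cancel, hab, hA'e, hA']
    simp only [Function.update_idem]
    congr 2
    abel

theorem convex_reflMat (hF : RealRootedMixture n E F) (e : E) {u : n → ℝ} (hu : u ⬝ᵥ u = 1)
    {p : ℝ} (h0 : 0 ≤ p) (h1 : p ≤ 1) :
    RealRootedMixture n E fun A => C (1 - p) * F A +
      C p * F (Function.update A e (reflMat u * A e * (reflMat u)ᵀ)) where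
  mixture := hF.mixture.convex h0 h1 (hF.mixture.comp_conj e (isOrth_reflMat hu))
  noUpperRoot A hA := by
    obtain ⟨q, h₁, h₂, -, hq, H₁, H₂, -, -, e1, e2⟩ := hF.exists_common hA e u
    simp only [e1, e2]
    have := noUpperRoot_sub_of_lowerRatio hq H₁ H₂ (sub_nonneg.2 h1) h0
    convert this using 1
    rw [C_sub, C_1]
    ring

theorem pos_or_pos_reflMat (hF : RealRootedMixture n E F) (hA : ∀ e, (A e).IsSymm) (e : E)
    (u : n → ℝ) {p b : ℝ} (h0 : 0 ≤ p) (h1 : p ≤ 1)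
    (hpos : ∀ x, b < x → 0 < (C (1 - p) * F A +
      C p * F (Function.update A e (reflMat u * A e * (reflMat u)ᵀ))).eval x) :
    (∀ x, b < x → 0 < (F A).eval x) ∨
      (∀ x, b < x → 0 < (F (Function.update A e (reflMat u * A e * (reflMat u)ᵀ))).eval x) := by
  obtain ⟨q, h₁, h₂, hq, -, H₁, H₂, d1, d2, e1, e2⟩ := hF.exists_common hA e u
  rw [e1, e2] at hpos ⊢
  refine H₁.pos_or_pos hq H₂ d1 d2 (sub_nonneg.2 h1) h0 fun x hx => ?_
  simpa using hpos x hx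

theorem pos_of_add_vecMulVec (hF : RealRootedMixture n E F) (hA : ∀ e, (A e).IsSymm) (e : E)
    (v : n → ℝ) {b : ℝ}
    (hpos : ∀ x, b < x → 0 < (F (Function.update A e (A e + vecMulVec v v))).eval x) :
    ∀ x, b < x → 0 < (F A).eval x := by
  obtain ⟨h1, h2⟩ := hF.exists_lowerRatio hA e v
  refine h1.pos_of_sub_pos (hF.mixture.monic A) h2 (b := b) ?_
  rwa [sub_sub_cancel]

end RealRootedMixture

end Mixture

/-! ### The uniform distribution on a symmetric group as a product of random swaps -/

section UniformPerm

open Equiv Nat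

/-- The permutations of `Fin n` as the permutations of `Fin (n + 1)` that fix `0`. -/
def permSuccHom (n : ℕ) : Perm (Fin n) →* Perm (Fin (n + 1)) where
  toFun e := Perm.decomposeFin.symm (0, e)
  map_one' := by
    simp
    rfl
  map_mul' a b := by
    ext i
    refine Fin.cases ?_ (fun i => ?_) i <;> simp

theorem decomposeFin_symm_eq {n : ℕ} (p : Fin (n + 1)) (e : Perm (Fin n)) :
    Perm.decomposeFin.symm (p, e) = swap 0 p * permSuccHom n e := by
  ext i
  refine Fin.cases ?_ (fun i => ?_) i <;> simp [permSuccHom]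

theorem permSuccHom_swap {n : ℕ} (i j : Fin n) :
    permSuccHom n (swap i j) = swap i.succ j.succ := by
  ext k
  refine Fin.cases ?_ (fun k => ?_) k
  · rw [swap_apply_of_ne_of_ne (Fin.succ_ne_zero i).symm (Fin.succ_ne_zero j).symm]
    simp [permSuccHom]
  · simp only [permSuccHom, MonoidHom.coe_mk, OneHom.coe_mk, Perm.decomposeFin_symm_apply_succ,
      swap_self, refl_apply]
    rw [(Fin.succ_injective n).swap_apply]

variable {B : Type*} [Ring B] [Algebra ℝ B]

/-- The average of a representation of a symmetric group. -/
noncomputable def uniformPerm {n : ℕ} (ρ : Perm (Fin n) →* B) : B :=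
  (n ! : ℝ)⁻¹ • ∑ g, ρ g

theorem mul_uniformPerm {n : ℕ} (ρ : Perm (Fin n) →* B) (g : Perm (Fin n)) :
    ρ g * uniformPerm ρ = uniformPerm ρ := by
  rw [uniformPerm, mul_smul_comm, Finset.mul_sum]
  congr 1
  simp only [← map_mul]
  exact Fintype.sum_equiv (Equiv.mulLeft g) _ _ fun _ => rfl

theorem uniformPerm_succ {n : ℕ} (ρ : Perm (Fin (n + 1)) →* B) :
    uniformPerm ρ = ((n : ℝ) + 1)⁻¹ •
      ∑ p, ρ (swap 0 p) * uniformPerm (ρ.comp (permSuccHom n)) := by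
  rw [uniformPerm, ← Perm.decomposeFin.symm.sum_comp, Fintype.sum_prod_type]
  simp only [uniformPerm, decomposeFin_symm_eq, map_mul, MonoidHom.comp_apply, mul_smul_comm,
    ← Finset.smul_sum, ← Finset.mul_sum, smul_smul]
  congr 1
  rw [factorial_succ]
  push_cast
  rw [mul_inv]

theorem uniformPerm_mul_self {n : ℕ} (ρ : Perm (Fin n) →* B) :
    uniformPerm ρ * uniformPerm ρ = uniformPerm ρ := by
  conv_lhs => enter [1]; rw [uniformPerm]
  rw [smul_mul_assoc, Finset.sum_mul]
  simp only [mul_uniformPerm, Finset.sum_const, Finset.card_univ, Fintype.card_perm,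
    Fintype.card_fin]
  rw [← Nat.cast_smul_eq_nsmul ℝ, smul_smul, inv_mul_cancel₀ (by positivity), one_smul]

/-- A permutation `g` fixing `0` can be moved past `swap 0 1`, which becomes the swap of `0` with
the image of `1`; then `g` is absorbed by the average on the right. Every image occurs equally
often. -/
theorem uniformPerm_mul_swap_mul {n : ℕ} (ρ : Perm (Fin (n + 2)) →* B) :
    uniformPerm (ρ.comp (permSuccHom (n + 1))) * ρ (swap 0 1) *
      uniformPerm (ρ.comp (permSuccHom (n + 1))) =
    ((n : ℝ) + 1)⁻¹ • ∑ j : Fin (n + 1), ρ (swap 0 j.succ) *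
      uniformPerm (ρ.comp (permSuccHom (n + 1))) := by
  set u := uniformPerm (ρ.comp (permSuccHom (n + 1))) with hu
  have h1 : ∀ g : Perm (Fin (n + 1)), ρ (permSuccHom (n + 1) g) * ρ (swap 0 1) * u =
      ρ (swap 0 (g 0).succ) * u := by
    intro g
    rw [← map_mul, mul_swap_eq_swap_mul, map_mul, mul_assoc]
    have := mul_uniformPerm (ρ.comp (permSuccHom (n + 1))) g
    rw [MonoidHom.comp_apply, ← hu] at this
    rw [this, ← Fin.succ_zero_eq_one]
    simp [permSuccHom]
  conv_lhs => enter [1, 1]; rw [hu, uniformPerm]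
  rw [smul_mul_assoc, smul_mul_assoc, Finset.sum_mul, Finset.sum_mul]
  simp only [MonoidHom.comp_apply, h1]
  rw [← Perm.decomposeFin.symm.sum_comp, Fintype.sum_prod_type]
  simp only [Perm.decomposeFin_symm_apply_zero, Finset.sum_const, Finset.card_univ,
    Fintype.card_perm, Fintype.card_fin]
  rw [← Finset.smul_sum, ← Nat.cast_smul_eq_nsmul ℝ, smul_smul]
  congr 1
  rw [factorial_succ]
  push_cast
  have : (n ! : ℝ) ≠ 0 := by positivity
  have : (n : ℝ) + 1 ≠ 0 := by positivity
  field_simp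

theorem uniformPerm_mem_closure {n : ℕ} (ρ : Perm (Fin n) →* B) :
    uniformPerm ρ ∈ Submonoid.closure {x : B | ∃ i j : Fin n, i ≠ j ∧ ∃ p : ℝ, 0 ≤ p ∧ p ≤ 1 ∧
      x = (1 - p) • 1 + p • ρ (swap i j)} := by
  induction n with
  | zero =>
    convert Submonoid.one_mem _
    simp [uniformPerm]
  | succ n ih =>
    have hu := Submonoid.closure_mono (t := {x : B | ∃ i j : Fin (n + 1), i ≠ j ∧
      ∃ p : ℝ, 0 ≤ p ∧ p ≤ 1 ∧ x = (1 - p) • 1 + p • ρ (swap i j)}) ?_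
        (ih (ρ.comp (permSuccHom n)))
    · set u := uniformPerm (ρ.comp (permSuccHom n)) with hu'
      cases n with
      | zero =>
        rw [uniformPerm_succ, ← hu']
        simpa [← Perm.one_def] using hu
      | succ n =>
        -- Shuffle the points other than `0`, perform a biased swap of `0` and `1`, and shuffle
        -- again. The bias is the probability that a uniform permutation of `n + 2` points moves
        -- `0`.
        have key : uniformPerm ρ = u * ((1 - ((n : ℝ) + 1) / (n + 2)) • 1 +
            (((n : ℝ) + 1) / (n + 2)) • ρ (swap 0 1)) * u := by
          have h1 : (n : ℝ) + 1 ≠ 0 := by positivity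
          have h2 : (n : ℝ) + 2 ≠ 0 := by positivity
          rw [mul_add, add_mul, mul_smul_comm, mul_smul_comm, smul_mul_assoc, smul_mul_assoc,
            mul_one, uniformPerm_mul_self, uniformPerm_mul_swap_mul, uniformPerm_succ, ← hu',
            Fin.sum_univ_succ, swap_self, ← Perm.one_def, map_one, one_mul, smul_add, smul_smul]
          push_cast
          congr 2 <;> field_simp <;> ring
        rw [key]
        refine mul_mem (mul_mem hu (Submonoid.subset_closure ?_)) hu
        refine ⟨0, 1, by simp, _, by positivity, ?_, rfl⟩
        rw [div_le_one (by positivity)]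
        linarith
    · rintro x ⟨i, j, hij, p, h0, h1, rfl⟩
      refine ⟨i.succ, j.succ, by simpa using hij, p, h0, h1, ?_⟩
      rw [MonoidHom.comp_apply, permSuccHom_swap]

end UniformPerm

/-! ### Averages over independent random permutations, one for each edge -/

section SlotAverage

open Polynomial Matrix Equiv Nat

variable {n E : Type*} [Fintype n] [DecidableEq n] [Fintype E] [DecidableEq E] {r : ℕ}

/-- The action of a symmetric group on functions of families of matrices by conjugation of the
entry with index `e`. -/
def slotAction (π : Perm (Fin r) →* Matrix n n ℝ) (e : E) :
    Perm (Fin r) →* Module.End ℝ ((E → Matrix n n ℝ) → ℝ[X]) where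
  toFun g :=
    { toFun := fun F A => F (Function.update A e (π g⁻¹ * A e * (π g⁻¹)ᵀ))
      map_add' := fun _ _ => rfl
      map_smul' := fun _ _ => rfl }
  map_one' := by
    ext1 F
    funext A
    simp
  map_mul' a b := by
    ext1 F
    funext A
    simp [transpose_mul, Matrix.mul_assoc]

/-- Stated for all `F` at once, both claims are properties of the averaging operator that pass to
products. So it is enough to check them for a single biased swap. -/
theorem RealRootedMixture.uniform_slot {π : Perm (Fin r) →* Matrix n n ℝ}
    (hswap : ∀ i j, i ≠ j → ∃ u, u ⬝ᵥ u = 1 ∧ π (swap i j) = reflMat u)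
    {F : (E → Matrix n n ℝ) → ℝ[X]} (hF : RealRootedMixture n E F) (e : E) :
    RealRootedMixture n E (uniformPerm (slotAction π e) F) ∧
    ∀ A : E → Matrix n n ℝ, (∀ e, (A e).IsSymm) → ∀ b : ℝ,
      (∀ x, b < x → 0 < (uniformPerm (slotAction π e) F A).eval x) →
      ∃ g, ∀ x, b < x → 0 < (F (Function.update A e (π g * A e * (π g)ᵀ))).eval x := by
  have key := uniformPerm_mem_closure (slotAction π e)
  revert F
  generalize uniformPerm (slotAction π e) = U at key ⊢
  induction key using Submonoid.closure_induction with
  | mem x hx =>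
    intro F hF
    obtain ⟨i, j, hij, p, h0, h1, rfl⟩ := hx
    obtain ⟨u, hu, hu'⟩ := hswap i j hij
    have hform : (((1 - p) • 1 + p • slotAction π e (swap i j) :
        Module.End ℝ ((E → Matrix n n ℝ) → ℝ[X])) F) = fun A => C (1 - p) * F A +
        C p * F (Function.update A e (reflMat u * A e * (reflMat u)ᵀ)) := by
      funext A
      simp [slotAction, hu', smul_eq_C_mul]
    rw [hform]
    refine ⟨hF.convex_reflMat e hu h0 h1, fun A hA b hpos => ?_⟩
    rcases hF.pos_or_pos_reflMat hA e u h0 h1 hpos with h | h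
    · exact ⟨1, by simpa using h⟩
    · exact ⟨swap i j, by simpa [hu'] using h⟩
  | one =>
    intro F hF
    exact ⟨hF, fun A hA b hpos => ⟨1, by simpa using hpos⟩⟩
  | mul x y hx hy ihx ihy =>
    intro F hF
    obtain ⟨h1, h2⟩ := ihy hF
    obtain ⟨h3, h4⟩ := ihx h1
    refine ⟨h3, fun A hA b hpos => ?_⟩
    obtain ⟨g, hg⟩ := h4 A hA b hpos
    obtain ⟨g', hg'⟩ := h2 _ (RealRootedMixture.isSymm_update hA ((hA e).conj (π g))) b hg
    refine ⟨g' * g, ?_⟩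
    simpa [transpose_mul, Matrix.mul_assoc] using hg'

theorem Fintype.sum_sum_update {G M : Type*} [Fintype G] [AddCommMonoid M] (e : E)
    (f : (E → G) → M) : ∑ k, ∑ h, f (Function.update h e k) = Fintype.card G • ∑ h, f h := by
  rw [Finset.sum_comm, ← Fintype.sum_prod_type' (f := fun h k => f (Function.update h e k))]
  have hinv : Function.Involutive fun x : (E → G) × G => (Function.update x.1 e x.2, x.1 e) :=
    fun x => by simp
  rw [← Equiv.sum_comp (hinv.toPerm _), Fintype.sum_prod_type]
  simp [Function.Involutive.toPerm, Finset.smul_sum]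

/-- The family `A`, with the entries with index in `s` conjugated by the matrices `g e`. -/
def conjOn (s : Finset E) (g : E → Matrix n n ℝ) (A : E → Matrix n n ℝ) (e : E) :
    Matrix n n ℝ :=
  if e ∈ s then g e * A e * (g e)ᵀ else A e

/-- The average, over the permutations `h e` with `e ∈ s`, of the characteristic polynomial of
the sum of the matrices of a family, when those with index in `s` are conjugated. -/
noncomputable def averageOn (π : E → Perm (Fin r) →* Matrix n n ℝ) (s : Finset E)
    (A : E → Matrix n n ℝ) : ℝ[X] :=
  ((r ! : ℝ) ^ Fintype.card E)⁻¹ •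
    ∑ h : E → Perm (Fin r), (∑ e, conjOn s (fun e => π e (h e)) A e).charpoly

theorem averageOn_insert (π : E → Perm (Fin r) →* Matrix n n ℝ) {s : Finset E} {e : E}
    (he : e ∉ s) :
    averageOn π (insert e s) = uniformPerm (slotAction (π e) e) (averageOn π s) := by
  funext A
  have h1 : ∀ k : Perm (Fin r), ∀ h : E → Perm (Fin r),
      conjOn s (fun e => π e (h e)) (Function.update A e (π e k * A e * (π e k)ᵀ)) =
      conjOn (insert e s) (fun e' => π e' (Function.update h e k e')) A := by
    intro k h
    funext e'
    by_cases h' : e' = e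
    · subst h'
      simp [conjOn, he]
    · by_cases h2 : e' ∈ s <;> simp [conjOn, h2, h']
  simp only [uniformPerm, LinearMap.smul_apply, LinearMap.sum_apply, Pi.smul_apply,
    Finset.sum_apply]
  simp only [averageOn, slotAction, MonoidHom.coe_mk, OneHom.coe_mk, LinearMap.coe_mk,
    AddHom.coe_mk]
  rw [← Finset.smul_sum, smul_comm]
  congr 1
  rw [← Equiv.sum_comp (Equiv.inv (Perm (Fin r)))]
  simp only [Equiv.inv_apply, inv_inv, h1]
  rw [Fintype.sum_sum_update e
    fun h => (∑ e', conjOn (insert e s) (fun e' => π e' (h e')) A e').charpoly,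
    Fintype.card_perm, Fintype.card_fin, ← Nat.cast_smul_eq_nsmul ℝ, smul_smul,
    inv_mul_cancel₀ (by positivity), one_smul]

theorem averageOn_empty (π : E → Perm (Fin r) →* Matrix n n ℝ) :
    averageOn π ∅ = fun A => (∑ e, A e).charpoly := by
  funext A
  simp only [averageOn, conjOn, Finset.notMem_empty, if_false, Finset.sum_const,
    Finset.card_univ, Fintype.card_fun, Fintype.card_perm, Fintype.card_fin]
  rw [← Nat.cast_smul_eq_nsmul ℝ, smul_smul]
  push_cast
  rw [inv_mul_cancel₀ (by positivity), one_smul]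

variable {π : E → Perm (Fin r) →* Matrix n n ℝ}
  (hswap : ∀ e i j, i ≠ j → ∃ u, u ⬝ᵥ u = 1 ∧ π e (swap i j) = reflMat u)

-- The slots are averaged one after the other, each average being applied to a mixture already known
-- to be real-rooted. The witness is found by undoing the averages and fixing one permutation per
-- slot.
include hswap in
theorem realRootedMixture_averageOn (s : Finset E) :
    RealRootedMixture n E (averageOn π s) ∧
    ∀ A : E → Matrix n n ℝ, (∀ e, (A e).IsSymm) → ∀ b : ℝ,
      (∀ x, b < x → 0 < (averageOn π s A).eval x) →
      ∃ h : E → Perm (Fin r), ∀ x, b < x →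
        0 < (∑ e, conjOn s (fun e => π e (h e)) A e).charpoly.eval x := by
  induction s using Finset.induction_on with
  | empty =>
    rw [averageOn_empty]
    refine ⟨realRootedMixture_charpoly, fun A _ b hpos => ⟨1, ?_⟩⟩
    simpa [conjOn] using hpos
  | insert e s he ih =>
    rw [averageOn_insert π he]
    obtain ⟨h1, h2⟩ := ih.1.uniform_slot (hswap e) e
    refine ⟨h1, fun A hA b hpos => ?_⟩
    obtain ⟨g, hg⟩ := h2 A hA b hpos
    obtain ⟨h, hh⟩ := ih.2 _ (RealRootedMixture.isSymm_update hA ((hA e).conj (π e g))) b hg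
    refine ⟨Function.update h e g, ?_⟩
    convert hh using 6 with x hx e' _
    by_cases h' : e' = e
    · subst h'
      simp [conjOn, he]
    · by_cases h2 : e' ∈ s <;> simp [conjOn, h2, h']

end SlotAverage

/-! ### Averages of determinants over finite groups of orthogonal matrices -/

section Plane

open Matrix

variable {n κ : Type*} [Fintype n] [DecidableEq n] [Fintype κ] [DecidableEq κ]

/-- The matrix is a rank-two update of `N - A`, which leaves a `2 × 2` determinant. Its terms of
degree three and four in the quadratic forms of `u` cancel; this is what keeps the trigonometric
degree at two. -/
theorem det_sub_reflMat_conj {N A : Matrix n n ℝ} (hN : N.IsSymm) (hA : A.IsSymm) (u : n → ℝ)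
    (hdet : (N - A).det ≠ 0) :
    (N - reflMat u * A * reflMat u).det = (N - A).det *
      (1 + 4 * (u ⬝ᵥ ((N - A)⁻¹ * A) *ᵥ u) + 4 * (u ⬝ᵥ ((N - A)⁻¹ * A) *ᵥ u) ^ 2
        - 4 * (u ⬝ᵥ A *ᵥ u) * (u ⬝ᵥ (N - A)⁻¹ *ᵥ u)
        - 4 * (u ⬝ᵥ (N - A)⁻¹ *ᵥ u) * (u ⬝ᵥ (A * (N - A)⁻¹ * A) *ᵥ u)) := by
  set K := (N - A)⁻¹ with hK
  have hKs : Kᵀ = K := by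
    rw [hK, transpose_nonsing_inv, transpose_sub, hN.eq, hA.eq]
  set m := u ⬝ᵥ A *ᵥ u with hm
  set r := (2 : ℝ) • (A *ᵥ u) - (2 * m) • u with hr
  have hadd : N - reflMat u * A * reflMat u =
      (N - A) + (of ![u, r])ᵀ * of ![r, u] := by
    rw [reflMat_conj hA, ← hm, ← hr]
    ext i j
    simp [Matrix.mul_apply, vecMulVec_apply, Fin.sum_univ_two]
    ring
  rw [hadd, det_add_mul _ _ (isUnit_iff_ne_zero.2 hdet), ← hK, det_fin_two]
  congr 1
  have hent : ∀ x y : n → ℝ, ∀ i j : Fin 2, ∀ x' y' : n → ℝ,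
      (of ![x, y] * K * (of ![x', y'])ᵀ) i j = (![x, y] i) ⬝ᵥ K *ᵥ (![x', y'] j) := by
    intro x y i j x' y'
    rw [Matrix.mul_assoc]
    simp only [Matrix.mul_apply, dotProduct, mulVec, of_apply, transpose_apply]
  simp only [Matrix.add_apply, hent]
  simp only [Matrix.one_apply, Matrix.cons_val_zero, Matrix.cons_val_one]
  have hsw : ∀ x y : n → ℝ, x ⬝ᵥ K *ᵥ y = y ⬝ᵥ K *ᵥ x := by
    intro x y
    rw [dotProduct_mulVec, ← mulVec_transpose, hKs, dotProduct_comm]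
  have e1 : u ⬝ᵥ K *ᵥ r = 2 * (u ⬝ᵥ (K * A) *ᵥ u) - 2 * m * (u ⬝ᵥ K *ᵥ u) := by
    rw [hr, mulVec_sub, mulVec_smul, mulVec_smul, dotProduct_sub, dotProduct_smul,
      dotProduct_smul, mulVec_mulVec, smul_eq_mul, smul_eq_mul]
  have e3 : (A *ᵥ u) ⬝ᵥ K *ᵥ (A *ᵥ u) = u ⬝ᵥ (A * K * A) *ᵥ u := by
    rw [← mulVec_mulVec, ← mulVec_mulVec, dotProduct_mulVec u A, ← mulVec_transpose, hA.eq]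
  have e4 : (A *ᵥ u) ⬝ᵥ K *ᵥ u = u ⬝ᵥ (K * A) *ᵥ u := by
    rw [hsw, mulVec_mulVec]
  have e2 : r ⬝ᵥ K *ᵥ r = 4 * (u ⬝ᵥ (A * K * A) *ᵥ u)
      - 8 * m * (u ⬝ᵥ (K * A) *ᵥ u) + 4 * m ^ 2 * (u ⬝ᵥ K *ᵥ u) := by
    conv_lhs => enter [1]; rw [hr]
    rw [sub_dotProduct, smul_dotProduct, smul_dotProduct, e1, hr, mulVec_sub, mulVec_smul,
      mulVec_smul, dotProduct_sub, dotProduct_smul, dotProduct_smul, e3, e4]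
    simp only [smul_eq_mul]
    ring
  rw [hsw r u, e1, e2]
  simp
  ring

/-- The unit vector at angle `φ / 2` in the plane with orthonormal basis `a`, `b`. -/
noncomputable def halfAngle (a b : κ → ℝ) (φ : ℝ) : κ → ℝ :=
  Real.cos (φ / 2) • a + Real.sin (φ / 2) • b

theorem halfAngle_zero (a b : κ → ℝ) : halfAngle a b 0 = a := by simp [halfAngle]

theorem cos_half_sq (φ : ℝ) : Real.cos (φ / 2) ^ 2 = (1 + Real.cos φ) / 2 := by
  rw [Real.cos_sq, mul_div_cancel₀ _ two_ne_zero]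
  ring

theorem sin_half_sq (φ : ℝ) : Real.sin (φ / 2) ^ 2 = (1 - Real.cos φ) / 2 := by
  rw [Real.sin_sq, cos_half_sq]
  ring

theorem sin_half_mul_cos_half (φ : ℝ) :
    Real.sin (φ / 2) * Real.cos (φ / 2) = Real.sin φ / 2 := by
  have := Real.sin_two_mul (φ / 2)
  rw [mul_div_cancel₀ _ two_ne_zero] at this
  linarith

/-- Since the angle is halved, a quadratic form has only the frequencies `0` and `1` in `φ`. -/
theorem exists_quadForm_halfAngle (X : Matrix n n ℝ) (a b : n → ℝ) :
    ∃ x y z : ℝ, ∀ φ, halfAngle a b φ ⬝ᵥ X *ᵥ halfAngle a b φ =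
      x + y * Real.cos φ + z * Real.sin φ := by
  refine ⟨(a ⬝ᵥ X *ᵥ a + b ⬝ᵥ X *ᵥ b) / 2, (a ⬝ᵥ X *ᵥ a - b ⬝ᵥ X *ᵥ b) / 2,
    (a ⬝ᵥ X *ᵥ b + b ⬝ᵥ X *ᵥ a) / 2, fun φ => ?_⟩
  simp only [halfAngle, mulVec_add, mulVec_smul, dotProduct_add, add_dotProduct,
    dotProduct_smul, smul_dotProduct, smul_eq_mul]
  linear_combination (a ⬝ᵥ X *ᵥ a) * cos_half_sq φ + (b ⬝ᵥ X *ᵥ b) * sin_half_sq φ +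
    (a ⬝ᵥ X *ᵥ b + b ⬝ᵥ X *ᵥ a) * sin_half_mul_cos_half φ

theorem halfAngle_dotProduct_self {a b : κ → ℝ} (ha : a ⬝ᵥ a = 1) (hb : b ⬝ᵥ b = 1)
    (hab : a ⬝ᵥ b = 0) (φ : ℝ) : halfAngle a b φ ⬝ᵥ halfAngle a b φ = 1 := by
  have hba : b ⬝ᵥ a = 0 := by rw [dotProduct_comm, hab]
  simp only [halfAngle, dotProduct_add, add_dotProduct,
    dotProduct_smul, smul_dotProduct, smul_eq_mul, ha, hb, hab, hba]
  linear_combination Real.cos_sq_add_sin_sq (φ / 2)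

theorem reflMat_halfAngle (a b : κ → ℝ) (φ : ℝ) : reflMat (halfAngle a b φ) =
    1 - (vecMulVec a a + vecMulVec b b) - Real.cos φ • (vecMulVec a a - vecMulVec b b)
      - Real.sin φ • (vecMulVec a b + vecMulVec b a) := by
  ext i j
  simp only [reflMat, halfAngle, Matrix.sub_apply, Matrix.add_apply, Matrix.smul_apply,
    vecMulVec_apply, Pi.add_apply, Pi.smul_apply, smul_eq_mul]
  linear_combination (-2 * a i * a j) * cos_half_sq φ + (-2 * b i * b j) * sin_half_sq φ +
    (-2 * (a i * b j + b i * a j)) * sin_half_mul_cos_half φ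

theorem reflMat_halfAngle_mul {a b : κ → ℝ} (ha : a ⬝ᵥ a = 1) (hb : b ⬝ᵥ b = 1)
    (hab : a ⬝ᵥ b = 0) (α β : ℝ) :
    reflMat (halfAngle a b α) * reflMat (halfAngle a b β) =
      1 - (vecMulVec a a + vecMulVec b b) + Real.cos (α - β) • (vecMulVec a a + vecMulVec b b)
        - Real.sin (α - β) • (vecMulVec a b - vecMulVec b a) := by
  have hba : b ⬝ᵥ a = 0 := by rw [dotProduct_comm, hab]
  simp only [reflMat_halfAngle, Matrix.mul_sub, Matrix.sub_mul, Matrix.mul_add, Matrix.add_mul,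
    Matrix.mul_smul, Matrix.smul_mul, Matrix.one_mul, Matrix.mul_one, vecMulVec_mul_vecMulVec,
    ha, hb, hab, hba, one_smul, zero_smul]
  rw [Real.cos_sub, Real.sin_sub]
  ext i j
  simp only [Matrix.sub_apply, Matrix.add_apply, Matrix.smul_apply, vecMulVec_apply,
    smul_eq_mul, Pi.zero_apply, mul_zero]
  ring

theorem reflMat_halfAngle_mul_mul {a b : κ → ℝ} (ha : a ⬝ᵥ a = 1) (hb : b ⬝ᵥ b = 1)
    (hab : a ⬝ᵥ b = 0) (α β γ : ℝ) :
    reflMat (halfAngle a b α) * reflMat (halfAngle a b β) * reflMat (halfAngle a b γ) =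
      reflMat (halfAngle a b (α - β + γ)) := by
  have hba : b ⬝ᵥ a = 0 := by rw [dotProduct_comm, hab]
  rw [reflMat_halfAngle_mul ha hb hab]
  simp only [reflMat_halfAngle, Matrix.mul_sub, Matrix.sub_mul, Matrix.mul_add, Matrix.add_mul,
    Matrix.mul_smul, Matrix.smul_mul, Matrix.one_mul, Matrix.mul_one, vecMulVec_mul_vecMulVec,
    ha, hb, hab, hba, one_smul, zero_smul]
  rw [Real.cos_add, Real.sin_add]
  ext i j
  simp only [Matrix.sub_apply, Matrix.add_apply, Matrix.smul_apply, vecMulVec_apply,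
    smul_eq_mul, Pi.zero_apply, mul_zero]
  ring

/-- The sum over `φ + θ j` of a trigonometric polynomial of degree at most two does not depend
on `φ`. -/
def IsCircleDesign {m : ℕ} (θ : Fin m → ℝ) : Prop :=
  ∀ x : Fin 6 → ℝ, ∀ φ : ℝ,
    ∑ j, (x 0 + x 1 * Real.cos (φ + θ j) + x 2 * Real.sin (φ + θ j) +
      x 3 * Real.cos (φ + θ j) ^ 2 + x 4 * (Real.cos (φ + θ j) * Real.sin (φ + θ j)) +
      x 5 * Real.sin (φ + θ j) ^ 2) =
    ∑ j, (x 0 + x 1 * Real.cos (θ j) + x 2 * Real.sin (θ j) +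
      x 3 * Real.cos (θ j) ^ 2 + x 4 * (Real.cos (θ j) * Real.sin (θ j)) +
      x 5 * Real.sin (θ j) ^ 2)

/-- The angles are equally spaced and the frequencies `1` and `2` are not multiples of `3`. -/
theorem isCircleDesign_three : IsCircleDesign ![0, 2 * Real.pi / 3, -(2 * Real.pi / 3)] := by
  intro x φ
  have h1 : Real.cos (2 * Real.pi / 3) = -1 / 2 := by
    have : 2 * Real.pi / 3 = Real.pi - Real.pi / 3 := by ring
    rw [this, Real.cos_pi_sub, Real.cos_pi_div_three]
    ring
  have h2 : Real.sin (2 * Real.pi / 3) = √3 / 2 := by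
    have : 2 * Real.pi / 3 = Real.pi - Real.pi / 3 := by ring
    rw [this, Real.sin_pi_sub, Real.sin_pi_div_three]
  have h3 : √3 ^ 2 = 3 := Real.sq_sqrt (by norm_num)
  simp only [Fin.sum_univ_three, Matrix.cons_val_zero, Matrix.cons_val_one, Matrix.cons_val_two,
    Matrix.tail_cons, Matrix.head_cons, Real.cos_add, Real.sin_add, Real.cos_neg,
    Real.sin_neg, h1, h2, Real.cos_zero, Real.sin_zero]
  have h4 := Real.cos_sq_add_sin_sq φ
  generalize Real.cos φ = c at *
  generalize Real.sin φ = s at *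
  generalize √3 = w at *
  have h5 : s ^ 2 = 1 - c ^ 2 := by linarith
  ring_nf
  rw [h3, h5]
  ring

theorem isCircleDesign_four :
    IsCircleDesign ![0, Real.pi / 2, Real.pi, -(Real.pi / 2)] := by
  intro x φ
  simp only [Fin.sum_univ_four, Matrix.cons_val_zero, Matrix.cons_val_one, Matrix.cons_val_two,
    Matrix.tail_cons, Matrix.head_cons, Matrix.cons_val, Real.cos_add, Real.sin_add, Real.cos_neg,
    Real.sin_neg, Real.cos_pi_div_two, Real.sin_pi_div_two, Real.cos_pi, Real.sin_pi,
    Real.cos_zero, Real.sin_zero]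
  linear_combination (2 * (x 3 + x 5)) * Real.cos_sq_add_sin_sq φ

theorem sum_det_sub_reflMat_halfAngle {m : ℕ} {θ : Fin m → ℝ} (hθ : IsCircleDesign θ)
    {N A : Matrix n n ℝ} (hN : N.IsSymm) (hA : A.IsSymm) (a b : n → ℝ) (φ : ℝ) :
    ∑ j, (N - reflMat (halfAngle a b (φ + θ j)) * A * reflMat (halfAngle a b (φ + θ j))).det =
      ∑ j, (N - reflMat (halfAngle a b (θ j)) * A * reflMat (halfAngle a b (θ j))).det := by
  have key : ∀ {N : Matrix n n ℝ}, N.IsSymm → (N - A).det ≠ 0 →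
      ∑ j, (N - reflMat (halfAngle a b (φ + θ j)) * A * reflMat (halfAngle a b (φ + θ j))).det =
      ∑ j, (N - reflMat (halfAngle a b (θ j)) * A * reflMat (halfAngle a b (θ j))).det := by
    intro N hN hdet
    simp only [det_sub_reflMat_conj hN hA _ hdet]
    obtain ⟨x1, y1, z1, h1⟩ := exists_quadForm_halfAngle ((N - A)⁻¹ * A) a b
    obtain ⟨x2, y2, z2, h2⟩ := exists_quadForm_halfAngle A a b
    obtain ⟨x3, y3, z3, h3⟩ := exists_quadForm_halfAngle ((N - A)⁻¹) a b
    obtain ⟨x4, y4, z4, h4⟩ := exists_quadForm_halfAngle (A * (N - A)⁻¹ * A) a b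
    simp only [h1, h2, h3, h4, ← Finset.mul_sum]
    congr 1
    have := hθ ![1 + 4 * x1 + 4 * x1 ^ 2 - 4 * x2 * x3 - 4 * x3 * x4,
      4 * y1 + 8 * x1 * y1 - 4 * (x2 * y3 + x3 * y2) - 4 * (x3 * y4 + x4 * y3),
      4 * z1 + 8 * x1 * z1 - 4 * (x2 * z3 + x3 * z2) - 4 * (x3 * z4 + x4 * z3),
      4 * y1 ^ 2 - 4 * y2 * y3 - 4 * y3 * y4,
      8 * y1 * z1 - 4 * (y2 * z3 + y3 * z2) - 4 * (y3 * z4 + y4 * z3),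
      4 * z1 ^ 2 - 4 * z2 * z3 - 4 * z3 * z4] φ
    simp only [Matrix.cons_val] at this
    convert this using 2 <;> ring
  -- The formula for the determinant needs `N - A` to be invertible. Replacing `N` by `N + t`
  -- achieves this for all but finitely many `t`, and both sides are polynomials in `t`.
  have hev : ∀ B : Matrix n n ℝ, ∀ t : ℝ,
      (N + t • (1 : Matrix n n ℝ) - B).det = (B - N).charpoly.eval t := by
    intro B t
    rw [eval_charpoly]
    congr 1
    rw [Matrix.scalar_apply, ← smul_one_eq_diagonal]
    abel
  have hpoly : ∑ j, (reflMat (halfAngle a b (φ + θ j)) * A *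
      reflMat (halfAngle a b (φ + θ j)) - N).charpoly =
      ∑ j, (reflMat (halfAngle a b (θ j)) * A * reflMat (halfAngle a b (θ j)) - N).charpoly := by
    refine Polynomial.eq_of_infinite_eval_eq _ _ (Set.Infinite.mono
      (s := {t | (A - N).charpoly.eval t = 0}ᶜ) (fun t ht => ?_) ?_)
    · rw [Set.mem_compl_iff, Set.mem_ofPred_eq, ← hev] at ht
      have := key (hN.add (by rw [IsSymm, transpose_smul, transpose_one])) ht
      simp only [hev] at this
      rw [Set.mem_ofPred_eq, Polynomial.eval_finsetSum, Polynomial.eval_finsetSum]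
      exact this
    · refine Set.Finite.infinite_compl ?_
      exact (Polynomial.finite_setOfPred_isRoot (charpoly_monic _).ne_zero)
  have := congrArg (Polynomial.eval 0) hpoly
  simpa only [Polynomial.eval_finsetSum, ← hev, zero_smul, add_zero] using this

end Plane

/-! ### Invariance of averaged determinants under all reflections -/

section Invariance

open Matrix

/-- A continuous homomorphism of matrix monoids that is compatible with transposition and takes
reflections to reflections. -/
structure ReflHom (κ n : Type*) [Fintype n] [DecidableEq n] [Fintype κ] [DecidableEq κ] where
  toMat : Matrix κ κ ℝ →* Matrix n n ℝ
  vec : (κ → ℝ) →ₗ[ℝ] (n → ℝ)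
  continuous_toMat : Continuous toMat
  toMat_transpose : ∀ Q, toMat Qᵀ = (toMat Q)ᵀ
  toMat_reflMat : ∀ u, toMat (reflMat u) = reflMat (vec u)
  vec_dotProduct : ∀ u w, vec u ⬝ᵥ vec w = u ⬝ᵥ w

variable {n κ Ω : Type*} [Fintype n] [DecidableEq n] [Fintype κ] [DecidableEq κ] [Fintype Ω]

theorem IsOrth.dotProduct_mulVec {Q : Matrix κ κ ℝ} (hQ : IsOrth Q) (u w : κ → ℝ) :
    (Q *ᵥ u) ⬝ᵥ (Q *ᵥ w) = u ⬝ᵥ w := by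
  rw [Matrix.dotProduct_mulVec, ← mulVec_transpose, mulVec_mulVec, hQ, one_mulVec]

theorem IsOrth.conj_reflMat {Q : Matrix κ κ ℝ} (hQ : IsOrth Q) (u : κ → ℝ) :
    Qᵀ * reflMat (Q *ᵥ u) * Q = reflMat u := by
  rw [reflMat, Matrix.mul_sub, Matrix.sub_mul, Matrix.mul_one, hQ, Matrix.mul_smul,
    Matrix.smul_mul, mul_vecMulVec, vecMulVec_mul, ← mulVec_transpose, mulVec_mulVec, hQ,
    one_mulVec, reflMat]

theorem Matrix.det_sub_conj {g : Matrix n n ℝ} (hg : IsOrth g) (N A : Matrix n n ℝ) :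
    (N - g * A * gᵀ).det = (gᵀ * N * g - A).det := by
  have : gᵀ * N * g - A = gᵀ * (N - g * A * gᵀ) * g := by
    rw [Matrix.mul_sub, Matrix.sub_mul]
    congr 1
    have := hg
    rw [IsOrth] at this
    calc A = (gᵀ * g) * A * (gᵀ * g) := by rw [this, Matrix.one_mul, Matrix.mul_one]
      _ = _ := by simp only [Matrix.mul_assoc]
  rw [this, det_mul, det_mul, mul_comm, ← mul_assoc, ← det_mul, hg.mul_transpose, det_one,
    one_mul]

namespace ReflHom

variable (D : ReflHom κ n)

theorem isOrth {Q : Matrix κ κ ℝ} (hQ : IsOrth Q) : IsOrth (D.toMat Q) := by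
  rw [IsOrth, ← D.toMat_transpose, ← map_mul, hQ, map_one]

/-- The sum of the determinants of `N - M h * A * (M h)ᵀ` over `h`, for matrices `M h` moved by
`D`. -/
noncomputable def sumDet (M : Ω → Matrix κ κ ℝ) (N A : Matrix n n ℝ) : ℝ :=
  ∑ h, (N - D.toMat (M h) * A * (D.toMat (M h))ᵀ).det

/-- Conjugating `A` by `Q` does not change the sum `sumDet`. -/
def Fixes (M : Ω → Matrix κ κ ℝ) (Q : Matrix κ κ ℝ) : Prop :=
  IsOrth Q ∧ ∀ N A : Matrix n n ℝ, N.IsSymm → A.IsSymm →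
    D.sumDet M N (D.toMat Q * A * (D.toMat Q)ᵀ) = D.sumDet M N A

variable {D} {M : Ω → Matrix κ κ ℝ}

theorem Fixes.mul {P Q : Matrix κ κ ℝ} (hP : D.Fixes M P) (hQ : D.Fixes M Q) :
    D.Fixes M (P * Q) := by
  refine ⟨hP.1.mul hQ.1, fun N A hN hA => ?_⟩
  have := (hP.2 N _ hN (hA.conj (D.toMat Q))).trans (hQ.2 N A hN hA)
  simpa only [map_mul, transpose_mul, Matrix.mul_assoc] using this

theorem fixes_one : D.Fixes M 1 := ⟨isOrth_one, fun N A _ _ => by simp⟩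

theorem Fixes.transpose {Q : Matrix κ κ ℝ} (hQ : D.Fixes M Q) : D.Fixes M Qᵀ := by
  refine ⟨hQ.1.transpose, fun N A hN hA => ?_⟩
  rw [← hQ.2 N _ hN (hA.conj _), D.toMat_transpose, transpose_transpose]
  congr 1
  have := (D.isOrth hQ.1).mul_transpose
  calc D.toMat Q * ((D.toMat Q)ᵀ * A * D.toMat Q) * (D.toMat Q)ᵀ =
      (D.toMat Q * (D.toMat Q)ᵀ) * A * (D.toMat Q * (D.toMat Q)ᵀ) := by
        simp only [Matrix.mul_assoc]
    _ = A := by rw [this, Matrix.one_mul, Matrix.mul_one]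

theorem fixes_of_equiv {ρ : Matrix κ κ ℝ} (hρ : IsOrth ρ) (τ : Ω ≃ Ω)
    (hτ : ∀ h, M (τ h) = M h * ρ) : D.Fixes M ρ := by
  refine ⟨hρ, fun N A _ _ => ?_⟩
  symm
  rw [sumDet, sumDet, ← τ.sum_comp]
  refine Finset.sum_congr rfl fun h _ => ?_
  rw [hτ, map_mul, transpose_mul]
  simp only [Matrix.mul_assoc]

theorem isClosed_fixes : IsClosed {Q | D.Fixes M Q} := by
  have hc := D.continuous_toMat
  have h1 : IsClosed {Q : Matrix κ κ ℝ | IsOrth Q} :=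
    isClosed_eq (by fun_prop) continuous_const
  have h2 : IsClosed {Q : Matrix κ κ ℝ | ∀ N A : Matrix n n ℝ, N.IsSymm → A.IsSymm →
      D.sumDet M N (D.toMat Q * A * (D.toMat Q)ᵀ) = D.sumDet M N A} := by
    simp only [Set.ofPred_forall]
    refine isClosed_iInter fun N => isClosed_iInter fun A => isClosed_iInter fun _ =>
      isClosed_iInter fun _ => isClosed_eq ?_ continuous_const
    unfold sumDet
    fun_prop
  exact h1.inter h2

theorem isCompact_fixes : IsCompact {Q | D.Fixes M Q} := by
  have hbox : IsCompact (Set.univ.pi fun _ : κ => Set.univ.pi fun _ : κ => Set.Icc (-1 : ℝ) 1) :=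
    isCompact_univ_pi fun _ => isCompact_univ_pi fun _ => isCompact_Icc
  refine IsCompact.of_isClosed_subset (s := (Set.univ.pi fun _ : κ => Set.univ.pi fun _ : κ =>
    Set.Icc (-1 : ℝ) 1)) hbox isClosed_fixes ?_
  intro (Q : Matrix κ κ ℝ) hQ i _ j _
  have h := congrFun (congrFun hQ.1 j) j
  rw [Matrix.mul_apply, Matrix.one_apply_eq] at h
  have h2 : Q i j * Q i j ≤ 1 := by
    rw [← h]
    exact Finset.single_le_sum (f := fun k => Qᵀ j k * Q k j)
      (fun k _ => mul_self_nonneg (Q k j)) (Finset.mem_univ i)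
  constructor <;> nlinarith

/-- The family absorbs reflections at the angles `θ j` from the right. Absorbing those at `θ j` and
`θ 0` turns the angle `φ` into `φ - θ 0 + θ j`, for any `j`; by the design property the sum over `j`
is independent of `φ`. -/
theorem fixes_reflMat_halfAngle {m : ℕ} [NeZero m] {θ : Fin m → ℝ} (hθ : IsCircleDesign θ)
    {a b : κ → ℝ} (ha : a ⬝ᵥ a = 1) (hb : b ⬝ᵥ b = 1) (hab : a ⬝ᵥ b = 0)
    (hM : ∀ h, IsOrth (M h)) (τ : Fin m → (Ω ≃ Ω))
    (hτ : ∀ j h, M (τ j h) = M h * reflMat (halfAngle a b (θ j))) (φ : ℝ) :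
    D.Fixes M (reflMat (halfAngle a b φ)) := by
  refine ⟨isOrth_reflMat (halfAngle_dotProduct_self ha hb hab φ), fun N A hN hA => ?_⟩
  have hvec : ∀ ψ, D.toMat (reflMat (halfAngle a b ψ)) =
      reflMat (halfAngle (D.vec a) (D.vec b) ψ) := by
    intro ψ
    rw [D.toMat_reflMat, halfAngle, halfAngle, map_add, map_smul, map_smul]
  have step : ∀ ψ h, (N - D.toMat (M h * reflMat (halfAngle a b ψ)) * A *
      (D.toMat (M h * reflMat (halfAngle a b ψ)))ᵀ).det =
      ((D.toMat (M h))ᵀ * N * D.toMat (M h) - reflMat (halfAngle (D.vec a) (D.vec b) ψ) * A *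
        reflMat (halfAngle (D.vec a) (D.vec b) ψ)).det := by
    intro ψ h
    rw [← det_sub_conj (D.isOrth (hM h)), map_mul, hvec, transpose_mul, reflMat_transpose]
    simp only [Matrix.mul_assoc]
  have hsym : ∀ h, ((D.toMat (M h))ᵀ * N * D.toMat (M h)).IsSymm := by
    intro h
    have := hN.conj (D.toMat (M h))ᵀ
    rwa [transpose_transpose] at this
  have e1 : ∀ j, D.sumDet M N A = ∑ h, ((D.toMat (M h))ᵀ * N * D.toMat (M h) -
      reflMat (halfAngle (D.vec a) (D.vec b) (θ j)) * A *
        reflMat (halfAngle (D.vec a) (D.vec b) (θ j))).det := by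
    intro j
    rw [sumDet, ← (τ j).sum_comp]
    exact Finset.sum_congr rfl fun h _ => by rw [hτ, step]
  have e2 : ∀ j, D.sumDet M N (D.toMat (reflMat (halfAngle a b φ)) * A *
      (D.toMat (reflMat (halfAngle a b φ)))ᵀ) =
      ∑ h, ((D.toMat (M h))ᵀ * N * D.toMat (M h) -
      reflMat (halfAngle (D.vec a) (D.vec b) ((φ - θ 0) + θ j)) * A *
        reflMat (halfAngle (D.vec a) (D.vec b) ((φ - θ 0) + θ j))).det := by
    intro j
    rw [sumDet, ← ((τ j).trans (τ 0)).sum_comp]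
    refine Finset.sum_congr rfl fun h _ => ?_
    rw [← step, Equiv.trans_apply, hτ, hτ]
    have : φ - θ 0 + θ j = θ j - θ 0 + φ := by ring
    rw [this, ← reflMat_halfAngle_mul_mul ha hb hab]
    simp only [map_mul, transpose_mul, Matrix.mul_assoc]
  have e3 : ∑ j : Fin m, D.sumDet M N (D.toMat (reflMat (halfAngle a b φ)) * A *
      (D.toMat (reflMat (halfAngle a b φ)))ᵀ) = ∑ j : Fin m, D.sumDet M N A := by
    rw [Finset.sum_congr rfl fun j _ => e2 j, Finset.sum_congr rfl fun j _ => e1 j,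
      Finset.sum_comm, Finset.sum_comm (s := Finset.univ (α := Fin m)) (t := Finset.univ (α := Ω))]
    exact Finset.sum_congr rfl fun h _ => sum_det_sub_reflMat_halfAngle hθ (hsym h) hA _ _ _
  rw [Finset.sum_const, Finset.sum_const, Finset.card_univ, Fintype.card_fin] at e3
  exact nsmul_right_injective (NeZero.ne m) e3

/-- Among the matrices that fix the sum, which form a compact group, choose `Q` with the largest
component of `Q u` along `v`. No reflection in a plane of `v` and `b k` can improve it, so `Q u =
±v`, and the reflection in `u` is conjugate by `Q` to the one in `v`. -/
theorem fixes_reflMat_of_planes {I : Type*} {v : κ → ℝ} {b : I → κ → ℝ} (hv : v ⬝ᵥ v = 1)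
    (hvb : ∀ k, v ⬝ᵥ b k = 0)
    (hspan : ∀ w : κ → ℝ, (∀ k, w ⬝ᵥ b k = 0) → ∃ c : ℝ, w = c • v)
    (hfix : D.Fixes M (reflMat v))
    (hplane : ∀ k φ, D.Fixes M (reflMat (halfAngle v (b k) φ))) {u : κ → ℝ} (hu : u ⬝ᵥ u = 1) :
    D.Fixes M (reflMat u) := by
  obtain ⟨Q, hQ, hmax⟩ := (isCompact_fixes (D := D) (M := M)).exists_isMaxOn ⟨1, fixes_one⟩
    (f := fun Q : Matrix κ κ ℝ => (Q *ᵥ u) ⬝ᵥ v) (by fun_prop)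
  set w := Q *ᵥ u with hw
  have hww : w ⬝ᵥ w = 1 := by rw [hw, hQ.1.dotProduct_mulVec, hu]
  have horth : ∀ k, w ⬝ᵥ b k = 0 := by
    intro k
    by_contra hne
    -- The reflection at the angle `z.arg` carries the projection of `w` to this plane onto the ray
    -- of `v`; the new component along `v` is `‖z‖`.
    set z : ℂ := ⟨-(w ⬝ᵥ v), -(w ⬝ᵥ b k)⟩ with hz
    have hz0 : z ≠ 0 := by
      intro h0
      have := congrArg Complex.im h0
      simp [hz] at this
      exact hne this
    have hle := hmax (hplane k z.arg |>.mul hQ)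
    simp only [Set.mem_ofPred_eq, ← mulVec_mulVec, ← hw] at hle
    have hval : (reflMat (halfAngle v (b k) z.arg) *ᵥ w) ⬝ᵥ v =
        -(Real.cos z.arg * (w ⬝ᵥ v)) - Real.sin z.arg * (w ⬝ᵥ b k) := by
      have hbv : b k ⬝ᵥ v = 0 := by rw [dotProduct_comm, hvb]
      simp only [reflMat_halfAngle, sub_mulVec, add_mulVec, smul_mulVec, vecMulVec_mulVec,
        one_mulVec, sub_dotProduct, add_dotProduct, smul_dotProduct, op_smul_eq_smul, smul_eq_mul,
        hv, hbv, dotProduct_comm v w, dotProduct_comm (b k) w]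
      ring
    rw [hval, Complex.cos_arg hz0, Complex.sin_arg] at hle
    have hzpos : 0 < ‖z‖ := norm_pos_iff.2 hz0
    have hn : ‖z‖ ^ 2 = (w ⬝ᵥ v) ^ 2 + (w ⬝ᵥ b k) ^ 2 := by
      rw [Complex.sq_norm, Complex.normSq_apply, hz]
      ring
    have hle2 : ‖z‖ ≤ w ⬝ᵥ v := by
      refine le_of_eq_of_le ?_ hle
      have hre : z.re = -(w ⬝ᵥ v) := rfl
      have him : z.im = -(w ⬝ᵥ b k) := rfl
      rw [hre, him]
      field_simp
      linarith
    have := sq_nonneg (w ⬝ᵥ b k)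
    have h3 : (w ⬝ᵥ b k) ^ 2 = 0 := by nlinarith
    exact hne (pow_eq_zero_iff two_ne_zero |>.1 h3)
  obtain ⟨c, hc⟩ := hspan w horth
  have hc2 : c * c = 1 := by
    rw [hc, smul_dotProduct, dotProduct_smul, hv] at hww
    simpa using hww
  have href : reflMat w = reflMat v := by
    rw [hc, reflMat, reflMat, smul_vecMulVec, vecMulVec_smul, smul_smul c c, hc2, one_smul]
  rw [← hQ.1.conj_reflMat u, ← hw, href]
  exact (hQ.transpose.mul hfix).mul hQ

/-- Evaluate the double sum over both families in two ways. The sum over `M₁` absorbs each `M₂ g`.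
In the other order `M₁ h` moves over to `N`; as `M₂` is closed under transposition, exchanging `N`
and `A` costs only a sign, so the sum over `M₂` absorbs `M₁ h` too. -/
theorem sumDet_eq_of_fixes {Ω₁ Ω₂ : Type*} [Fintype Ω₁] [Fintype Ω₂] [Nonempty Ω₁]
    {M₁ : Ω₁ → Matrix κ κ ℝ} {M₂ : Ω₂ → Matrix κ κ ℝ} (h₁ : ∀ g, D.Fixes M₁ (M₂ g))
    (h₂ : ∀ h, D.Fixes M₂ (M₁ h)) (ι : Ω₂ ≃ Ω₂) (hι : ∀ g, M₂ (ι g) = (M₂ g)ᵀ)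
    {N A : Matrix n n ℝ} (hN : N.IsSymm) (hA : A.IsSymm) :
    Fintype.card Ω₂ * D.sumDet M₁ N A = Fintype.card Ω₁ * D.sumDet M₂ N A := by
  have hsw : ∀ N A : Matrix n n ℝ,
      D.sumDet M₂ N A = (-1) ^ Fintype.card n * D.sumDet M₂ A N := by
    intro N A
    rw [sumDet, sumDet, ← ι.sum_comp, Finset.mul_sum]
    refine Finset.sum_congr rfl fun g _ => ?_
    obtain ⟨h0⟩ := (inferInstance : Nonempty Ω₁)
    have ho : IsOrth (D.toMat (M₂ g)ᵀ) := D.isOrth (h₁ g).1.transpose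
    rw [hι, det_sub_conj ho, ← det_neg, neg_sub, D.toMat_transpose, transpose_transpose]
  calc Fintype.card Ω₂ * D.sumDet M₁ N A
      = ∑ g : Ω₂, D.sumDet M₁ N (D.toMat (M₂ g) * A * (D.toMat (M₂ g))ᵀ) := by
        rw [Finset.sum_congr rfl fun g _ => (h₁ g).2 N A hN hA]
        simp
    _ = ∑ h : Ω₁, D.sumDet M₂ ((D.toMat (M₁ h))ᵀ * N * D.toMat (M₁ h)) A := by
        simp only [sumDet]
        rw [Finset.sum_comm]
        refine Finset.sum_congr rfl fun h _ => Finset.sum_congr rfl fun g _ => ?_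
        rw [det_sub_conj (D.isOrth (h₂ h).1)]
    _ = ∑ h : Ω₁, D.sumDet M₂ N A := by
        refine Finset.sum_congr rfl fun h _ => ?_
        rw [hsw, hsw N A]
        congr 1
        have := (h₂ h).transpose.2 A N hA hN
        rwa [D.toMat_transpose, transpose_transpose] at this
    _ = Fintype.card Ω₁ * D.sumDet M₂ N A := by simp

end ReflHom

end Invariance

/-! ### Permutation matrices, signed permutations and the standard representation -/

section Permutations

open Matrix Equiv

variable {κ ρ n Ω : Type*} [Fintype κ] [DecidableEq κ] [Fintype ρ] [DecidableEq ρ] [Fintype n]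
  [DecidableEq n] [Fintype Ω]

/-- The matrix that takes the basis vector with index `j` to that with index `p j`. -/
def permMat : Perm κ →* Matrix κ κ ℝ where
  toFun p := of fun i j => if i = p j then 1 else 0
  map_one' := by
    ext i j
    simp [Matrix.one_apply]
    rfl
  map_mul' p q := by
    ext i j
    simp [Matrix.mul_apply]
    rfl

theorem permMat_apply (p : Perm κ) (i j : κ) : permMat p i j = if i = p j then 1 else 0 := rfl

theorem permMat_transpose (p : Perm κ) : (permMat p)ᵀ = permMat p⁻¹ := by
  ext i j
  simp only [transpose_apply, permMat_apply, Perm.eq_inv_iff_eq, eq_comm]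

theorem isOrth_permMat (p : Perm κ) : IsOrth (permMat p) := by
  rw [IsOrth, permMat_transpose, ← map_mul, inv_mul_cancel, map_one]

/-- The unit vector in the direction of the difference of two basis vectors. -/
noncomputable def rootVec (i j : κ) : κ → ℝ := (√2)⁻¹ • (Pi.single i 1 - Pi.single j 1)

theorem rootVec_dotProduct_self {i j : κ} (h : i ≠ j) : rootVec i j ⬝ᵥ rootVec i j = 1 := by
  have h2 : (√2)⁻¹ * (√2)⁻¹ = (2 : ℝ)⁻¹ := by
    rw [← mul_inv, Real.mul_self_sqrt (by norm_num)]
  simp only [rootVec, smul_dotProduct, dotProduct_smul, sub_dotProduct, dotProduct_sub,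
    single_one_dotProduct, smul_eq_mul, Pi.single_eq_same, Pi.single_eq_of_ne h,
    Pi.single_eq_of_ne h.symm]
  linear_combination 2 * h2

theorem reflMat_rootVec {i j : κ} (h : i ≠ j) : reflMat (rootVec i j) = permMat (swap i j) := by
  have h2 : (√2)⁻¹ * (√2)⁻¹ = (2 : ℝ)⁻¹ := by
    rw [← mul_inv, Real.mul_self_sqrt (by norm_num)]
  ext a b
  have : (reflMat (rootVec i j)) a b = (1 : Matrix κ κ ℝ) a b -
      (Pi.single i 1 - Pi.single j 1 : κ → ℝ) a * (Pi.single i 1 - Pi.single j 1 : κ → ℝ) b := by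
    simp only [reflMat, rootVec, Matrix.sub_apply, Matrix.smul_apply, vecMulVec_apply,
      Pi.smul_apply, smul_eq_mul]
    linear_combination (-2 * (Pi.single i 1 - Pi.single j 1 : κ → ℝ) a *
      (Pi.single i 1 - Pi.single j 1 : κ → ℝ) b) * h2
  rw [this, permMat_apply, Matrix.one_apply, swap_apply_def]
  simp only [Pi.sub_apply, Pi.single_apply]
  by_cases h1 : b = i
  · subst h1
    by_cases h3 : a = b
    · subst h3
      simp [h]
    · by_cases h4 : a = j <;> simp [h, h.symm, h3, h4]
  · by_cases h2 : b = j
    · subst h2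
      by_cases h3 : a = b
      · subst h3
        simp [h.symm]
      · by_cases h4 : a = i <;> simp [h.symm, h3, h4]
    · simp [h1, h2]

/-- Right multiplication by `Q` permutes the family of matrices `M`. -/
def RightStable (M : Ω → Matrix κ κ ℝ) (Q : Matrix κ κ ℝ) : Prop :=
  ∃ τ : Ω ≃ Ω, ∀ h, M (τ h) = M h * Q

theorem RightStable.mul {M : Ω → Matrix κ κ ℝ} {P Q : Matrix κ κ ℝ} (hP : RightStable M P)
    (hQ : RightStable M Q) : RightStable M (P * Q) := by
  obtain ⟨τ, hτ⟩ := hP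
  obtain ⟨τ', hτ'⟩ := hQ
  exact ⟨τ.trans τ', fun h => by rw [Equiv.trans_apply, hτ', hτ, Matrix.mul_assoc]⟩

namespace ReflHom

variable {D : ReflHom κ n} {M : Ω → Matrix κ κ ℝ}

theorem fixes_map_perm (h : ∀ u, u ⬝ᵥ u = 1 → D.Fixes M (reflMat u))
    (π : Perm ρ →* Matrix κ κ ℝ)
    (hπ : ∀ i j, i ≠ j → ∃ u, u ⬝ᵥ u = 1 ∧ π (swap i j) = reflMat u) (p : Perm ρ) :
    D.Fixes M (π p) := by
  induction p using Perm.swap_induction_on with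
  | one => rw [map_one]; exact fixes_one
  | swap_mul f x y hxy ih =>
    obtain ⟨u, hu, hu'⟩ := hπ x y hxy
    rw [map_mul, hu']
    exact (h u hu).mul ih

theorem fixes_diagonal (h : ∀ u, u ⬝ᵥ u = 1 → D.Fixes M (reflMat u)) (ε : κ → ℤˣ) :
    D.Fixes M (diagonal fun i => ((ε i : ℤ) : ℝ)) := by
  have key : ∀ s : Finset κ,
      D.Fixes M (diagonal fun i => if i ∈ s then ((ε i : ℤ) : ℝ) else 1) := by
    intro s
    induction s using Finset.induction_on with
    | empty => simpa using fixes_one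
    | insert a s ha ih =>
      rcases Int.units_eq_one_or (ε a) with he | he
      · convert ih using 3 with i
        by_cases hi : i = a
        · subst hi
          simp [he]
        · simp [hi]
      · have h1 := (h (Pi.single a 1) (by simp)).mul ih
        convert h1 using 1
        ext i j
        by_cases hij : i = j
        · subst hij
          by_cases hi : i = a
          · subst hi
            simp [reflMat, vecMulVec_apply, he, ha]
            norm_num
          · simp [reflMat, vecMulVec_apply, hi]
        · by_cases hi : i = a
          · subst hi
            simp [reflMat, vecMulVec_apply, hij, Ne.symm hij]
          · simp [reflMat, vecMulVec_apply, hi, hij]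
  simpa using key Finset.univ

end ReflHom

/-! #### Signed permutations -/

/-- The signed permutation matrices. -/
def signedMat (g : (κ → ℤˣ) × Perm κ) : Matrix κ κ ℝ :=
  diagonal (fun i => ((g.1 i : ℤ) : ℝ)) * permMat g.2

theorem signedMat_apply (g : (κ → ℤˣ) × Perm κ) (i j : κ) :
    signedMat g i j = if i = g.2 j then ((g.1 i : ℤ) : ℝ) else 0 := by
  simp [signedMat, permMat_apply]

theorem isOrth_diagonal_units (ε : κ → ℤˣ) : IsOrth (diagonal fun i => ((ε i : ℤ) : ℝ)) := by
  rw [IsOrth, diagonal_transpose, diagonal_mul_diagonal, ← diagonal_one]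
  congr 1
  funext i
  rcases Int.units_eq_one_or (ε i) with h | h <;> simp [h]

theorem isOrth_signedMat (g : (κ → ℤˣ) × Perm κ) : IsOrth (signedMat g) :=
  (isOrth_diagonal_units _).mul (isOrth_permMat _)

/-- Transposition of signed permutation matrices. -/
def signedInv : ((κ → ℤˣ) × Perm κ) ≃ ((κ → ℤˣ) × Perm κ) :=
  Function.Involutive.toPerm (fun g => (g.1 ∘ g.2, g.2⁻¹)) fun g => by
    ext i <;> simp

theorem signedMat_signedInv (g : (κ → ℤˣ) × Perm κ) :
    signedMat (signedInv g) = (signedMat g)ᵀ := by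
  ext i j
  change signedMat (g.1 ∘ g.2, g.2⁻¹) i j = _
  simp only [signedMat_apply, transpose_apply, Function.comp, Perm.eq_inv_iff_eq]
  by_cases h : j = g.2 i
  · simp [h]
  · simp [h, Ne.symm h]

theorem rightStable_signedMat_permMat (q : Perm κ) :
    RightStable (signedMat (κ := κ)) (permMat q) :=
  ⟨(Equiv.refl _).prodCongr (Equiv.mulRight q), fun g => by
    simp [signedMat, Matrix.mul_assoc]⟩

theorem rightStable_signedMat_single (a : κ) :
    RightStable (signedMat (κ := κ)) (reflMat (Pi.single a 1)) := by
  refine ⟨Function.Involutive.toPerm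
    (fun g => (Function.update g.1 (g.2 a) (-g.1 (g.2 a)), g.2)) fun g => by simp, fun g => ?_⟩
  ext i j
  change signedMat (Function.update g.1 (g.2 a) (-g.1 (g.2 a)), g.2) i j = _
  simp only [signedMat_apply, reflMat, Matrix.mul_sub,
    Matrix.mul_one, Matrix.mul_smul, Matrix.sub_apply, Matrix.smul_apply, mul_vecMulVec,
    vecMulVec_apply, mulVec_single_one, Matrix.col_apply, smul_eq_mul]
  by_cases hj : j = a
  · subst hj
    by_cases h : i = g.2 j
    · subst h
      simp
      ring
    · simp [h]
  · by_cases h : i = g.2 j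
    · subst h
      simp [hj]
    · simp [h, hj]

/-- In the plane of two basis vectors, the signed permutations include the reflections in both of
them and in their normalized sum and difference. The doubled angles are four equally spaced points.
-/
theorem ReflHom.fixes_signedMat (D : ReflHom κ n) {u : κ → ℝ} (hu : u ⬝ᵥ u = 1) :
    D.Fixes (signedMat (κ := κ)) (reflMat u) := by
  obtain ⟨a⟩ : Nonempty κ := by
    by_contra hne
    rw [not_nonempty_iff] at hne
    simp [dotProduct] at hu
  have hv : (Pi.single a 1 : κ → ℝ) ⬝ᵥ Pi.single a 1 = 1 := by simp
  refine ReflHom.fixes_reflMat_of_planes (I := {k // k ≠ a}) (v := Pi.single a 1)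
    (b := fun k => Pi.single k.1 1) hv (fun k => by simp [k.2.symm]) (fun w hw => ?_) ?_
    (fun k φ => ?_) hu
  · refine ⟨w a, ?_⟩
    ext i
    by_cases hi : i = a
    · subst hi
      simp
    · have := hw ⟨i, hi⟩
      rw [dotProduct_single_one] at this
      simp [this, hi]
  · obtain ⟨τ, hτ⟩ := rightStable_signedMat_single a
    exact ReflHom.fixes_of_equiv (isOrth_reflMat hv) τ hτ
  · have hb : (Pi.single k.1 1 : κ → ℝ) ⬝ᵥ Pi.single k.1 1 = 1 := by simp
    have hab : (Pi.single a 1 : κ → ℝ) ⬝ᵥ Pi.single k.1 1 = 0 := by simp [k.2.symm]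
    have e0 := rightStable_signedMat_single a
    have e2 := rightStable_signedMat_single k.1
    have e3 := rightStable_signedMat_permMat (swap a k.1)
    rw [← halfAngle_zero (Pi.single a 1) (Pi.single k.1 1)] at e0
    have h2 : halfAngle (Pi.single a 1) (Pi.single k.1 1) Real.pi = Pi.single k.1 (1 : ℝ) := by
      simp [halfAngle]
    have h3 : reflMat (halfAngle (Pi.single a 1) (Pi.single k.1 1) (-(Real.pi / 2))) =
        permMat (swap a k.1) := by
      rw [← reflMat_rootVec k.2.symm]
      congr 1
      have : -(Real.pi / 2) / 2 = -(Real.pi / 4) := by ring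
      rw [halfAngle, this, Real.cos_neg, Real.sin_neg, Real.cos_pi_div_four,
        Real.sin_pi_div_four, rootVec, smul_sub, neg_smul, ← sub_eq_add_neg,
        ← Real.sqrt_div_self]
    rw [← h2] at e2
    rw [← h3] at e3
    -- The angle `π / 2` is obtained as `0 - (-(π / 2)) + 0`.
    have e1 := (e0.mul e3).mul e0
    rw [reflMat_halfAngle_mul_mul hv hb hab] at e1
    have : ∀ j : Fin 4, RightStable (signedMat (κ := κ)) (reflMat (halfAngle (Pi.single a 1)
        (Pi.single k.1 1) (![0, Real.pi / 2, Real.pi, -(Real.pi / 2)] j))) := by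
      intro j
      fin_cases j
      · exact e0
      · simpa using e1
      · exact e2
      · exact e3
    choose τ hτ using this
    exact ReflHom.fixes_reflMat_halfAngle isCircleDesign_four hv hb hab isOrth_signedMat τ hτ φ

/-! #### The standard representation of a symmetric group -/

/-- The columns of `U` are an orthonormal basis of the orthogonal complement of the constant
vectors. -/
structure IsStdBasis (U : Matrix ρ κ ℝ) : Prop where
  transpose_mul : Uᵀ * U = 1
  sum_col : ∀ j, ∑ i, U i j = 0
  card : Fintype.card ρ = Fintype.card κ + 1

namespace IsStdBasis

variable {U : Matrix ρ κ ℝ} (hU : IsStdBasis U)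

/-- The square matrix that consists of a normalized constant column and of `U`. -/
noncomputable def full (U : Matrix ρ κ ℝ) : Matrix ρ (Unit ⊕ κ) ℝ :=
  of fun i => Sum.elim (fun _ => (√(Fintype.card ρ))⁻¹) (U i)

include hU

theorem full_transpose_mul : (full U)ᵀ * full U = 1 := by
  have hpos : (0 : ℝ) < Fintype.card ρ := by
    rw [hU.card]
    positivity
  have h := hU.transpose_mul
  ext (i | i) (j | j)
  · simp [full, Matrix.mul_apply]
    rw [← mul_inv, Real.mul_self_sqrt hpos.le, mul_inv_cancel₀ hpos.ne']
  · simp [full, Matrix.mul_apply, ← Finset.mul_sum, hU.sum_col]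
  · simp [full, Matrix.mul_apply, ← Finset.sum_mul, hU.sum_col]
  · have := congrFun (congrFun h i) j
    simpa [full, Matrix.mul_apply, Matrix.one_apply] using this

theorem full_mul_transpose : full U * (full U)ᵀ = 1 :=
  (mul_eq_one_comm_of_card_eq _ _ _ (by rw [hU.card]; simp [add_comm])).1 hU.full_transpose_mul

theorem mul_transpose : U * Uᵀ = 1 - (Fintype.card ρ : ℝ)⁻¹ • of fun _ _ => 1 := by
  rw [← hU.full_mul_transpose]
  ext i j
  have : (√(Fintype.card ρ : ℝ))⁻¹ * (√(Fintype.card ρ : ℝ))⁻¹ = (Fintype.card ρ : ℝ)⁻¹ := by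
    rw [← mul_inv, Real.mul_self_sqrt (by positivity)]
  simp [full, Matrix.mul_apply, this]

theorem mul_transpose_mulVec {z : ρ → ℝ} (hz : ∑ i, z i = 0) : (U * Uᵀ) *ᵥ z = z := by
  rw [hU.mul_transpose, sub_mulVec, one_mulVec, smul_mulVec]
  ext i
  simp [mulVec, dotProduct, hz]

theorem dotProduct_transpose_mulVec {z w : ρ → ℝ} (hz : ∑ i, z i = 0) :
    (Uᵀ *ᵥ z) ⬝ᵥ (Uᵀ *ᵥ w) = z ⬝ᵥ w := by
  rw [Matrix.dotProduct_mulVec, ← mulVec_transpose, transpose_transpose, mulVec_mulVec,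
    hU.mul_transpose_mulVec hz]

theorem conj_reflMat (z : ρ → ℝ) : Uᵀ * reflMat z * U = reflMat (Uᵀ *ᵥ z) := by
  rw [reflMat, Matrix.mul_sub, Matrix.sub_mul, Matrix.mul_one, hU.transpose_mul, Matrix.mul_smul,
    Matrix.smul_mul, mul_vecMulVec, vecMulVec_mul, ← mulVec_transpose, reflMat]

theorem permMat_mul (p : Perm ρ) : U * (Uᵀ * permMat p * U) = permMat p * U := by
  rw [← Matrix.mul_assoc, ← Matrix.mul_assoc, hU.mul_transpose, Matrix.sub_mul, Matrix.sub_mul,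
    Matrix.one_mul, sub_eq_self, Matrix.smul_mul, Matrix.smul_mul]
  ext i j
  have h1 : ∀ k, ∑ x, permMat p x k = 1 := by
    intro k
    simp [permMat_apply]
  simp [Matrix.mul_apply, h1, hU.sum_col]

end IsStdBasis

/-- The standard representation of a symmetric group, in the basis given by the columns of `U`. -/
noncomputable def stdRep {U : Matrix ρ κ ℝ} (hU : IsStdBasis U) : Perm ρ →* Matrix κ κ ℝ where
  toFun p := Uᵀ * permMat p * U
  map_one' := by rw [map_one, Matrix.mul_one, hU.transpose_mul]
  map_mul' p q := by
    rw [Matrix.mul_assoc (Uᵀ * permMat p) U, hU.permMat_mul q, map_mul]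
    simp only [Matrix.mul_assoc]

variable {U : Matrix ρ κ ℝ} (hU : IsStdBasis U)

theorem stdRep_apply (p : Perm ρ) : stdRep hU p = Uᵀ * permMat p * U := rfl

theorem stdRep_transpose (p : Perm ρ) : (stdRep hU p)ᵀ = stdRep hU p⁻¹ := by
  simp only [stdRep_apply, transpose_mul, transpose_transpose, permMat_transpose,
    Matrix.mul_assoc]

theorem isOrth_stdRep (p : Perm ρ) : IsOrth (stdRep hU p) := by
  rw [IsOrth, stdRep_transpose, ← map_mul, inv_mul_cancel, map_one]

theorem sum_rootVec (i j : ρ) : ∑ k, rootVec i j k = 0 := by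
  simp [rootVec, ← Finset.mul_sum]

theorem stdRep_swap {i j : ρ} (h : i ≠ j) :
    stdRep hU (swap i j) = reflMat (Uᵀ *ᵥ rootVec i j) := by
  rw [stdRep_apply, ← reflMat_rootVec h, hU.conj_reflMat]

theorem exists_stdRep_swap_eq_reflMat (i j : ρ) (h : i ≠ j) :
    ∃ u, u ⬝ᵥ u = 1 ∧ stdRep hU (swap i j) = reflMat u :=
  ⟨_, by rw [hU.dotProduct_transpose_mulVec (sum_rootVec i j), rootVec_dotProduct_self h],
    stdRep_swap hU h⟩

/-- A unit vector orthogonal to `rootVec i j` in the plane spanned by the roots on `i`, `j`, `k`. -/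
noncomputable def corootVec (i j k : ρ) : ρ → ℝ :=
  (√6)⁻¹ • (Pi.single i 1 + Pi.single j 1 - (2 : ℝ) • Pi.single k 1)

theorem halfAngle_root_pos {i j k : ρ} :
    halfAngle (rootVec i j) (corootVec i j k) (2 * Real.pi / 3) = rootVec i k := by
  have h1 : 2 * Real.pi / 3 / 2 = Real.pi / 3 := by ring
  have h6 : √6 = √2 * √3 := by rw [← Real.sqrt_mul (by norm_num)]; norm_num
  have h2 : √2 ≠ 0 := by positivity
  have h3 : √3 ≠ 0 := by positivity
  rw [halfAngle, h1, Real.cos_pi_div_three, Real.sin_pi_div_three]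
  ext x
  simp only [rootVec, corootVec, Pi.add_apply, Pi.sub_apply, Pi.smul_apply, smul_eq_mul, h6]
  field_simp
  ring

theorem halfAngle_root_neg {i j k : ρ} :
    halfAngle (rootVec i j) (corootVec i j k) (-(2 * Real.pi / 3)) = rootVec k j := by
  have h1 : -(2 * Real.pi / 3) / 2 = -(Real.pi / 3) := by ring
  have h6 : √6 = √2 * √3 := by rw [← Real.sqrt_mul (by norm_num)]; norm_num
  have h2 : √2 ≠ 0 := by positivity
  have h3 : √3 ≠ 0 := by positivity
  rw [halfAngle, h1, Real.cos_neg, Real.sin_neg, Real.cos_pi_div_three, Real.sin_pi_div_three]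
  ext x
  simp only [rootVec, corootVec, Pi.add_apply, Pi.sub_apply, Pi.smul_apply, smul_eq_mul, h6]
  field_simp
  ring

theorem corootVec_dotProduct_self {i j k : ρ} (hij : i ≠ j) (hik : i ≠ k) (hjk : j ≠ k) :
    corootVec i j k ⬝ᵥ corootVec i j k = 1 := by
  have h2 : (√6)⁻¹ * (√6)⁻¹ = (6 : ℝ)⁻¹ := by
    rw [← mul_inv, Real.mul_self_sqrt (by norm_num)]
  simp only [corootVec, smul_dotProduct, dotProduct_smul, sub_dotProduct, dotProduct_sub,
    add_dotProduct, dotProduct_add, single_one_dotProduct, smul_eq_mul, Pi.single_eq_same,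
    Pi.single_eq_of_ne hij, Pi.single_eq_of_ne hij.symm, Pi.single_eq_of_ne hik,
    Pi.single_eq_of_ne hik.symm, Pi.single_eq_of_ne hjk, Pi.single_eq_of_ne hjk.symm]
  linear_combination 6 * h2

theorem rootVec_dotProduct_corootVec {i j k : ρ} (hij : i ≠ j) (hik : i ≠ k) (hjk : j ≠ k) :
    rootVec i j ⬝ᵥ corootVec i j k = 0 := by
  simp only [rootVec, corootVec, smul_dotProduct, dotProduct_smul, sub_dotProduct, dotProduct_sub,
    dotProduct_add, single_one_dotProduct, smul_eq_mul, Pi.single_eq_same,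
    Pi.single_eq_of_ne hij, Pi.single_eq_of_ne hij.symm, Pi.single_eq_of_ne hik,
    Pi.single_eq_of_ne hjk]
  ring

theorem sum_corootVec (i j k : ρ) : ∑ x, corootVec i j k x = 0 := by
  simp [corootVec, ← Finset.mul_sum, Finset.sum_add_distrib]
  norm_num

/-- Orthogonality makes every other coordinate equal to the mean of `z x` and `z y`; as the
coordinates sum to zero, this mean is zero. -/
theorem eq_smul_rootVec {x y : ρ} (hxy : x ≠ y) {z : ρ → ℝ} (hz : ∑ i, z i = 0)
    (h : ∀ k, k ≠ x → k ≠ y → z ⬝ᵥ corootVec x y k = 0) :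
    z = (z x * √2) • rootVec x y := by
  have h1 : ∀ k, k ≠ x → k ≠ y → z k = (z x + z y) / 2 := by
    intro k hx hy
    have := h k hx hy
    simp only [corootVec, dotProduct_smul, dotProduct_sub, dotProduct_add, dotProduct_single_one,
      smul_eq_mul] at this
    have h6 : (√6)⁻¹ ≠ (0 : ℝ) := by positivity
    have := (mul_eq_zero.1 this).resolve_left h6
    linarith
  have h2 : ∑ i, (z i - (z x + z y) / 2) = 0 := by
    rw [← Finset.add_sum_erase _ _ (Finset.mem_univ x), ← Finset.add_sum_erase _ _
      (Finset.mem_erase.2 ⟨hxy.symm, Finset.mem_univ y⟩), Finset.sum_eq_zero]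
    · ring
    · intro k hk
      simp only [Finset.mem_erase] at hk
      rw [h1 k hk.2.1 hk.1, sub_self]
  rw [Finset.sum_sub_distrib, hz, Finset.sum_const, nsmul_eq_mul, zero_sub, neg_eq_zero] at h2
  have hpos : (0 : ℝ) < (Finset.univ : Finset ρ).card := by
    exact_mod_cast Finset.card_pos.2 ⟨x, Finset.mem_univ x⟩
  have h3 := (mul_eq_zero.1 h2).resolve_left hpos.ne'
  have h4 : √2 ≠ 0 := by positivity
  ext k
  simp only [rootVec, Pi.smul_apply, Pi.sub_apply, smul_eq_mul]
  by_cases hx : k = x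
  · subst hx
    simp [hxy]
  · by_cases hy : k = y
    · subst hy
      simp [hxy.symm]
      field_simp
      linarith
    · simp [hx, hy, h1 k hx hy, h3]

/-- The three transpositions of `x`, `y`, `k` act as reflections in roots that lie in one plane, and
the doubled angles of these roots are equally spaced. -/
theorem ReflHom.fixes_stdRep (D : ReflHom κ n) {u : κ → ℝ} (hu : u ⬝ᵥ u = 1) :
    D.Fixes (stdRep hU) (reflMat u) := by
  have hκ : Nonempty κ := by
    by_contra hne
    rw [not_nonempty_iff] at hne
    simp [dotProduct] at hu
  have hc : 1 < Fintype.card ρ := by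
    have := Fintype.card_pos_iff.2 hκ
    have := hU.card
    omega
  obtain ⟨x, y, hxy⟩ := Fintype.one_lt_card_iff.1 hc
  have hstab : ∀ i j, i ≠ j → RightStable (stdRep hU) (reflMat (Uᵀ *ᵥ rootVec i j)) := by
    intro i j hij
    refine ⟨Equiv.mulRight (swap i j), fun h => ?_⟩
    rw [Equiv.coe_mulRight, map_mul, stdRep_swap hU hij]
  have hv : (Uᵀ *ᵥ rootVec x y) ⬝ᵥ (Uᵀ *ᵥ rootVec x y) = 1 := by
    rw [hU.dotProduct_transpose_mulVec (sum_rootVec x y), rootVec_dotProduct_self hxy]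
  refine ReflHom.fixes_reflMat_of_planes (I := {k // k ≠ x ∧ k ≠ y}) (v := Uᵀ *ᵥ rootVec x y)
    (b := fun k => Uᵀ *ᵥ corootVec x y k.1) hv (fun k => ?_) (fun w hw => ?_) ?_
    (fun k φ => ?_) hu
  · rw [hU.dotProduct_transpose_mulVec (sum_rootVec x y),
      rootVec_dotProduct_corootVec hxy k.2.1.symm k.2.2.symm]
  · have h1 := eq_smul_rootVec hxy (z := U *ᵥ w) ?_ ?_
    · have h2 := congrArg (Uᵀ *ᵥ ·) h1
      simp only [mulVec_mulVec, hU.transpose_mul, one_mulVec, mulVec_smul] at h2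
      exact ⟨_, h2⟩
    · simp only [mulVec, dotProduct]
      rw [Finset.sum_comm]
      simp [← Finset.sum_mul, hU.sum_col]
    · intro k hx hy
      have := hw ⟨k, hx, hy⟩
      rwa [Matrix.dotProduct_mulVec, ← mulVec_transpose, transpose_transpose] at this
  · obtain ⟨τ, hτ⟩ := hstab x y hxy
    exact ReflHom.fixes_of_equiv (isOrth_reflMat hv) τ hτ
  · have hang : ∀ ψ, halfAngle (Uᵀ *ᵥ rootVec x y) (Uᵀ *ᵥ corootVec x y k.1) ψ =
        Uᵀ *ᵥ halfAngle (rootVec x y) (corootVec x y k.1) ψ := by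
      intro ψ
      rw [halfAngle, halfAngle, mulVec_add, mulVec_smul, mulVec_smul]
    have : ∀ j : Fin 3, RightStable (stdRep hU) (reflMat (halfAngle (Uᵀ *ᵥ rootVec x y)
        (Uᵀ *ᵥ corootVec x y k.1) (![0, 2 * Real.pi / 3, -(2 * Real.pi / 3)] j))) := by
      intro j
      rw [hang]
      fin_cases j
      · simpa [halfAngle_zero] using hstab x y hxy
      · simpa [halfAngle_root_pos] using hstab x k.1 k.2.1.symm
      · simpa [halfAngle_root_neg] using hstab k.1 y k.2.2
    choose τ hτ using this
    refine ReflHom.fixes_reflMat_halfAngle isCircleDesign_three hv ?_ ?_ (isOrth_stdRep hU) τ hτ φ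
    · rw [hU.dotProduct_transpose_mulVec (sum_corootVec x y k.1),
        corootVec_dotProduct_self hxy k.2.1.symm k.2.2.symm]
    · rw [hU.dotProduct_transpose_mulVec (sum_rootVec x y),
        rootVec_dotProduct_corootVec hxy k.2.1.symm k.2.2.symm]

/-- Each sum is invariant under all reflections, and each group consists of products of reflections;
so each sum is invariant under the other group. -/
theorem ReflHom.sumDet_stdRep (D : ReflHom κ n) {N A : Matrix n n ℝ} (hN : N.IsSymm)
    (hA : A.IsSymm) :
    Fintype.card ((κ → ℤˣ) × Perm κ) * D.sumDet (stdRep hU) N A =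
      Fintype.card (Perm ρ) * D.sumDet signedMat N A := by
  refine ReflHom.sumDet_eq_of_fixes (fun g => ?_) (fun h => ?_) signedInv signedMat_signedInv hN hA
  · rw [signedMat]
    refine (ReflHom.fixes_diagonal (fun u hu => D.fixes_stdRep hU hu) _).mul
      (ReflHom.fixes_map_perm (fun u hu => D.fixes_stdRep hU hu) permMat (fun i j hij => ?_) _)
    exact ⟨_, rootVec_dotProduct_self hij, (reflMat_rootVec hij).symm⟩
  · exact ReflHom.fixes_map_perm (fun u hu => D.fixes_signedMat hu) _
      (exists_stdRep_swap_eq_reflMat hU) _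

end Permutations

/-! ### Expected characteristic polynomials of random signings -/

section Matching

open Matrix

variable {n ι : Type*} [Fintype n] [DecidableEq n] [Fintype ι] [DecidableEq ι]

/-- The principal minor of `Y` with rows and columns in `S`. -/
def principalMinor (Y : Matrix n n ℝ) (S : Finset n) : ℝ :=
  (of fun i j => if i ∈ S then Y i j else (1 : Matrix n n ℝ) i j).det

/-- The adjacency matrix of an edge. -/
def edgeMat (a b : n) : Matrix n n ℝ := single a b 1 + single b a 1

/-- At most two rows depend on `t`. The coefficient of `t ^ 2` gets its sign from exchanging rows
`a` and `b`; the value of `c` is irrelevant, as it cancels between the two signs of the edge. -/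
theorem exists_principalMinor_add_smul_edgeMat (Y : Matrix n n ℝ) (S : Finset n) {a b : n}
    (hab : a ≠ b) : ∃ c, ∀ t : ℝ, principalMinor (Y + t • edgeMat a b) S =
      principalMinor Y S + t * c -
        t ^ 2 * if {a, b} ⊆ S then principalMinor Y (S \ {a, b}) else 0 := by
  set M : Matrix n n ℝ := of fun i j => if i ∈ S then Y i j else (1 : Matrix n n ℝ) i j with hM
  have one : ∀ {a b : n}, a ≠ b → a ∈ S → b ∉ S → ∀ t : ℝ,
      principalMinor (Y + t • (single a b 1 + single b a 1)) S =
        principalMinor Y S + t * (M.updateRow a (Pi.single b 1)).det := by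
    intro a b hab ha hb t
    have : (of fun i j => if i ∈ S then (Y + t • (single a b 1 + single b a 1) : Matrix n n ℝ) i j
        else (1 : Matrix n n ℝ) i j) = M.updateRow a (M a + t • Pi.single b 1) := by
      ext i j
      by_cases hi : i = a
      · subst hi
        simp [hM, ha, single_apply, Pi.single_apply, hab.symm, eq_comm]
      · by_cases hib : i = b
        · subst hib
          simp [hM, hb, hi]
        · simp [hM, hi, single_apply, Ne.symm hi, Ne.symm hib]
    rw [principalMinor, this, det_updateRow_add, det_updateRow_smul]
    congr 2
    ext i j
    by_cases hi : i = a
    · subst hi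
      simp [hM]
    · simp [hM, hi]
  by_cases ha : a ∈ S
  · by_cases hb : b ∈ S
    · refine ⟨(M.updateRow b (Pi.single a 1)).det + (M.updateRow a (Pi.single b 1)).det,
        fun t => ?_⟩
      have h1 : (of fun i j => if i ∈ S then (Y + t • edgeMat a b) i j
          else (1 : Matrix n n ℝ) i j) =
          (M.updateRow a (M a + t • Pi.single b 1)).updateRow b (M b + t • Pi.single a 1) := by
        ext i j
        by_cases hi : i = a
        · subst hi
          simp [hM, ha, edgeMat, single_apply, Pi.single_apply, hab, hab.symm, eq_comm]
        · by_cases hib : i = b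
          · subst hib
            simp [hM, hb, edgeMat, single_apply, Pi.single_apply, hab, eq_comm]
          · simp [hM, hi, hib, edgeMat, single_apply, Ne.symm hi, Ne.symm hib]
      have h2 : ((M.updateRow a (Pi.single b 1)).updateRow b (Pi.single a 1)).det =
          -principalMinor Y (S \ {a, b}) := by
        have h3 : ((M.updateRow a (Pi.single b 1)).updateRow b (Pi.single a 1)) =
            (of fun i j => if i ∈ S \ {a, b} then Y i j else (1 : Matrix n n ℝ) i j).submatrix
              (Equiv.swap a b) id := by
          ext i j
          by_cases hi : i = a
          · subst hi
            simp [hab, Matrix.one_apply, Pi.single_apply, eq_comm]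
          · by_cases hib : i = b
            · subst hib
              simp [Matrix.one_apply, Pi.single_apply, eq_comm]
            · simp [hM, hi, hib, Equiv.swap_apply_of_ne_of_ne hi hib]
        rw [h3, det_permute, Equiv.Perm.sign_swap hab]
        simp [principalMinor]
      have h4 : M.updateRow a (M a) = M := updateRow_eq_self M a
      have h5 : M.updateRow b (M b) = M := updateRow_eq_self M b
      have h6 : (M.updateRow a (Pi.single b 1)).updateRow b (M b) =
          M.updateRow a (Pi.single b 1) := by
        have := updateRow_eq_self (M.updateRow a (Pi.single b 1)) b
        rwa [updateRow_ne hab.symm] at this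
      have h7 : principalMinor Y S = M.det := rfl
      rw [principalMinor, h1, det_updateRow_add, det_updateRow_smul, updateRow_comm _ hab,
        updateRow_comm _ hab, det_updateRow_add, det_updateRow_smul, det_updateRow_add,
        det_updateRow_smul, ← updateRow_comm _ hab, ← updateRow_comm _ hab,
        ← updateRow_comm _ hab, ← updateRow_comm _ hab, h4, h5, h6, h2, h7,
        if_pos (by simp [Finset.insert_subset_iff, ha, hb])]
      ring
    · refine ⟨(M.updateRow a (Pi.single b 1)).det, fun t => ?_⟩
      rw [if_neg (by simp [Finset.insert_subset_iff, hb]), edgeMat, one hab ha hb t, mul_zero,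
        sub_zero]
  · rw [if_neg (by simp [Finset.insert_subset_iff, ha])]
    by_cases hb : b ∈ S
    · refine ⟨(M.updateRow b (Pi.single a 1)).det, fun t => ?_⟩
      rw [edgeMat, add_comm (single a b 1), one hab.symm hb ha t, mul_zero, sub_zero]
    · refine ⟨0, fun t => ?_⟩
      rw [mul_zero, mul_zero, add_zero, sub_zero, principalMinor, principalMinor]
      congr 1
      ext i j
      by_cases hi : i ∈ S
      · have h1 : i ≠ a := by rintro rfl; exact ha hi
        have h2 : i ≠ b := by rintro rfl; exact hb hi
        simp [hi, edgeMat, single_apply, h1.symm, h2.symm]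
      · simp [hi]

variable (a b : ι → n)

/-- The sum over all signings of the principal minors of `x - A`, where `A` is the signed adjacency
matrix of the graph with the edges in `s`. -/
def signingSum (x : ℝ) (s : Finset ι) (S : Finset n) : ℝ :=
  ∑ δ : ι → ℤˣ, principalMinor
    (x • 1 - ∑ i ∈ s, ((δ i : ℤ) : ℝ) • edgeMat (a i) (b i)) S

theorem signingSum_empty (x : ℝ) (S : Finset n) :
    signingSum a b x ∅ S = Fintype.card (ι → ℤˣ) * x ^ S.card := by
  have : principalMinor (x • 1 : Matrix n n ℝ) S = x ^ S.card := by
    have h : (of fun i j => if i ∈ S then (x • 1 : Matrix n n ℝ) i j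
        else (1 : Matrix n n ℝ) i j) = diagonal fun i => if i ∈ S then x else 1 := by
      ext i j
      by_cases hij : i = j
      · subst hij
        simp
      · simp [hij]
    rw [principalMinor, h, det_diagonal, Finset.prod_ite_mem, Finset.univ_inter,
      Finset.prod_const]
  simp [signingSum, this]

variable {a b}

/-- Pairing each signing with its flip at `i` removes the linear term. This is the edge recursion of
matching polynomials. -/
theorem signingSum_insert {i : ι} (hab : a i ≠ b i) (x : ℝ) {s : Finset ι} (hi : i ∉ s)
    (S : Finset n) : signingSum a b x (insert i s) S = signingSum a b x s S -
      if {a i, b i} ⊆ S then signingSum a b x s (S \ {a i, b i}) else 0 := by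
  set f : (ι → ℤˣ) → ℝ := fun δ => principalMinor
    (x • 1 - ∑ i ∈ insert i s, ((δ i : ℤ) : ℝ) • edgeMat (a i) (b i)) S with hf
  have hinv : Function.Involutive fun δ : ι → ℤˣ => Function.update δ i (-δ i) :=
    fun δ => by simp
  have h1 : ∑ δ, f δ = ∑ δ, f (Function.update δ i (-δ i)) :=
    (Equiv.sum_comp (hinv.toPerm _) f).symm
  have h2 : ∀ δ, f δ + f (Function.update δ i (-δ i)) = 2 * (principalMinor
      (x • 1 - ∑ i ∈ s, ((δ i : ℤ) : ℝ) • edgeMat (a i) (b i)) S -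
      if {a i, b i} ⊆ S then principalMinor
        (x • 1 - ∑ i ∈ s, ((δ i : ℤ) : ℝ) • edgeMat (a i) (b i)) (S \ {a i, b i}) else 0) := by
    intro δ
    set Y := x • 1 - ∑ i ∈ s, ((δ i : ℤ) : ℝ) • edgeMat (a i) (b i) with hY
    obtain ⟨c, hc⟩ := exists_principalMinor_add_smul_edgeMat Y S hab
    have e1 : f δ = principalMinor (Y + (-((δ i : ℤ) : ℝ)) • edgeMat (a i) (b i)) S := by
      simp only [hf]
      rw [Finset.sum_insert hi, hY]
      congr 1
      rw [neg_smul]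
      abel
    have e2 : f (Function.update δ i (-δ i)) =
        principalMinor (Y + ((δ i : ℤ) : ℝ) • edgeMat (a i) (b i)) S := by
      simp only [hf]
      rw [Finset.sum_insert hi, hY, Function.update_self]
      have : ∑ x ∈ s, ((Function.update δ i (-δ i) x : ℤ) : ℝ) • edgeMat (a x) (b x) =
          ∑ x ∈ s, ((δ x : ℤ) : ℝ) • edgeMat (a x) (b x) :=
        Finset.sum_congr rfl fun j hj => by
          rw [Function.update_of_ne (by rintro rfl; exact hi hj)]
      rw [this]
      congr 1
      push_cast
      rw [neg_smul]
      abel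
    have e3 : ((δ i : ℤ) : ℝ) ^ 2 = 1 := by
      rcases Int.units_eq_one_or (δ i) with h | h <;> simp [h]
    rw [e1, e2, hc, hc, neg_sq, e3]
    ring
  have h3 : 2 * ∑ δ, f δ = 2 * (signingSum a b x s S -
      if {a i, b i} ⊆ S then signingSum a b x s (S \ {a i, b i}) else 0) := by
    have : 2 * ∑ δ, f δ = ∑ δ, (f δ + f (Function.update δ i (-δ i))) := by
      rw [Finset.sum_add_distrib, ← h1]
      ring
    rw [this, Finset.sum_congr rfl fun δ _ => h2 δ, ← Finset.mul_sum, Finset.sum_sub_distrib]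
    congr 2
    by_cases h : {a i, b i} ⊆ S <;> simp [h, signingSum]
  exact mul_left_cancel₀ two_ne_zero h3

/-- The vertex recursion of matching polynomials, deduced from the edge recursion by adding the
edges one at a time. -/
theorem signingSum_erase (x : ℝ) (s : Finset ι) (hab : ∀ i ∈ s, a i ≠ b i) {S : Finset n} {v : n}
    (hv : v ∈ S) : signingSum a b x s S = x * signingSum a b x s (S.erase v) -
      ∑ i ∈ s with v ∈ ({a i, b i} : Finset n) ∧ {a i, b i} ⊆ S,
        signingSum a b x s (S \ {a i, b i}) := by
  induction s using Finset.induction_on generalizing S with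
  | empty =>
    rw [signingSum_empty, signingSum_empty, ← Finset.card_erase_add_one hv]
    simp [pow_succ]
    ring
  | insert j s hj ih =>
    replace ih := @ih fun i hi => hab i (Finset.mem_insert_of_mem hi)
    by_cases hvj : v ∈ ({a j, b j} : Finset n)
    · have h1 : ∀ T : Finset n, v ∉ T →
          signingSum a b x (insert j s) T = signingSum a b x s T := by
        intro T hT
        rw [signingSum_insert (hab j (Finset.mem_insert_self j s)) x hj, if_neg (fun h => hT (h hvj)), sub_zero]
      have h2 : ∀ t : Finset ι, ∑ i ∈ t with v ∈ ({a i, b i} : Finset n) ∧ {a i, b i} ⊆ S,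
          signingSum a b x (insert j s) (S \ {a i, b i}) =
          ∑ i ∈ t with v ∈ ({a i, b i} : Finset n) ∧ {a i, b i} ⊆ S,
          signingSum a b x s (S \ {a i, b i}) := fun t =>
        Finset.sum_congr rfl fun i hi => h1 _ (by
          rw [Finset.mem_sdiff]
          exact fun h => h.2 (Finset.mem_filter.1 hi).2.1)
      rw [h2, h1 _ (Finset.notMem_erase v S), signingSum_insert (hab j (Finset.mem_insert_self j s)) x hj, ih hv,
        Finset.filter_insert]
      by_cases h : {a j, b j} ⊆ S
      · rw [if_pos h, if_pos ⟨hvj, h⟩, Finset.sum_insert (by simp [hj])]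
        ring
      · rw [if_neg h, if_neg (fun h' => h h'.2)]
        ring
    · rw [Finset.filter_insert, if_neg (fun h => hvj h.1), signingSum_insert (hab j (Finset.mem_insert_self j s)) x hj, ih hv,
        signingSum_insert (hab j (Finset.mem_insert_self j s)) x hj]
      have h1 : {a j, b j} ⊆ S.erase v ↔ {a j, b j} ⊆ S := by
        rw [Finset.subset_erase]
        exact and_iff_left hvj
      have h2 : ∀ i ∈ s.filter fun i => v ∈ ({a i, b i} : Finset n) ∧ {a i, b i} ⊆ S,
          signingSum a b x (insert j s) (S \ {a i, b i}) =
          signingSum a b x s (S \ {a i, b i}) -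
            if {a j, b j} ⊆ S ∧ {a i, b i} ⊆ S \ {a j, b j} then
              signingSum a b x s ((S \ {a j, b j}) \ {a i, b i}) else 0 := by
        intro i hi
        have hi' := (Finset.mem_filter.1 hi).2.2
        rw [signingSum_insert (hab j (Finset.mem_insert_self j s)) x hj, sdiff_right_comm]
        congr 2
        rw [Finset.subset_sdiff, Finset.subset_sdiff, disjoint_comm, eq_iff_iff]
        tauto
      rw [Finset.sum_congr rfl h2, Finset.sum_sub_distrib]
      simp only [h1]
      by_cases h : {a j, b j} ⊆ S
      · rw [if_pos h, if_pos h, ih (Finset.mem_sdiff.2 ⟨hv, hvj⟩)]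
        simp only [h, true_and]
        rw [← Finset.sum_filter, Finset.filter_filter, Finset.erase_sdiff_comm]
        have : (s.filter fun i => (v ∈ ({a i, b i} : Finset n) ∧ {a i, b i} ⊆ S) ∧
            {a i, b i} ⊆ S \ {a j, b j}) =
            s.filter fun i => v ∈ ({a i, b i} : Finset n) ∧ {a i, b i} ⊆ S \ {a j, b j} := by
          refine Finset.filter_congr fun i _ => ?_
          have : {a i, b i} ⊆ S \ {a j, b j} → {a i, b i} ⊆ S := fun h =>
            h.trans Finset.sdiff_subset
          tauto
        rw [this]
        ring
      · simp [h]

/-- The Heilmann–Lieb bound. -/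
theorem signingSum_pos {x τ : ℝ} {k : ℕ} (hτ : 0 < τ)
    (h1 : τ + ((k - 1 : ℕ) : ℝ) / τ ≤ x) (h2 : k / τ < x) (s : Finset ι)
    (hab : ∀ i ∈ s, a i ≠ b i)
    (hdeg : ∀ v, (s.filter fun i => v ∈ ({a i, b i} : Finset n)).card ≤ k) (S : Finset n) :
    0 < signingSum a b x s S := by
  -- The induction also carries a lower bound `τ` for the ratio of the values at `S` and `S.erase
  -- v`, at vertices with at most `k - 1` edges inside `S`.
  suffices H : ∀ m : ℕ, ∀ S : Finset n, S.card = m → 0 < signingSum a b x s S ∧ ∀ v ∈ S,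
      (s.filter fun i => v ∈ ({a i, b i} : Finset n) ∧ {a i, b i} ⊆ S).card ≤ k - 1 →
      τ * signingSum a b x s (S.erase v) ≤ signingSum a b x s S from (H _ S rfl).1
  intro m
  induction m with
  | zero =>
    intro S hS
    rw [Finset.card_eq_zero] at hS
    subst hS
    refine ⟨?_, by simp⟩
    have h : ∀ Y : Matrix n n ℝ, principalMinor Y ∅ = 1 := by
      intro Y
      simp only [principalMinor, Finset.notMem_empty, if_false]
      exact det_one
    simp only [signingSum, h, Finset.sum_const, Finset.card_univ, nsmul_eq_mul, mul_one]
    exact_mod_cast Fintype.card_pos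
  | succ m ih =>
    intro S hS
    have key : ∀ v ∈ S, 0 < signingSum a b x s (S.erase v) ∧
        (x - ((s.filter fun i => v ∈ ({a i, b i} : Finset n) ∧ {a i, b i} ⊆ S).card : ℝ) / τ) *
          signingSum a b x s (S.erase v) ≤ signingSum a b x s S := by
      intro v hv
      have hc : (S.erase v).card = m := by
        rw [Finset.card_erase_of_mem hv, hS]
        rfl
      obtain ⟨i1, i2⟩ := ih _ hc
      refine ⟨i1, ?_⟩
      rw [signingSum_erase x s hab hv, sub_mul]
      refine sub_le_sub_left ?_ _
      have : ∀ i ∈ s.filter fun i => v ∈ ({a i, b i} : Finset n) ∧ {a i, b i} ⊆ S,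
          signingSum a b x s (S \ {a i, b i}) ≤ signingSum a b x s (S.erase v) / τ := by
        intro i hi
        obtain ⟨his, hvi, hiS⟩ := Finset.mem_filter.1 hi
        obtain ⟨w, hwv, hw⟩ : ∃ w, w ≠ v ∧ ({a i, b i} : Finset n) = {v, w} := by
          rcases Finset.mem_insert.1 hvi with h | h
          · exact ⟨b i, by rw [h]; exact (hab i his).symm, by rw [h]⟩
          · rw [Finset.mem_singleton] at h
            exact ⟨a i, by rw [h]; exact hab i his, by rw [h, Finset.pair_comm]⟩
        rw [hw] at hiS
        have hwS : w ∈ S.erase v := Finset.mem_erase.2 ⟨hwv, hiS (by simp)⟩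
        have hdel : S \ {a i, b i} = (S.erase v).erase w := by
          rw [hw]
          ext y
          simp only [Finset.mem_sdiff, Finset.mem_insert, Finset.mem_singleton, Finset.mem_erase]
          tauto
        rw [hdel, le_div_iff₀ hτ, mul_comm]
        -- Once `v` is removed, `w` has lost the edge `i`, so the ratio bound applies to it.
        refine i2 w hwS (Nat.le_sub_one_of_lt ?_)
        refine lt_of_lt_of_le (Finset.card_lt_card ?_) (hdeg w)
        refine (Finset.ssubset_iff_of_subset ?_).2 ⟨i, ?_, ?_⟩
        · exact fun y hy => by
            rw [Finset.mem_filter] at hy ⊢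
            exact ⟨hy.1, hy.2.1⟩
        · rw [Finset.mem_filter, hw]
          exact ⟨his, by simp⟩
        · rw [Finset.mem_filter, hw]
          exact fun h => Finset.notMem_erase v S (h.2.2 (by simp))
      refine (Finset.sum_le_card_nsmul _ _ _ this).trans (le_of_eq ?_)
      rw [nsmul_eq_mul]
      ring
    refine ⟨?_, fun v hv hd => ?_⟩
    · obtain ⟨v, hv⟩ : S.Nonempty := Finset.card_pos.1 (by omega)
      obtain ⟨k1, k2⟩ := key v hv
      refine lt_of_lt_of_le (mul_pos (sub_pos.2 (lt_of_le_of_lt ?_ h2)) k1) k2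
      gcongr
      refine (Finset.card_le_card fun y hy => ?_).trans (hdeg v)
      rw [Finset.mem_filter] at hy ⊢
      exact ⟨hy.1, hy.2.1⟩
    · obtain ⟨k1, k2⟩ := key v hv
      refine le_trans (mul_le_mul_of_nonneg_right ?_ k1.le) k2
      have : ((s.filter fun i => v ∈ ({a i, b i} : Finset n) ∧ {a i, b i} ⊆ S).card : ℝ) / τ ≤
          ((k - 1 : ℕ) : ℝ) / τ := by
        gcongr
      linarith

/-- The spectral radius of the `k`-regular tree. -/
noncomputable def treeBound (k : ℕ) : ℝ := if k ≤ 1 then k else 2 * √(k - 1)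

theorem sum_signing_det_pos {x : ℝ} {k : ℕ} (hx : treeBound k < x)
    (s : Finset ι) (hab : ∀ i ∈ s, a i ≠ b i)
    (hdeg : ∀ v, (s.filter fun i => v ∈ ({a i, b i} : Finset n)).card ≤ k) :
    0 < ∑ δ : ι → ℤˣ, (x • 1 - ∑ i ∈ s, ((δ i : ℤ) : ℝ) • edgeMat (a i) (b i)).det := by
  have huniv : ∀ Y : Matrix n n ℝ, principalMinor Y Finset.univ = Y.det := by
    intro Y
    simp only [principalMinor, Finset.mem_univ, if_true]
    rfl
  -- The minimum of `τ + (k - 1) / τ` is `2√(k - 1)`, attained at `τ = √(k - 1)`. For `k ≤ 1` the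
  -- second term is absent and `τ = x` works.
  have : ∃ τ : ℝ, 0 < τ ∧ τ + ((k - 1 : ℕ) : ℝ) / τ ≤ x ∧ k / τ < x := by
    unfold treeBound at hx
    by_cases hk : k ≤ 1
    · rw [if_pos hk] at hx
      have hx0 : 0 < x := lt_of_le_of_lt (by positivity) hx
      refine ⟨x, hx0, ?_, ?_⟩
      · have : k - 1 = 0 := by omega
        simp [this]
      · rw [div_lt_iff₀ hx0]
        interval_cases k
        · simp
          positivity
        · simp at hx ⊢
          nlinarith
    · rw [if_neg hk] at hx
      have hk2 : (2 : ℝ) ≤ k := by exact_mod_cast not_le.1 hk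
      have hpos : 0 < √((k : ℝ) - 1) := Real.sqrt_pos.2 (by linarith)
      have hsq : √((k : ℝ) - 1) * √((k : ℝ) - 1) = k - 1 := Real.mul_self_sqrt (by linarith)
      refine ⟨√(k - 1), hpos, ?_, ?_⟩
      · rw [Nat.cast_sub (by omega), Nat.cast_one]
        have : ((k : ℝ) - 1) / √(k - 1) = √(k - 1) := by
          rw [div_eq_iff hpos.ne', hsq]
        rw [this]
        linarith
      · rw [div_lt_iff₀ hpos]
        nlinarith
  obtain ⟨τ, hτ, h1, h2⟩ := this
  simpa only [signingSum, huniv] using signingSum_pos hτ h1 h2 s hab hdeg Finset.univ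

end Matching

/-! ### A basis of the standard representation adapted to a cycle -/

section PathBasis

open Matrix Equiv

/-- The adjacency matrix of the path with vertices `0, …, d - 1`. -/
def pathMat (d : ℕ) : Matrix (Fin d) (Fin d) ℝ :=
  of fun i j => if (i : ℕ) + 1 = j ∨ (j : ℕ) + 1 = i then 1 else 0

/-- The incidence matrix of the path with vertices `0, …, d`. -/
def pathIncidence (d : ℕ) : Matrix (Fin (d + 1)) (Fin d) ℝ :=
  of fun i j => (Pi.single j.castSucc 1 - Pi.single j.succ 1 : Fin (d + 1) → ℝ) i

theorem pathIncidence_transpose_mul (d : ℕ) :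
    (pathIncidence d)ᵀ * pathIncidence d = (2 : ℝ) • 1 - pathMat d := by
  ext i j
  have : ((pathIncidence d)ᵀ * pathIncidence d) i j =
      (Pi.single i.castSucc 1 - Pi.single i.succ 1 : Fin (d + 1) → ℝ) ⬝ᵥ
        (Pi.single j.castSucc 1 - Pi.single j.succ 1) := rfl
  rw [this, sub_dotProduct, dotProduct_sub, dotProduct_sub]
  simp only [single_one_dotProduct, Pi.single_apply, pathMat,
    Matrix.sub_apply, Matrix.smul_apply, Matrix.one_apply, of_apply, Fin.ext_iff, Fin.val_succ,
    Fin.val_castSucc, smul_eq_mul]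
  split_ifs <;> first | omega | norm_num

theorem pathIncidence_injective {d : ℕ} {x : Fin d → ℝ} (hx : pathIncidence d *ᵥ x = 0) :
    x = 0 := by
  have h : ∀ m (hm : m < d), x ⟨m, hm⟩ = 0 := by
    intro m
    induction m with
    | zero =>
      intro hm
      have := congrFun hx 0
      rw [Matrix.mulVec, dotProduct, Finset.sum_eq_single ⟨0, hm⟩] at this
      · simpa [pathIncidence, Pi.single_apply, Fin.ext_iff] using this
      · intro b _ hb
        have : (b : ℕ) ≠ 0 := fun h => hb (Fin.ext h)
        simp [pathIncidence, Pi.single_apply, Fin.ext_iff, this.symm]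
      · simp
    | succ m ih =>
      intro hm
      have := congrFun hx ⟨m + 1, by omega⟩
      rw [Matrix.mulVec, dotProduct, Finset.sum_eq_single ⟨m + 1, hm⟩] at this
      · simpa [pathIncidence, Pi.single_apply, Fin.ext_iff] using this
      · intro b _ hb
        have h1 : m + 1 ≠ (b : ℕ) := fun h => hb (Fin.ext h.symm)
        by_cases h2 : m = (b : ℕ)
        · have : b = ⟨m, by omega⟩ := Fin.ext h2.symm
          rw [this, ih, mul_zero]
        · simp [pathIncidence, Pi.single_apply, Fin.ext_iff, h1, h2]
      · simp
  funext i
  exact h i i.2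

theorem permMat_add_transpose {ρ : Type*} [Fintype ρ] [DecidableEq ρ] (p : Perm ρ) :
    permMat p + (permMat p)ᵀ = (2 : ℝ) • 1 -
      ∑ i, vecMulVec (Pi.single i 1 - Pi.single (p i) 1) (Pi.single i 1 - Pi.single (p i) 1) := by
  ext a b
  have h : ∀ i, (Pi.single (p i) 1 : ρ → ℝ) b = if i = p.symm b then 1 else 0 := by
    intro i
    simp [Pi.single_apply, Equiv.eq_symm_apply, eq_comm]
  have h' : ∀ i, (Pi.single (p i) 1 : ρ → ℝ) a = if i = p.symm a then 1 else 0 := by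
    intro i
    simp [Pi.single_apply, Equiv.eq_symm_apply, eq_comm]
  have h2 : ∀ (a : ρ) i, (Pi.single i 1 : ρ → ℝ) a = if i = a then 1 else 0 := by
    intro a i
    simp [Pi.single_apply, eq_comm]
  simp only [Matrix.add_apply, Matrix.sub_apply, Matrix.smul_apply, Matrix.sum_apply,
    vecMulVec_apply, Pi.sub_apply, h, h', h2, mul_sub, Finset.sum_sub_distrib, mul_ite, mul_one,
    mul_zero, Finset.sum_ite_eq', Finset.mem_univ, if_true, permMat_apply, Matrix.one_apply,
    transpose_apply, smul_eq_mul]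
  simp only [Equiv.symm_apply_eq, Equiv.eq_symm_apply, Equiv.apply_symm_apply,
    @eq_comm _ (p _) _]
  by_cases hab : a = b
  · subst hab
    simp
    ring
  · simp [hab, Ne.symm hab]
    ring

theorem sum_vecMulVec_finRotate (d : ℕ) :
    ∑ i, vecMulVec (Pi.single i 1 - Pi.single (finRotate (d + 1) i) 1 : Fin (d + 1) → ℝ)
      (Pi.single i 1 - Pi.single (finRotate (d + 1) i) 1) =
    pathIncidence d * (pathIncidence d)ᵀ +
      vecMulVec (Pi.single (Fin.last d) 1 - Pi.single 0 1)
        (Pi.single (Fin.last d) 1 - Pi.single 0 1) := by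
  rw [Fin.sum_univ_castSucc, finRotate_last]
  congr 1
  ext a b
  simp only [Matrix.sum_apply, Matrix.mul_apply, vecMulVec_apply, finRotate_apply,
    Fin.coeSucc_eq_succ, transpose_apply, pathIncidence, of_apply]

-- Cutting the cycle at one edge leaves a path, with incidence matrix `D`. Take `U = D (Dᵀ
-- D)^(-1/2)`, the orthonormal factor in the polar decomposition of `D`. Then `Uᵀ D Dᵀ U = Dᵀ D`,
-- which is `2` minus the path matrix, and the edge that was cut accounts for `z zᵀ`.
open scoped MatrixOrder in
theorem exists_isStdBasis (d : ℕ) : ∃ (U : Matrix (Fin (d + 1)) (Fin d) ℝ) (hU : IsStdBasis U)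
    (z : Fin d → ℝ), pathMat d =
      stdRep hU (finRotate (d + 1)) + (stdRep hU (finRotate (d + 1)))ᵀ + vecMulVec z z := by
  set D := pathIncidence d with hD
  have hpos : (Dᵀ * D).PosDef := by
    have := Matrix.PosDef.conjTranspose_mul_self D (fun x y hxy => by
      rw [← sub_eq_zero]
      apply pathIncidence_injective
      rw [Matrix.mulVec_sub, sub_eq_zero]
      exact hxy)
    rwa [conjTranspose_eq_transpose_of_trivial] at this
  obtain ⟨S, hS, hSS⟩ : ∃ S : Matrix (Fin d) (Fin d) ℝ, Sᵀ = S ∧ S * S = Dᵀ * D := by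
    refine ⟨CFC.sqrt (Dᵀ * D), ?_, ?_⟩
    · have := (Matrix.nonneg_iff_posSemidef.1 (CFC.sqrt_nonneg (Dᵀ * D))).isHermitian
      rwa [IsHermitian, conjTranspose_eq_transpose_of_trivial] at this
    · exact CFC.sqrt_mul_sqrt_self _ (Matrix.nonneg_iff_posSemidef.2 hpos.posSemidef)
  have hdet : IsUnit S.det := by
    have : S.det * S.det ≠ 0 := by
      rw [← det_mul, hSS]
      exact hpos.det_pos.ne'
    exact (left_ne_zero_of_mul this).isUnit
  have h1 : S⁻¹ * S = 1 := nonsing_inv_mul _ hdet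
  have h2 : S * S⁻¹ = 1 := mul_nonsing_inv _ hdet
  have hT : (D * S⁻¹)ᵀ = S⁻¹ * Dᵀ := by
    rw [transpose_mul, transpose_nonsing_inv, hS]
  have hU : IsStdBasis (D * S⁻¹) := by
    refine ⟨?_, fun j => ?_, by simp⟩
    · rw [hT, show S⁻¹ * Dᵀ * (D * S⁻¹) = S⁻¹ * (Dᵀ * D) * S⁻¹ by simp only [Matrix.mul_assoc],
        ← hSS, ← Matrix.mul_assoc, h1, Matrix.one_mul, h2]
    · simp only [Matrix.mul_apply]
      rw [Finset.sum_comm]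
      refine Finset.sum_eq_zero fun k _ => ?_
      rw [← Finset.sum_mul]
      simp [hD, pathIncidence]
  refine ⟨_, hU, (D * S⁻¹)ᵀ *ᵥ (Pi.single (Fin.last d) 1 - Pi.single 0 1), ?_⟩
  set U := D * S⁻¹ with hUdef
  have h3 : Uᵀ * (D * Dᵀ) * U = Dᵀ * D := by
    rw [hT, hUdef, show S⁻¹ * Dᵀ * (D * Dᵀ) * (D * S⁻¹) = S⁻¹ * (Dᵀ * D) * (Dᵀ * D) * S⁻¹ by
      simp only [Matrix.mul_assoc], ← hSS,
      show S⁻¹ * (S * S) * (S * S) * S⁻¹ = (S⁻¹ * S) * S * S * (S * S⁻¹) by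
      simp only [Matrix.mul_assoc], h1, h2, Matrix.one_mul, Matrix.mul_one]
  have h4 : stdRep hU (finRotate (d + 1)) + (stdRep hU (finRotate (d + 1)))ᵀ =
      Uᵀ * (permMat (finRotate (d + 1)) + (permMat (finRotate (d + 1)))ᵀ) * U := by
    rw [stdRep_transpose, permMat_transpose, Matrix.mul_add, Matrix.add_mul]
    rfl
  rw [h4, permMat_add_transpose, sum_vecMulVec_finRotate, ← sub_sub, Matrix.mul_sub, Matrix.mul_sub,
    Matrix.sub_mul, Matrix.sub_mul, h3, pathIncidence_transpose_mul, Matrix.mul_smul,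
    Matrix.smul_mul, Matrix.mul_one, hU.transpose_mul, mul_vecMulVec, vecMulVec_mul,
    ← mulVec_transpose]
  abel

end PathBasis

/-! ### Block matrices attached to edges, and the new eigenvalues of a covering -/

section EdgeBlock

open Matrix Equiv
open scoped Kronecker

variable {V κ ρ : Type*} [Fintype V] [DecidableEq V] [Fintype κ] [DecidableEq κ] [Fintype ρ]
  [DecidableEq ρ]

/-- The block matrix with block `Q` at `(t, h)` and block `Qᵀ` at `(h, t)`, added if `t = h`. -/
def edgeBlock (t h : V) (Q : Matrix κ κ ℝ) : Matrix (κ × V) (κ × V) ℝ :=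
  Q ⊗ₖ single t h 1 + Qᵀ ⊗ₖ single h t 1

theorem isSymm_edgeBlock (t h : V) (Q : Matrix κ κ ℝ) : (edgeBlock t h Q).IsSymm := by
  rw [IsSymm, edgeBlock, transpose_add, ← kroneckerMap_transpose, ← kroneckerMap_transpose,
    transpose_transpose, transpose_single, transpose_single, add_comm]

theorem Matrix.sub_kronecker (A B : Matrix κ κ ℝ) (C : Matrix V V ℝ) :
    (A - B) ⊗ₖ C = A ⊗ₖ C - B ⊗ₖ C := by
  ext i j
  simp [sub_mul]

/-- The action of `κ × κ` matrices on the block of the vertex `v`. -/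
def blockHom (v : V) : ReflHom κ (κ × V) where
  toMat :=
    { toFun Q := 1 + (Q - 1) ⊗ₖ single v v 1
      map_one' := by rw [sub_self, zero_kronecker, add_zero]
      map_mul' P Q := by
        rw [add_mul, mul_add, mul_add, ← mul_kronecker_mul, single_mul_single_same, mul_one,
          one_mul, one_mul, mul_one, add_assoc, ← add_kronecker, ← add_kronecker]
        congr 2
        noncomm_ring }
  vec :=
    { toFun u i := if i.2 = v then u i.1 else 0
      map_add' u w := by
        ext i
        by_cases h : i.2 = v <;> simp [h]
      map_smul' c u := by
        ext i
        by_cases h : i.2 = v <;> simp [h] }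
  continuous_toMat := by
    refine continuous_matrix fun i j => ?_
    simp only [MonoidHom.coe_mk, OneHom.coe_mk, Matrix.add_apply, kroneckerMap_apply,
      Matrix.sub_apply]
    fun_prop
  toMat_transpose Q := by
    simp only [MonoidHom.coe_mk, OneHom.coe_mk]
    rw [transpose_add, transpose_one, ← kroneckerMap_transpose, transpose_single, transpose_sub,
      transpose_one]
  toMat_reflMat u := by
    ext i j
    simp only [MonoidHom.coe_mk, OneHom.coe_mk, LinearMap.coe_mk, AddHom.coe_mk, reflMat,
      Matrix.add_apply, kroneckerMap_apply, Matrix.sub_apply, Matrix.smul_apply, vecMulVec_apply,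
      single_apply, @eq_comm _ v]
    by_cases h1 : i.2 = v <;> by_cases h2 : j.2 = v <;> simp [h1, h2]
    ring
  vec_dotProduct u w := by
    simp only [LinearMap.coe_mk, AddHom.coe_mk, dotProduct]
    rw [Fintype.sum_prod_type]
    simp

theorem blockHom_toMat (v : V) (Q : Matrix κ κ ℝ) :
    (blockHom v).toMat Q = 1 + (Q - 1) ⊗ₖ single v v 1 := rfl

theorem blockHom_vec (v : V) (u : κ → ℝ) (i : κ × V) :
    (blockHom v).vec u i = if i.2 = v then u i.1 else 0 := rfl

/-- Only one end of the edge is moved, so `P` acts from one side and `Q = 1` can be carried to any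
`P`. For a loop both ends move and `Q` is merely conjugated, which is why loops start from a cycle.
-/
theorem blockHom_conj_edgeBlock_of_ne {t h : V} (hth : t ≠ h) (P Q : Matrix κ κ ℝ) :
    (blockHom t).toMat P * edgeBlock t h Q * ((blockHom t).toMat P)ᵀ = edgeBlock t h (P * Q) := by
  rw [← ReflHom.toMat_transpose, blockHom_toMat, blockHom_toMat, edgeBlock, edgeBlock]
  simp only [add_mul, mul_add, ← mul_kronecker_mul, single_mul_single_same, mul_one, one_mul,
    single_mul_single_of_ne _ _ _ _ hth, single_mul_single_of_ne _ _ _ _ hth.symm,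
    kronecker_zero, transpose_mul, sub_mul, mul_sub, zero_mul, sub_kronecker]
  abel

theorem blockHom_conj_edgeBlock_self (t : V) (P Q : Matrix κ κ ℝ) :
    (blockHom t).toMat P * edgeBlock t t Q * ((blockHom t).toMat P)ᵀ =
      edgeBlock t t (P * Q * Pᵀ) := by
  have key : ∀ R : Matrix κ κ ℝ, (blockHom t).toMat P * (R ⊗ₖ single t t 1) *
      ((blockHom t).toMat P)ᵀ = (P * R * Pᵀ) ⊗ₖ single t t 1 := by
    intro R
    rw [← ReflHom.toMat_transpose, blockHom_toMat, blockHom_toMat]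
    simp only [add_mul, mul_add, ← mul_kronecker_mul, single_mul_single_same, mul_one, one_mul,
      sub_mul, mul_sub, sub_kronecker]
    abel
  rw [edgeBlock, mul_add, add_mul, key, key, edgeBlock, transpose_mul, transpose_mul,
    transpose_transpose, Matrix.mul_assoc P Qᵀ]

theorem kronecker_one_conj_edgeBlock (F : Matrix ρ κ ℝ) (t h : V) (P : Matrix ρ ρ ℝ) :
    (F ⊗ₖ (1 : Matrix V V ℝ))ᵀ * edgeBlock t h P * (F ⊗ₖ (1 : Matrix V V ℝ)) =
      edgeBlock t h (Fᵀ * P * F) := by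
  rw [edgeBlock, edgeBlock, ← kroneckerMap_transpose, Matrix.mul_add, Matrix.add_mul,
    transpose_one]
  simp only [← mul_kronecker_mul, one_mul, mul_one, transpose_mul, transpose_transpose,
    Matrix.mul_assoc]

theorem IsStdBasis.full_conj_permMat {U : Matrix ρ κ ℝ} (hU : IsStdBasis U) (p : Perm ρ) :
    (full U)ᵀ * permMat p * full U = fromBlocks 1 0 0 (stdRep hU p) := by
  have h1 : ∀ k (f : ρ → ℝ), ∑ x, permMat p k x * f x = f (p.symm k) := by
    intro k f
    simp [permMat_apply, ← Equiv.symm_apply_eq]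
  rw [Matrix.mul_assoc]
  ext (i | i) (j | j)
  · have := congrFun (congrFun hU.full_transpose_mul (Sum.inl i)) (Sum.inl j)
    simpa [Matrix.mul_apply, full, h1] using this
  · simp only [Matrix.mul_apply, h1, full, transpose_apply, of_apply, Sum.elim_inl, Sum.elim_inr,
      fromBlocks_apply₁₂, Matrix.zero_apply, ← Finset.mul_sum]
    rw [Equiv.sum_comp p.symm fun k => U k j, hU.sum_col, mul_zero]
  · simp [Matrix.mul_apply, h1, full, ← Finset.sum_mul, hU.sum_col]
  · rw [fromBlocks_apply₂₂, stdRep_apply, Matrix.mul_assoc]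
    rfl

theorem charpoly_transpose_mul_mul {m n : Type*} [Fintype m] [DecidableEq m] [Fintype n]
    [DecidableEq n] (F : Matrix m n ℝ) (hF : F * Fᵀ = 1) (hcard : Fintype.card m = Fintype.card n)
    (B : Matrix m m ℝ) : (Fᵀ * B * F).charpoly = B.charpoly := by
  rw [Matrix.mul_assoc, charpoly_mul_comm_of_le _ _ hcard.le, hcard, Nat.sub_self, pow_zero,
    one_mul, Matrix.mul_assoc, hF, Matrix.mul_one]

theorem charpoly_sum_edgeBlock_fromBlocks {E : Type*} [Fintype E] (t h : E → V)
    (A : E → Matrix Unit Unit ℝ) (B : E → Matrix κ κ ℝ) :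
    (∑ e, edgeBlock (t e) (h e) (fromBlocks (A e) 0 0 (B e))).charpoly =
      (∑ e, edgeBlock (t e) (h e) (A e)).charpoly * (∑ e, edgeBlock (t e) (h e) (B e)).charpoly := by
  rw [← charpoly_fromBlocks_zero₁₂ _ (0 : Matrix (κ × V) (Unit × V) ℝ),
    ← charpoly_reindex (Equiv.sumProdDistrib Unit κ V)]
  congr 1
  ext (i | i) (j | j) <;>
    simp [edgeBlock, Matrix.sum_apply, fromBlocks_transpose, kroneckerMap_apply]

namespace MGraph

variable {E : Type*} [Fintype E] (G : MGraph V E)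

theorem adjMatrix_eq_sum : G.adjMatrix =
    ∑ e, (single (G.tail e) (G.head e) 1 + single (G.head e) (G.tail e) 1) := by
  ext u v
  rw [adjMatrix, of_apply, Finset.natCast_card_filter, Fintype.sum_prod_type, Matrix.sum_apply]
  refine Finset.sum_congr rfl fun e _ => ?_
  rw [Fintype.sum_bool, Matrix.add_apply, single_apply, single_apply]
  rfl

theorem charpoly_adjMatrix : G.adjMatrix.charpoly =
    (∑ e, edgeBlock (G.tail e) (G.head e) (1 : Matrix Unit Unit ℝ)).charpoly := by
  rw [← charpoly_reindex (Equiv.punitProd V).symm, adjMatrix_eq_sum]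
  congr 1
  ext i j
  simp [edgeBlock, Matrix.sum_apply, kroneckerMap_apply]

theorem charpoly_adjMatrix_lift {r : ℕ} (σ : E → Perm (Fin r)) :
    (G.lift σ).adjMatrix.charpoly =
      (∑ e, edgeBlock (G.tail e) (G.head e) (permMat (σ e))).charpoly := by
  rw [← charpoly_reindex (Equiv.prodComm V (Fin r)), adjMatrix_eq_sum]
  congr 1
  ext ⟨i, u⟩ ⟨j, v⟩
  rw [Matrix.sum_apply, reindex_apply, submatrix_apply, Matrix.sum_apply, Fintype.sum_prod_type]
  refine Finset.sum_congr rfl fun e _ => ?_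
  simp only [lift, Matrix.add_apply, single_apply, edgeBlock, kroneckerMap_apply, permMat_apply,
    transpose_apply, Equiv.prodComm_symm, Equiv.prodComm_apply, Prod.swap_prod_mk, Prod.mk.injEq,
    Finset.sum_add_distrib, mul_ite, mul_one, mul_zero]
  congr 1
  · by_cases h : G.tail e = u ∧ G.head e = v
    · simp only [h.1, h.2, true_and, and_self, if_true]
      rw [Finset.sum_eq_single j (fun k _ hk => if_neg fun h => hk h.2) (by simp)]
      simp [eq_comm]
    · rw [if_neg h]
      refine Finset.sum_eq_zero fun k _ => if_neg ?_
      tauto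
  · by_cases h : G.head e = u ∧ G.tail e = v
    · simp only [h.1, h.2, true_and, and_self, if_true]
      rw [Finset.sum_eq_single i (fun k _ hk => if_neg fun h => hk h.1) (by simp)]
      simp [eq_comm]
    · rw [if_neg h]
      refine Finset.sum_eq_zero fun k _ => if_neg ?_
      tauto

/-- In the basis `full U` the permutation representation splits into the trivial one, which yields
the characteristic polynomial of `G`, and the standard one. So the multiset difference removes
exactly the roots of the first factor. -/
theorem newSpec_eq_roots {r : ℕ} {U : Matrix (Fin r) κ ℝ} (hU : IsStdBasis U)
    (σ : E → Perm (Fin r)) : G.newSpec σ =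
      (∑ e, edgeBlock (G.tail e) (G.head e) (stdRep hU (σ e))).charpoly.roots := by
  have h2 : (G.lift σ).adjMatrix.charpoly = G.adjMatrix.charpoly *
      (∑ e, edgeBlock (G.tail e) (G.head e) (stdRep hU (σ e))).charpoly := by
    have hF : (IsStdBasis.full U ⊗ₖ (1 : Matrix V V ℝ)) * (IsStdBasis.full U ⊗ₖ (1 : Matrix V V ℝ))ᵀ = 1 := by
      rw [← kroneckerMap_transpose, ← mul_kronecker_mul, hU.full_mul_transpose, transpose_one,
        one_mul, one_kronecker_one]
    rw [G.charpoly_adjMatrix, ← charpoly_sum_edgeBlock_fromBlocks, charpoly_adjMatrix_lift,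
      ← charpoly_transpose_mul_mul _ hF (by simp [hU.card, add_comm]), Matrix.mul_sum,
      Matrix.sum_mul]
    simp only [kronecker_one_conj_edgeBlock, hU.full_conj_permMat]
  rw [newSpec, spec, spec, h2, Polynomial.roots_mul, add_tsub_cancel_left]
  exact mul_ne_zero (charpoly_monic _).ne_zero (charpoly_monic _).ne_zero

end MGraph

end EdgeBlock

/-! ### Positivity of the expected characteristic polynomial -/

section Expected

open Matrix Equiv
open scoped Kronecker

variable {V κ ρ n E : Type*} [Fintype V] [DecidableEq V] [Fintype κ] [DecidableEq κ] [Fintype ρ]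
  [DecidableEq ρ] [Fintype n] [DecidableEq n] [Fintype E] [DecidableEq E]

theorem Matrix.isSymm_sum {ι : Type*} {s : Finset ι} {A : ι → Matrix n n ℝ}
    (hA : ∀ i ∈ s, (A i).IsSymm) : (∑ i ∈ s, A i).IsSymm := by
  rw [IsSymm, transpose_sum]
  exact Finset.sum_congr rfl hA

/-- If for every slot the averages of `det (N - ·)` over two families of matrices agree, then so
do the averages over independent choices in all the slots. -/
theorem sum_det_eq_of_slots {Ω₁ Ω₂ : Type*} [Fintype Ω₁] [Fintype Ω₂] [Nonempty Ω₁] [Nonempty Ω₂]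
    {M₁ : E → Ω₁ → Matrix n n ℝ} {M₂ : E → Ω₂ → Matrix n n ℝ} (h₁ : ∀ e ω, (M₁ e ω).IsSymm)
    (h₂ : ∀ e ω, (M₂ e ω).IsSymm)
    (h : ∀ e (N : Matrix n n ℝ), N.IsSymm → Fintype.card Ω₂ * ∑ ω, (N - M₁ e ω).det =
      Fintype.card Ω₁ * ∑ ω, (N - M₂ e ω).det) {N : Matrix n n ℝ} (hN : N.IsSymm) :
    Fintype.card (E → Ω₂) * ∑ f : E → Ω₁, (N - ∑ e, M₁ e (f e)).det =
      Fintype.card (E → Ω₁) * ∑ g : E → Ω₂, (N - ∑ e, M₂ e (g e)).det := by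
  -- The hybrid sum, with the slots in `s` already exchanged. Summing over `f` and `g` in full makes
  -- all these sums equal without changing the normalization.
  set T : Finset E → ℝ := fun s => ∑ f : E → Ω₁, ∑ g : E → Ω₂,
    (N - ∑ e, if e ∈ s then M₂ e (g e) else M₁ e (f e)).det with hT
  have hstep : ∀ (s : Finset E) (a : E), a ∉ s → T (insert a s) = T s := by
    intro s a ha
    have hc₁ : (Fintype.card Ω₁ : ℝ) ≠ 0 := by exact_mod_cast Fintype.card_ne_zero
    have hc₂ : (Fintype.card Ω₂ : ℝ) ≠ 0 := by exact_mod_cast Fintype.card_ne_zero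
    set R : (E → Ω₁) → (E → Ω₂) → Matrix n n ℝ := fun f g =>
      N - ∑ e ∈ Finset.univ.erase a, if e ∈ s then M₂ e (g e) else M₁ e (f e) with hR
    have hRs : ∀ f g, (R f g).IsSymm := fun f g => by
      refine hN.sub (Matrix.isSymm_sum fun e _ => ?_)
      split_ifs
      exacts [h₂ _ _, h₁ _ _]
    have e1 : ∀ f g k, (N - ∑ e, if e ∈ s then M₂ e (g e) else
        M₁ e (Function.update f a k e)) = R f g - M₁ a k := by
      intro f g k
      rw [← Finset.add_sum_erase _ _ (Finset.mem_univ a), if_neg ha, Function.update_self, hR,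
        sub_sub, add_comm]
      congr 2
      refine Finset.sum_congr rfl fun e he => ?_
      rw [Function.update_of_ne (Finset.ne_of_mem_erase he)]
    have e2 : ∀ f g k, (N - ∑ e, if e ∈ insert a s then M₂ e (Function.update g a k e) else
        M₁ e (f e)) = R f g - M₂ a k := by
      intro f g k
      rw [← Finset.add_sum_erase _ _ (Finset.mem_univ a), if_pos (Finset.mem_insert_self a s),
        Function.update_self, hR, sub_sub, add_comm]
      congr 2
      refine Finset.sum_congr rfl fun e he => ?_
      rw [Function.update_of_ne (Finset.ne_of_mem_erase he)]
      simp [Finset.mem_insert, Finset.ne_of_mem_erase he]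
    have f1 : Fintype.card Ω₁ * T s = ∑ f, ∑ g, ∑ k, (R f g - M₁ a k).det := by
      rw [hT]
      simp only
      rw [← nsmul_eq_mul, ← Fintype.sum_sum_update a, Finset.sum_comm]
      simp only [e1]
      exact Finset.sum_congr rfl fun f _ => Finset.sum_comm
    have f2 : Fintype.card Ω₂ * T (insert a s) = ∑ f, ∑ g, ∑ k, (R f g - M₂ a k).det := by
      rw [hT]
      simp only
      rw [Finset.mul_sum]
      refine Finset.sum_congr rfl fun f _ => ?_
      rw [← nsmul_eq_mul, ← Fintype.sum_sum_update a, Finset.sum_comm]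
      simp only [e2]
    have f3 : Fintype.card Ω₂ * (Fintype.card Ω₁ * T s) =
        Fintype.card Ω₁ * (Fintype.card Ω₂ * T (insert a s)) := by
      rw [f1, f2]
      simp only [Finset.mul_sum (s := (Finset.univ : Finset (E → Ω₁))),
        Finset.mul_sum (s := (Finset.univ : Finset (E → Ω₂))), h a _ (hRs _ _)]
    have f4 : (Fintype.card Ω₁ * Fintype.card Ω₂ : ℝ) * T (insert a s) =
        (Fintype.card Ω₁ * Fintype.card Ω₂ : ℝ) * T s := by
      linear_combination -f3
    exact mul_left_cancel₀ (mul_ne_zero hc₁ hc₂) f4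
  have hall : ∀ s, T s = T ∅ := fun s => by
    induction s using Finset.induction_on with
    | empty => rfl
    | insert a s ha ih => rw [hstep s a ha, ih]
  have h0 : T ∅ = Fintype.card (E → Ω₂) * ∑ f : E → Ω₁, (N - ∑ e, M₁ e (f e)).det := by
    simp [hT, Finset.mul_sum]
  have h1 : T Finset.univ = Fintype.card (E → Ω₁) * ∑ g : E → Ω₂, (N - ∑ e, M₂ e (g e)).det := by
    simp [hT, Finset.mul_sum]
  rw [← h0, ← h1, hall Finset.univ]

/-- The signed edges at a vertex over `v` inject into the oriented edges of `G` that start at `v`,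
because `p e` and `q e` are injective on `s e`. So the degrees upstairs are at most `k`. -/
theorem sum_signing_det_pos_of_degree (G : MGraph V E) {k : ℕ} (hk : ∀ v, G.degree v ≤ k) {x : ℝ}
    (hx : treeBound k < x) (p q : E → κ → κ) (s : E → Finset κ)
    (hp : ∀ e, Set.InjOn (p e) (s e)) (hq : ∀ e, Set.InjOn (q e) (s e))
    (hpq : ∀ e, G.tail e = G.head e → ∀ i ∈ s e, p e i ≠ q e i) :
    0 < ∑ δ : E → κ → ℤˣ, (x • 1 - ∑ e, ∑ i ∈ s e,
      ((δ e i : ℤ) : ℝ) • edgeMat (p e i, G.tail e) (q e i, G.head e)).det := by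
  have := sum_signing_det_pos (ι := Σ _ : E, κ) (n := κ × V)
    (a := fun i => (p i.1 i.2, G.tail i.1)) (b := fun i => (q i.1 i.2, G.head i.1)) hx
    (Finset.univ.sigma s) (fun i hi h => by
      rw [Finset.mem_sigma] at hi
      rw [Prod.mk.injEq] at h
      exact hpq i.1 h.2 i.2 hi.2 h.1) (fun w => ?_)
  · rw [← Equiv.sum_comp (Equiv.piCurry fun (_ : E) (_ : κ) => ℤˣ)]
    simpa only [Finset.sum_sigma, Equiv.piCurry_apply, Sigma.curry] using this
  · refine le_trans ?_ (hk w.2)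
    rw [MGraph.degree]
    refine Finset.card_le_card_of_injOn
      (fun i => (i.1, decide ((p i.1 i.2, G.tail i.1) = w))) (fun i hi => ?_)
      (fun i hi j hj hij => ?_)
    · simp only [Finset.coe_filter, Finset.mem_sigma, Finset.mem_univ, true_and, Set.mem_ofPred_eq,
        Finset.mem_insert, Finset.mem_singleton] at hi ⊢
      by_cases h : (p i.1 i.2, G.tail i.1) = w
      · simp [MGraph.src, h, ← congrArg Prod.snd h]
      · simp [MGraph.src, h, congrArg Prod.snd (hi.2.resolve_left (Ne.symm h))]
    · simp only [Finset.coe_filter, Finset.mem_sigma, Finset.mem_univ, true_and, Set.mem_ofPred_eq,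
        Finset.mem_insert, Finset.mem_singleton] at hi hj
      obtain ⟨e, i⟩ := i
      obtain ⟨e', j⟩ := j
      obtain rfl : e = e' := congrArg Prod.fst hij
      have hd := congrArg Prod.snd hij
      simp only [decide_eq_decide] at hd hi hj
      by_cases h : (p e i, G.tail e) = w
      · have h' := hd.1 h
        rw [hp e hi.1 hj.1 (congrArg Prod.fst (h.trans h'.symm))]
      · have h' := fun h2 => h (hd.2 h2)
        have h3 := hi.2.resolve_left (Ne.symm h)
        have h4 := hj.2.resolve_left (Ne.symm h')
        rw [hq e hi.1 hj.1 (congrArg Prod.fst (h3.symm.trans h4))]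

/-- The adjacency matrix of the directed path `0 → 1 → ⋯ → d - 1`. -/
def directedPathMat (d : ℕ) : Matrix (Fin d) (Fin d) ℝ :=
  of fun i j => if (i : ℕ) + 1 = j then 1 else 0

theorem directedPathMat_add_transpose (d : ℕ) :
    directedPathMat d + (directedPathMat d)ᵀ = pathMat d := by
  ext i j
  simp only [directedPathMat, pathMat, Matrix.add_apply, transpose_apply, of_apply]
  split_ifs <;> first | omega | norm_num

/-- The successor on `Fin d`, which fixes the last element. -/
def Fin.next {d : ℕ} (i : Fin d) : Fin d := if h : (i : ℕ) + 1 < d then ⟨i + 1, h⟩ else i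

theorem Fin.val_next {d : ℕ} {i : Fin d} (h : (i : ℕ) + 1 < d) : (Fin.next i : ℕ) = i + 1 := by
  simp [Fin.next, h]

theorem directedPathMat_eq_sum (d : ℕ) : directedPathMat d =
    ∑ i ∈ Finset.univ.filter fun i : Fin d => (i : ℕ) + 1 < d, single i (Fin.next i) 1 := by
  ext i j
  rw [Matrix.sum_apply, directedPathMat, of_apply]
  by_cases h : (i : ℕ) + 1 < d
  · rw [Finset.sum_eq_single i (fun b _ hb => by simp [hb]) (by simp [h]), single_apply]
    simp [Fin.ext_iff, Fin.val_next h]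
  · rw [if_neg (by omega)]
    refine (Finset.sum_eq_zero fun b hb => ?_).symm
    have : b ≠ i := by
      rintro rfl
      exact h (Finset.mem_filter.1 hb).2
    simp [this]

theorem signedMat_eq_sum (ε : κ → ℤˣ) (p : Perm κ) :
    signedMat (ε, p) = ∑ i, ((ε (p i) : ℤ) : ℝ) • single (p i) i 1 := by
  ext i j
  rw [Matrix.sum_apply, Finset.sum_eq_single j (fun b _ hb => by simp [hb]) (by simp),
    signedMat_apply]
  by_cases h : i = p j
  · simp [h]
  · simp [h, Ne.symm h]

theorem signedMat_conj_single (ε : κ → ℤˣ) (p : Perm κ) (a b : κ) :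
    signedMat (ε, p) * single a b 1 * (signedMat (ε, p))ᵀ =
      (((ε (p a) * ε (p b) : ℤˣ) : ℤ) : ℝ) • single (p a) (p b) 1 := by
  have h : ∀ a, signedMat (ε, p) *ᵥ Pi.single a 1 = ((ε (p a) : ℤ) : ℝ) • Pi.single (p a) 1 := by
    intro a
    ext i
    rw [mulVec_single_one]
    by_cases hi : i = p a <;> simp [signedMat_apply, hi]
  rw [single_eq_single_vecMulVec_single, mul_vecMulVec, vecMulVec_mul, vecMul_transpose, h, h,
    smul_vecMulVec, vecMulVec_smul, ← single_eq_single_vecMulVec_single, smul_smul]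
  push_cast
  rfl

/-- The products of neighbouring signs along a path, completed by the last sign. -/
def pathSigns {d : ℕ} (ε : Fin d → ℤˣ) (i : Fin d) : ℤˣ :=
  if (i : ℕ) + 1 < d then ε i * ε (Fin.next i) else ε i

/-- The signs can be recovered from the last one backwards. Hence uniform signs on the vertices of a
path induce independent uniform signs on its edges. -/
theorem bijective_pathSigns (d : ℕ) : Function.Bijective (pathSigns (d := d)) := by
  refine Function.Injective.bijective_of_finite fun ε ε' h => ?_
  have key : ∀ m (i : Fin d), (i : ℕ) + m + 1 = d → ε i = ε' i := by
    intro m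
    induction m with
    | zero =>
      intro i hi
      have := congrFun h i
      rwa [pathSigns, pathSigns, if_neg (by omega), if_neg (by omega)] at this
    | succ m ih =>
      intro i hi
      have := congrFun h i
      have hlt : (i : ℕ) + 1 < d := by omega
      rwa [pathSigns, pathSigns, if_pos hlt, if_pos hlt,
        ih (Fin.next i) (by rw [Fin.val_next hlt]; omega), mul_left_inj] at this
  funext i
  exact key (d - 1 - i) i (by omega)

theorem edgeBlock_sum {ι : Type*} (t h : V) (s : Finset ι) (c : ι → ℝ) (p q : ι → κ) :
    edgeBlock t h (∑ i ∈ s, c i • single (p i) (q i) 1) =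
      ∑ i ∈ s, c i • edgeMat (p i, t) (q i, h) := by
  ext i j
  simp only [edgeBlock, edgeMat, Matrix.add_apply, kroneckerMap_apply, Matrix.sum_apply,
    Matrix.smul_apply, transpose_apply, Finset.sum_mul, ← Finset.sum_add_distrib]
  refine Finset.sum_congr rfl fun l _ => ?_
  simp only [single_apply, Prod.ext_iff, smul_eq_mul]
  rw [mul_assoc, mul_assoc, ← mul_add, ite_zero_mul_ite_zero, ite_zero_mul_ite_zero, mul_one]
  congr 3 <;> rw [eq_iff_iff] <;> tauto

/-- The block matrix of an edge between `t` and `h` before a covering has been chosen; for loops it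
is built from the matrix `L`. -/
def slotMat (t h : V) (L : Matrix κ κ ℝ) : Matrix (κ × V) (κ × V) ℝ :=
  edgeBlock t h (if t = h then L else 1)

theorem blockHom_conj_slotMat (t h : V) (L P : Matrix κ κ ℝ) :
    (blockHom t).toMat P * slotMat t h L * ((blockHom t).toMat P)ᵀ =
      edgeBlock t h (if t = h then P * L * Pᵀ else P) := by
  by_cases hth : t = h
  · subst hth
    rw [slotMat, if_pos rfl, if_pos rfl, blockHom_conj_edgeBlock_self]
  · rw [slotMat, if_neg hth, if_neg hth, blockHom_conj_edgeBlock_of_ne hth, mul_one]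

/-- With the permutations fixed, the sum over signs runs over the signings of a loopless graph: `d`
disjoint edges over an ordinary edge, and the edges of a path over a loop. -/
theorem sum_signedMat_det_pos (G : MGraph V E) {k : ℕ} (hk : ∀ v, G.degree v ≤ k) {x : ℝ}
    (hx : treeBound k < x) (d : ℕ) :
    0 < ∑ g : E → (Fin d → ℤˣ) × Perm (Fin d), (x • 1 - ∑ e,
      (blockHom (G.tail e)).toMat (signedMat (g e)) *
        slotMat (G.tail e) (G.head e) (directedPathMat d) *
        ((blockHom (G.tail e)).toMat (signedMat (g e)))ᵀ).det := by
  simp only [blockHom_conj_slotMat]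
  rw [← Equiv.sum_comp (Equiv.arrowProdEquivProdArrow E (fun _ => Fin d → ℤˣ)
    fun _ => Perm (Fin d)).symm, Fintype.sum_prod_type, Finset.sum_comm]
  refine Finset.sum_pos (fun p _ => ?_) Finset.univ_nonempty
  set s : E → Finset (Fin d) := fun e =>
    if G.tail e = G.head e then Finset.univ.filter fun i => (i : ℕ) + 1 < d else Finset.univ
    with hs
  set q : E → Fin d → Fin d := fun e i =>
    if G.tail e = G.head e then p e (Fin.next i) else i with hq
  -- This substitution makes the signs of the edges independent variables. Over a loop the last sign
  -- belongs to no edge and only completes the bijection.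
  set φ : ∀ e : E, (Fin d → ℤˣ) → (Fin d → ℤˣ) := fun e ε =>
    if G.tail e = G.head e then pathSigns (ε ∘ p e) else ε ∘ p e with hφ
  have hφb : ∀ e, Function.Bijective (φ e) := by
    intro e
    have h1 : Function.Bijective fun ε : Fin d → ℤˣ => ε ∘ p e :=
      (Equiv.arrowCongr (p e).symm (Equiv.refl ℤˣ)).bijective
    by_cases h : G.tail e = G.head e
    · simp only [hφ, if_pos h]
      exact (bijective_pathSigns d).comp h1
    · simpa only [hφ, if_neg h] using h1
  have hmat : ∀ e (ε : Fin d → ℤˣ), (if G.tail e = G.head e then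
      signedMat (ε, p e) * directedPathMat d * (signedMat (ε, p e))ᵀ else signedMat (ε, p e)) =
      ∑ i ∈ s e, ((φ e ε i : ℤ) : ℝ) • single (p e i) (q e i) 1 := by
    intro e ε
    by_cases h : G.tail e = G.head e
    · simp only [hs, hφ, hq, if_pos h]
      rw [directedPathMat_eq_sum, Matrix.mul_sum, Matrix.sum_mul]
      refine Finset.sum_congr rfl fun i hi => ?_
      rw [signedMat_conj_single, pathSigns, if_pos (Finset.mem_filter.1 hi).2]
      rfl
    · simp only [hs, hφ, hq, if_neg h, signedMat_eq_sum, Function.comp]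
  have hpos := sum_signing_det_pos_of_degree G hk hx (fun e => p e) q s
    (fun e => (p e).injective.injOn) (fun e i hi j hj hij => ?_) (fun e h i hi => ?_)
  · rw [← Equiv.sum_comp (Equiv.piCongrRight fun e => Equiv.ofBijective (φ e) (hφb e))] at hpos
    refine hpos.trans_eq (Finset.sum_congr rfl fun ε _ => ?_)
    congr 2
    refine Finset.sum_congr rfl fun e _ => ?_
    have := hmat e (ε e)
    simp only [Equiv.arrowProdEquivProdArrow, Equiv.coe_fn_symm_mk]
    rw [this, edgeBlock_sum]
    rfl
  · by_cases h : G.tail e = G.head e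
    · simp only [hq, hs, if_pos h, EmbeddingLike.apply_eq_iff_eq, Finset.coe_filter,
        Finset.mem_univ, true_and, Set.mem_ofPred_eq] at hij hi hj
      have := congrArg Fin.val hij
      rw [Fin.val_next hi, Fin.val_next hj] at this
      exact Fin.ext (by omega)
    · simpa only [hq, if_neg h] using hij
  · simp only [hq, hs, if_pos h, Finset.mem_filter, Finset.mem_univ, true_and] at hi ⊢
    rw [Ne, EmbeddingLike.apply_eq_iff_eq]
    intro h'
    have := congrArg Fin.val h'
    rw [Fin.val_next hi] at this
    omega

end Expected

/-! ### A covering whose new eigenvalues are small -/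

section Existence

open Matrix Equiv Polynomial
open scoped Kronecker Nat

variable {V n E : Type*} [Fintype V] [DecidableEq V] [Fintype n] [DecidableEq n] [Fintype E]
  [DecidableEq E]

theorem RealRootedMixture.pos_of_forall_add_vecMulVec {F : (E → Matrix n n ℝ) → ℝ[X]}
    (hF : RealRootedMixture n E F) {A : E → Matrix n n ℝ} (hA : ∀ e, (A e).IsSymm)
    (v : E → n → ℝ) {b : ℝ}
    (hpos : ∀ x, b < x → 0 < (F fun e => A e + vecMulVec (v e) (v e)).eval x) :
    ∀ x, b < x → 0 < (F A).eval x := by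
  suffices H : ∀ (s : Finset E) (B : E → Matrix n n ℝ), (∀ e, (B e).IsSymm) →
      (∀ x, b < x → 0 < (F fun e => if e ∈ s then B e + vecMulVec (v e) (v e) else B e).eval x) →
      ∀ x, b < x → 0 < (F B).eval x from
    H Finset.univ A hA (by simpa using hpos)
  intro s
  induction s using Finset.induction_on with
  | empty => exact fun B _ h => by simpa using h
  | insert a s ha ih =>
    intro B hB h
    refine hF.pos_of_add_vecMulVec hB a (v a) (ih _ (fun e => isSymm_update hB
      ((hB a).add (isSymm_vecMulVec (v a))) e) fun x hx => ?_)
    convert h x hx using 3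
    funext e
    by_cases hea : e = a
    · subst hea
      simp [ha]
    · simp [hea]

/-- The block of a loop depends on its matrix `L` only through `L + Lᵀ`, so the directed path may
stand for the path. -/
theorem exists_slotMat_eq (t h : V) {d : ℕ} {P : Matrix (Fin d) (Fin d) ℝ} {z : Fin d → ℝ}
    (hz : pathMat d = P + Pᵀ + vecMulVec z z) :
    ∃ v, slotMat t h (directedPathMat d) = slotMat t h P + vecMulVec v v := by
  by_cases hth : t = h
  · subst hth
    refine ⟨(blockHom t).vec z, ?_⟩
    rw [slotMat, slotMat, if_pos rfl, if_pos rfl, edgeBlock, edgeBlock, ← add_kronecker,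
      ← add_kronecker, directedPathMat_add_transpose, hz, add_kronecker]
    congr 1
    ext i j
    simp only [kroneckerMap_apply, vecMulVec_apply, blockHom_vec, single_apply]
    by_cases h1 : i.2 = t <;> by_cases h2 : j.2 = t <;> simp [h1, h2, Ne.symm]
  · refine ⟨0, ?_⟩
    simp [slotMat, hth]

/-- Interlacing is applied to the actual matrices, with a cycle at every loop, and yields the
witness. Positivity of their average is inherited from the larger matrices with a path at every
loop, for which signed permutations can be used. -/
theorem exists_perm_charpoly_pos (G : MGraph V E) {k : ℕ} (hk : ∀ v, G.degree v ≤ k) {d : ℕ}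
    {U : Matrix (Fin (d + 1)) (Fin d) ℝ} (hU : IsStdBasis U) {z : Fin d → ℝ}
    {c : Perm (Fin (d + 1))}
    (hz : pathMat d = stdRep hU c + (stdRep hU c)ᵀ + vecMulVec z z) :
    ∃ σ : E → Perm (Fin (d + 1)), ∀ x, treeBound k < x →
      0 < (∑ e, edgeBlock (G.tail e) (G.head e) (stdRep hU (σ e))).charpoly.eval x := by
  set π : E → Perm (Fin (d + 1)) →* Matrix (Fin d × V) (Fin d × V) ℝ := fun e =>
    (blockHom (G.tail e)).toMat.comp (stdRep hU) with hπ
  have hsymm : ∀ t h (L : Matrix (Fin d) (Fin d) ℝ), (slotMat (V := V) t h L).IsSymm :=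
    fun t h L => isSymm_edgeBlock _ _ _
  have hswap : ∀ e i j, i ≠ j → ∃ u, u ⬝ᵥ u = 1 ∧ π e (swap i j) = reflMat u := by
    intro e i j hij
    obtain ⟨u, hu, hu'⟩ := exists_stdRep_swap_eq_reflMat hU i j hij
    refine ⟨(blockHom (G.tail e)).vec u, ?_, ?_⟩
    · rw [ReflHom.vec_dotProduct, hu]
    · rw [hπ, MonoidHom.comp_apply, hu', ReflHom.toMat_reflMat]
  obtain ⟨hmix, hex⟩ := realRootedMixture_averageOn hswap Finset.univ
  have hstd : ∀ x, treeBound k < x → 0 < (averageOn π Finset.univ fun e =>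
      slotMat (G.tail e) (G.head e) (stdRep hU c)).eval x := by
    choose v hv using fun e => exists_slotMat_eq (G.tail e) (G.head e) hz
    refine hmix.pos_of_forall_add_vecMulVec (fun e => hsymm _ _ _) v fun x hx => ?_
    simp only [← hv]
    have hslots := sum_det_eq_of_slots
      (M₁ := fun e h => (blockHom (G.tail e)).toMat (stdRep hU h) *
        slotMat (G.tail e) (G.head e) (directedPathMat d) *
        ((blockHom (G.tail e)).toMat (stdRep hU h))ᵀ)
      (M₂ := fun e g => (blockHom (G.tail e)).toMat (signedMat g) *
        slotMat (G.tail e) (G.head e) (directedPathMat d) *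
        ((blockHom (G.tail e)).toMat (signedMat g))ᵀ)
      (fun e g => (hsymm _ _ _).conj _) (fun e g => (hsymm _ _ _).conj _)
      (fun e N hN => ReflHom.sumDet_stdRep hU (blockHom (G.tail e)) hN (hsymm _ _ _))
      (N := x • 1) (isSymm_one.smul x)
    have hpos := sum_signedMat_det_pos G hk hx d
    have h1 : 0 < ∑ f : E → Perm (Fin (d + 1)), (x • 1 - ∑ e,
        (blockHom (G.tail e)).toMat (stdRep hU (f e)) *
          slotMat (G.tail e) (G.head e) (directedPathMat d) *
          ((blockHom (G.tail e)).toMat (stdRep hU (f e)))ᵀ).det := by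
      refine pos_of_mul_pos_right (hslots ▸ mul_pos ?_ hpos) (Nat.cast_nonneg _)
      exact_mod_cast Fintype.card_pos
    rw [averageOn, eval_smul, smul_eq_mul, eval_finsetSum]
    refine mul_pos (by positivity) (h1.trans_eq (Finset.sum_congr rfl fun f _ => ?_))
    rw [eval_charpoly, scalar_apply, ← smul_one_eq_diagonal]
    simp only [conjOn, Finset.mem_univ, if_true]
    rfl
  obtain ⟨σ, hσ⟩ := hex (fun e => slotMat (G.tail e) (G.head e) (stdRep hU c))
    (fun e => hsymm _ _ _) (treeBound k) hstd
  -- At a loop the chosen permutation acts by conjugation on `c`.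
  refine ⟨fun e => if G.tail e = G.head e then σ e * c * (σ e)⁻¹ else σ e, fun x hx => ?_⟩
  convert hσ x hx using 4 with e
  rw [conjOn, if_pos (Finset.mem_univ e), hπ, MonoidHom.comp_apply, blockHom_conj_slotMat]
  by_cases h : G.tail e = G.head e
  · simp only [if_pos h, map_mul, stdRep_transpose]
  · simp only [if_neg h]

theorem MGraph.exists_newSpec_le_treeBound (G : MGraph V E) {k : ℕ} (hk : ∀ v, G.degree v ≤ k)
    {r : ℕ} (hr : 1 ≤ r) :
    ∃ σ : E → Perm (Fin r), ∀ μ ∈ G.newSpec σ, μ ≤ treeBound k := by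
  obtain ⟨d, rfl⟩ : ∃ d, r = d + 1 := ⟨r - 1, by omega⟩
  obtain ⟨U, hU, z, hz⟩ := exists_isStdBasis d
  obtain ⟨σ, hσ⟩ := exists_perm_charpoly_pos G hk hU hz
  refine ⟨σ, fun μ hμ => ?_⟩
  rw [G.newSpec_eq_roots hU] at hμ
  by_contra! h
  exact (hσ μ h).ne' (isRoot_of_mem_roots hμ)

end Existence

/-! ### The spectral radius of the universal covering tree of a regular graph -/

section Tree

open scoped ENNReal

namespace MGraph

variable {V E : Type*} (G : MGraph V E) (v : V)

theorem IsReducedWalk.of_cons {G : MGraph V E} {v : V} {d : G.Dart} {l : List G.Dart}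
    (h : G.IsReducedWalk v (d :: l)) : G.IsReducedWalk v l := by
  cases l with
  | nil => trivial
  | cons d' l => exact h.2.2

theorem finite_treeVertex_length_lt [Finite E] (N : ℕ) :
    {p : G.TreeVertex v | p.1.length < N}.Finite :=
  Set.Finite.preimage Subtype.val_injective.injOn (List.finite_length_lt G.Dart N)

variable [Fintype E]

/-- The vertices of the universal covering tree at distance less than `N` from the root. -/
noncomputable def treeBall (N : ℕ) : Finset (G.TreeVertex v) :=
  (G.finite_treeVertex_length_lt v N).toFinset

/-- The number of vertices of the universal covering tree at distance `m` from the root. -/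
noncomputable def sphereCard (m : ℕ) : ℕ :=
  ((G.treeBall v (m + 1)).filter fun p => p.1.length = m).card

/-- The neighbours of a vertex of the tree that are further away from the root. -/
noncomputable def children {v : V} (p : G.TreeVertex v) : Finset (G.TreeVertex v) :=
  ((G.universalCover v).neighborFinset p).filter fun q => q.1.length = p.1.length + 1

variable {G v}

theorem mem_treeBall {N : ℕ} {p : G.TreeVertex v} : p ∈ G.treeBall v N ↔ p.1.length < N := by
  simp [treeBall]

theorem mem_children {p q : G.TreeVertex v} : q ∈ G.children p ↔ ∃ d, q.1 = d :: p.1 := by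
  simp only [children, Finset.mem_filter, SimpleGraph.mem_neighborFinset]
  constructor
  · rintro ⟨⟨d, h | h⟩, hl⟩
    · exact ⟨d, h⟩
    · rw [h, List.length_cons] at hl
      omega
  · rintro ⟨d, h⟩
    exact ⟨⟨d, Or.inl h⟩, by rw [h, List.length_cons]⟩

/-- The neighbour of a vertex other than the root that is closer to the root. -/
def parent (p : G.TreeVertex v) : G.TreeVertex v :=
  ⟨p.1.tail, by
    obtain ⟨l, hl⟩ := p
    cases l with
    | nil => trivial
    | cons d l => exact hl.of_cons⟩

theorem sum_neighborFinset {M : Type*} [AddCommMonoid M] (φ : ℕ → M) (p : G.TreeVertex v) :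
    ∑ q ∈ (G.universalCover v).neighborFinset p, φ q.1.length =
      (if p.1.length = 0 then 0 else φ (p.1.length - 1)) +
        (G.children p).card • φ (p.1.length + 1) := by
  classical
  rw [← Finset.sum_filter_add_sum_filter_not _ (fun q => q.1.length = p.1.length + 1), add_comm]
  congr 1
  · split_ifs with h
    · refine Finset.sum_eq_zero fun q hq => ?_
      rw [Finset.mem_filter, SimpleGraph.mem_neighborFinset] at hq
      obtain ⟨⟨d, h' | h'⟩, h2⟩ := hq
      · exact absurd (by rw [h', List.length_cons]) h2
      · rw [h', List.length_cons] at h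
        omega
    · rw [Finset.sum_eq_single (parent p)]
      · simp [parent]
      · intro q hq hne
        rw [Finset.mem_filter, SimpleGraph.mem_neighborFinset] at hq
        obtain ⟨⟨d, h' | h'⟩, h2⟩ := hq
        · exact absurd (by rw [h', List.length_cons]) h2
        · exact absurd (Subtype.ext (by simp [parent, h'])) hne
      · intro hq
        exfalso
        apply hq
        rw [Finset.mem_filter, SimpleGraph.mem_neighborFinset]
        refine ⟨⟨p.1.head (by simpa using h), Or.inr ?_⟩, ?_⟩
        · exact (List.cons_head_tail _).symm
        · simp only [parent, List.length_tail]
          omega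
  · rw [children, ← Finset.sum_const]
    exact Finset.sum_congr rfl fun q hq => by rw [(Finset.mem_filter.1 hq).2]

variable [DecidableEq V]

theorem card_children (p : G.TreeVertex v) {k : ℕ} (hk : ∀ v, G.degree v = k) :
    (G.children p).card = if p.1.length = 0 then k else k - 1 := by
  classical
  obtain ⟨l, hl⟩ := p
  rw [← Finset.card_image_of_injective _ Subtype.val_injective]
  cases l with
  | nil =>
    have : (G.children ⟨[], hl⟩).image Subtype.val =
        (Finset.univ.filter fun d : G.Dart => G.src d = v).image fun d => [d] := by
      ext l
      simp only [Finset.mem_image, mem_children, Finset.mem_filter, Finset.mem_univ, true_and]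
      constructor
      · rintro ⟨q, ⟨d, hd⟩, rfl⟩
        have := q.2
        rw [hd] at this
        exact ⟨d, this, hd.symm⟩
      · rintro ⟨d, hd, rfl⟩
        exact ⟨⟨[d], hd⟩, ⟨d, rfl⟩, rfl⟩
    rw [this, Finset.card_image_of_injective _ (fun a b h => by simpa using h)]
    exact hk v
  | cons e l =>
    have : (G.children ⟨e :: l, hl⟩).image Subtype.val =
        ((Finset.univ.filter fun d : G.Dart => G.src d = G.tgt e).erase (G.rev e)).image
          fun d => d :: e :: l := by
      ext l'
      simp only [Finset.mem_image, mem_children, Finset.mem_filter, Finset.mem_univ, true_and,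
        Finset.mem_erase]
      constructor
      · rintro ⟨q, ⟨d, hd⟩, rfl⟩
        have := q.2
        rw [hd] at this
        exact ⟨d, ⟨this.2.1, this.1⟩, hd.symm⟩
      · rintro ⟨d, hd, rfl⟩
        exact ⟨⟨d :: e :: l, hd.2, hd.1, hl⟩, ⟨d, rfl⟩, rfl⟩
    rw [this, Finset.card_image_of_injective _ (fun a b h => by simpa using h),
      Finset.card_erase_of_mem, if_neg (by simp)]
    · rw [← hk (G.tgt e)]
      rfl
    · rw [Finset.mem_filter]
      refine ⟨Finset.mem_univ _, ?_⟩
      obtain ⟨e, b⟩ := e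
      cases b <;> rfl

theorem sphereCard_one {k : ℕ} (hk : ∀ v, G.degree v = k) : G.sphereCard v 1 = k := by
  have h := card_children (G := G) (v := v) ⟨[], trivial⟩ hk
  rw [if_pos (by simp)] at h
  rw [sphereCard, ← h]
  congr 1
  ext p
  rw [Finset.mem_filter, mem_treeBall, mem_children, List.length_eq_one_iff]
  constructor
  · rintro ⟨-, d, h⟩
    exact ⟨d, h⟩
  · rintro ⟨d, h⟩
    exact ⟨by simp [h], d, h⟩

theorem sphereCard_succ {k : ℕ} (hk : ∀ v, G.degree v = k) {m : ℕ} (hm : 1 ≤ m) :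
    G.sphereCard v (m + 1) = (k - 1) * G.sphereCard v m := by
  classical
  rw [sphereCard, sphereCard, mul_comm, Finset.card_eq_sum_card_fiberwise (f := parent)
    (t := (G.treeBall v (m + 1)).filter fun p => p.1.length = m), ← smul_eq_mul]
  · refine Finset.sum_eq_card_nsmul fun p hp => ?_
    rw [Finset.mem_filter] at hp
    have h := card_children p hk
    rw [if_neg (by omega)] at h
    rw [← h]
    congr 1
    ext q
    rw [Finset.mem_filter, Finset.mem_filter, mem_treeBall, mem_children]
    constructor
    · rintro ⟨⟨h1, h2⟩, rfl⟩
      refine ⟨q.1.head (by rintro h0; simp [h0] at h2), (List.cons_head_tail _).symm⟩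
    · rintro ⟨d, hd⟩
      refine ⟨⟨?_, ?_⟩, Subtype.ext ?_⟩ <;> simp [parent, hd, hp.2]
  · intro p hp
    simp only [Finset.coe_filter, Set.mem_ofPred_eq, mem_treeBall, parent, List.length_tail]
      at hp ⊢
    omega

theorem sphereCard_eq {k : ℕ} (hk : ∀ v, G.degree v = k) (m : ℕ) :
    G.sphereCard v (m + 1) = k * (k - 1) ^ m := by
  induction m with
  | zero => rw [zero_add, sphereCard_one hk, pow_zero, mul_one]
  | succ m ih => rw [sphereCard_succ hk (by omega), ih, pow_succ, mul_left_comm, mul_comm (k - 1)]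

/-- The radial function on the tree with values `φ 0, …, φ (N - 1), 0, 0, …`. -/
noncomputable def radial (G : MGraph V E) (v : V) (N : ℕ) (φ : ℕ → ℂ) :
    lp (fun _ : G.TreeVertex v => ℂ) 2 :=
  ⟨fun p => if p.1.length < N then φ p.1.length else 0,
    (memℓp_zero ((G.finite_treeVertex_length_lt v N).subset fun p hp => by
      by_contra h
      exact hp (if_neg h))).of_exponent_ge zero_le⟩

theorem radial_apply (N : ℕ) (φ : ℕ → ℂ) (p : G.TreeVertex v) :
    radial G v N φ p = if p.1.length < N then φ p.1.length else 0 := rfl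

theorem norm_radial_sq (N : ℕ) (φ : ℕ → ℂ) :
    ‖radial G v N φ‖ ^ 2 = ∑ m ∈ Finset.range N, G.sphereCard v m * ‖φ m‖ ^ 2 := by
  have h := lp.norm_rpow_eq_tsum (p := 2) (by norm_num) (radial G v N φ)
  rw [ENNReal.toReal_ofNat, Real.rpow_ofNat] at h
  rw [h, tsum_eq_sum (s := G.treeBall v N) (fun p hp => by
    rw [mem_treeBall] at hp
    simp [radial_apply, hp])]
  rw [← Finset.sum_fiberwise_of_maps_to (s := G.treeBall v N) (t := Finset.range N)
    (g := fun p => p.1.length) (fun p hp => Finset.mem_range.2 (mem_treeBall.1 hp))]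
  refine Finset.sum_congr rfl fun m hm => ?_
  rw [Finset.mem_range] at hm
  have : (G.treeBall v N).filter (fun p => p.1.length = m) =
      (G.treeBall v (m + 1)).filter fun p => p.1.length = m := by
    ext p
    simp only [Finset.mem_filter, mem_treeBall]
    constructor <;> rintro ⟨h1, h2⟩ <;> exact ⟨by omega, h2⟩
  rw [this, sphereCard, ← nsmul_eq_mul, ← Finset.sum_const]
  refine Finset.sum_congr rfl fun p hp => ?_
  rw [radial_apply, (Finset.mem_filter.1 hp).2, if_pos hm, Real.rpow_ofNat]

theorem adjOperator_radial {k : ℕ} (hk : ∀ v, G.degree v = k) {N : ℕ} {φ ψ : ℕ → ℂ}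
    (hφ : ∀ m, N ≤ m → φ m = 0) (h0 : ψ 0 = k * φ 1)
    (hψ : ∀ m, ψ (m + 1) = φ m + (k - 1 : ℕ) * φ (m + 2)) :
    (G.universalCover v).adjOperator (G.degree_universalCover_le v) (radial G v N φ) =
      radial G v (N + 1) ψ := by
  have hφ' : ∀ p : G.TreeVertex v, radial G v N φ p = φ p.1.length := by
    intro p
    rw [radial_apply]
    split_ifs with h
    · rfl
    · rw [hφ _ (by omega)]
  ext p
  have : (G.universalCover v).adjOperator (G.degree_universalCover_le v) (radial G v N φ) p =
      ∑ q ∈ (G.universalCover v).neighborFinset p, radial G v N φ q := rfl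
  rw [this]
  simp only [hφ']
  rw [sum_neighborFinset, card_children p hk, radial_apply]
  rcases Nat.eq_zero_or_eq_succ_pred p.1.length with h | h
  · rw [h]
    simp [h0]
  · rw [h]
    simp only [Nat.succ_eq_add_one, Nat.add_eq_zero_iff, one_ne_zero, and_false, if_false, hψ,
      Nat.add_sub_cancel, nsmul_eq_mul]
    split_ifs with h'
    · rfl
    · rw [hφ _ (by omega), hφ _ (by omega), mul_zero, add_zero]

end MGraph

end Tree

/-! ### Approximate eigenvectors on the regular tree -/

section Radius

open scoped ENNReal

/-- If `c - A` had a bounded inverse, every `f` with error at most `C` would have norm at most `C`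
times the norm of that inverse. -/
theorem mem_spectrum_of_forall_exists {H : Type*} [NormedAddCommGroup H] [NormedSpace ℂ H]
    (A : H →L[ℂ] H) (c : ℂ) {C : ℝ} (h : ∀ M : ℝ, ∃ f : H, M ≤ ‖f‖ ∧ ‖A f - c • f‖ ≤ C) :
    c ∈ spectrum ℂ A := by
  by_contra hc
  rw [spectrum.notMem_iff] at hc
  obtain ⟨u, hu⟩ := hc
  obtain ⟨f, hf, hf'⟩ := h (‖(↑u⁻¹ : H →L[ℂ] H)‖ * C + 1)
  have h1 : (↑u⁻¹ : H →L[ℂ] H) ((u : H →L[ℂ] H) f) = f := by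
    rw [← mul_apply_eq_comp, Units.inv_mul, one_apply_eq_self]
  have h2 : ‖(u : H →L[ℂ] H) f‖ ≤ C := by
    rw [hu, _root_.sub_apply, Algebra.algebraMap_eq_smul_one,
      _root_.smul_apply, one_apply_eq_self, norm_sub_rev]
    exact hf'
  have h3 : ‖f‖ ≤ ‖(↑u⁻¹ : H →L[ℂ] H)‖ * C := by
    conv_lhs => rw [← h1]
    exact (ContinuousLinearMap.le_opNorm _ _).trans (by gcongr)
  linarith

namespace MGraph

variable {V E : Type*} {G : MGraph V E} {v : V} [Fintype E] [DecidableEq V]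

theorem norm_adjOperator_radial_sub_sq {k : ℕ} (hk : ∀ v, G.degree v = k) {N : ℕ} {φ χ : ℕ → ℝ}
    {c : ℝ} (hφ : ∀ m, N ≤ m → φ m = 0) (h0 : χ 0 = k * φ 1 - c * φ 0)
    (hχ : ∀ m, χ (m + 1) = φ m + (k - 1 : ℕ) * φ (m + 2) - c * φ (m + 1)) :
    ‖(G.universalCover v).adjOperator (G.degree_universalCover_le v)
        (radial G v N fun m => (φ m : ℂ)) - (c : ℂ) • radial G v N fun m => (φ m : ℂ)‖ ^ 2 =
      ∑ m ∈ Finset.range (N + 1), G.sphereCard v m * χ m ^ 2 := by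
  have h : (G.universalCover v).adjOperator (G.degree_universalCover_le v)
      (radial G v N fun m => (φ m : ℂ)) - (c : ℂ) • radial G v N (fun m => (φ m : ℂ)) =
      radial G v (N + 1) fun m => (χ m : ℂ) := by
    rw [adjOperator_radial hk (ψ := fun m => ((χ m + c * φ m : ℝ) : ℂ))
      (fun m hm => by rw [hφ m hm, Complex.ofReal_zero]) (by rw [h0]; push_cast; ring)
      (fun m => by rw [hχ]; push_cast; ring)]
    ext p
    change radial G v (N + 1) _ p - (c : ℂ) * radial G v N _ p = _
    rw [radial_apply, radial_apply, radial_apply]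
    split_ifs with h1 h2
    · push_cast
      ring
    · rw [hφ _ (not_lt.1 h2)]
      simp
    · omega
    · simp
  rw [h, norm_radial_sq]
  simp

/-- For `k ≥ 2` and `w = √(k - 1)`, the radial function `w⁻¹ ^ m` solves the eigenvalue equation for
`2 w` away from the root, and all spheres of positive radius carry the same mass. Truncation spoils
the equation on boundedly many spheres, by a bounded amount, while the norm grows without limit. -/
theorem treeBound_mem_spectrum {k : ℕ} (hk : ∀ v, G.degree v = k) (h1 : 1 ≤ k) :
    (treeBound k : ℂ) ∈ spectrum ℂ
      ((G.universalCover v).adjOperator (G.degree_universalCover_le v)) := by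
  have hS := sphereCard_eq (G := G) (v := v) hk
  have hkpos : (0 : ℝ) < k := by exact_mod_cast h1
  rcases h1.eq_or_lt with rfl | h2
  · refine mem_spectrum_of_forall_exists _ _ (C := 0) fun M => ?_
    -- For `k = 1` the tree is a single edge, and constant functions are exact eigenvectors.
    set φ : ℕ → ℝ := fun m => if m < 2 then M else 0 with hφ
    refine ⟨radial G v 2 fun m => (φ m : ℂ), ?_, ?_⟩
    · refine (le_abs_self M).trans (abs_le_of_sq_le_sq' ?_ (norm_nonneg _)).2
      rw [norm_radial_sq, Finset.sum_range_succ, Finset.sum_range_one, hS 0]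
      simp [hφ]
      positivity
    · refine le_of_eq ((pow_eq_zero_iff two_ne_zero).1 ?_)
      rw [norm_adjOperator_radial_sub_sq hk (χ := fun m => if m = 2 then M else 0)]
      · simp [hS 1]
      · exact fun m hm => if_neg (not_lt.2 hm)
      · simp [hφ, treeBound]
      · intro m
        rcases m with _ | _ | m <;> simp [hφ, treeBound]
  · obtain ⟨q, rfl⟩ : ∃ q, k = q + 1 := ⟨k - 1, by omega⟩
    have hq : (0 : ℝ) < q := by
      have : 0 < q := by omega
      exact_mod_cast this
    set w : ℝ := √q with hw
    have hwpos : 0 < w := Real.sqrt_pos.2 hq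
    have hww : w ^ 2 = q := Real.sq_sqrt hq.le
    have hws : w * w⁻¹ = 1 := mul_inv_cancel₀ hwpos.ne'
    have hb : treeBound (q + 1) = 2 * w := by
      rw [treeBound, if_neg (by omega), hw]
      simp
    have hpow : ∀ m, (q : ℝ) ^ m * (w⁻¹ ^ m) ^ 2 = 1 := by
      intro m
      rw [← hww, ← pow_mul, ← pow_mul, mul_comm m 2, ← mul_pow, hws, one_pow]
    have hcard : ∀ m, (G.sphereCard v (m + 1) : ℝ) = (q + 1) * q ^ m := by
      intro m
      rw [hS m]
      push_cast
      simp
    -- The error lives on the spheres of radius `0`, `1`, `j + 2` and `j + 3`, and each of the last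
    -- three contributes `q + 1`, whatever `j` is.
    set C : ℝ := G.sphereCard v 0 * ((q + 1) * w⁻¹) ^ 2 + 3 * (q + 1) with hC
    refine mem_spectrum_of_forall_exists _ _ (C := √C) fun M => ?_
    obtain ⟨j, hj⟩ := exists_nat_ge (M ^ 2 * q / (q + 1))
    set φ : ℕ → ℝ := fun m => if 1 ≤ m ∧ m < j + 3 then w⁻¹ ^ m else 0 with hφ
    set χ : ℕ → ℝ := fun m => if m = 0 then (q + 1) * w⁻¹ else if m = 1 then -1 else
      if m = j + 2 then -w⁻¹ ^ (j + 1) else if m = j + 3 then w⁻¹ ^ (j + 2) else 0 with hχ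
    refine ⟨radial G v (j + 3) fun m => (φ m : ℂ), ?_, Real.le_sqrt_of_sq_le ?_⟩
    · refine (le_abs_self M).trans (abs_le_of_sq_le_sq' ?_ (norm_nonneg _)).2
      rw [norm_radial_sq, Finset.sum_range_succ']
      have : ∀ m ∈ Finset.range (j + 2), (G.sphereCard v (m + 1) : ℝ) * ‖(φ (m + 1) : ℂ)‖ ^ 2 =
          (q + 1) / q := by
        intro m hm
        have hm' : m + 1 < j + 3 := by
          have := Finset.mem_range.1 hm
          omega
        rw [hcard, Complex.norm_real, Real.norm_eq_abs, sq_abs, hφ]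
        simp only
        rw [if_pos ⟨by omega, hm'⟩, eq_div_iff hq.ne']
        linear_combination (q + 1 : ℝ) * hpow (m + 1)
      rw [Finset.sum_congr rfl this, Finset.sum_const, Finset.card_range, nsmul_eq_mul, sq_abs]
      rw [div_le_iff₀ (by positivity)] at hj
      have h3 : M ^ 2 ≤ j * ((q + 1) / q) := by
        rw [mul_div_assoc', le_div_iff₀ hq]
        exact hj
      have h4 : (0 : ℝ) ≤ 2 * ((q + 1) / q) := by positivity
      have h5 : (0 : ℝ) ≤ G.sphereCard v 0 * ‖(φ 0 : ℂ)‖ ^ 2 := by positivity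
      push_cast
      linarith
    · rw [norm_adjOperator_radial_sub_sq hk (χ := χ)]
      · rw [Finset.sum_range_succ, Finset.sum_range_succ, Finset.sum_range_succ',
          Finset.sum_range_succ', Finset.sum_eq_zero, hcard, hcard, hcard]
        · have e1 : χ (j + 2) = -w⁻¹ ^ (j + 1) := by simp [hχ]
          have e2 : χ (j + 3) = w⁻¹ ^ (j + 2) := by simp [hχ]
          have e3 : χ (0 + 1) = -1 := by simp [hχ]
          have e4 : χ 0 = (q + 1) * w⁻¹ := by simp [hχ]
          rw [e1, e2, e3, e4]
          refine le_of_eq ?_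
          linear_combination (q + 1 : ℝ) * hpow (j + 1) + (q + 1 : ℝ) * hpow (j + 2)
        · intro m hm
          have := Finset.mem_range.1 hm
          have : χ (m + 1 + 1) = 0 := by
            simp only [hχ]
            rw [if_neg (by omega), if_neg (by omega), if_neg (by omega), if_neg (by omega)]
          rw [this]
          ring
      · intro m hm
        simp only [hφ]
        rw [if_neg (by omega)]
      · simp [hφ, hχ]
      · intro m
        have hs : w⁻¹ ^ (m + 1) = w * w⁻¹ ^ (m + 2) := by
          rw [pow_succ _ (m + 1)]
          linear_combination (-w⁻¹ ^ (m + 1)) * hws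
        have hs' : w⁻¹ ^ m = w * w⁻¹ ^ (m + 1) := by
          rw [pow_succ]
          linear_combination (-w⁻¹ ^ m) * hws
        rw [hb, Nat.add_sub_cancel, ← hww]
        simp only [hφ, hχ]
        rcases Nat.eq_zero_or_pos m with rfl | hm
        · rw [if_neg (by omega), if_pos (by omega), if_neg (by omega), if_pos (by omega),
            if_pos (by omega)]
          linear_combination (-(w * w⁻¹ - 1)) * hws
        rw [if_neg (by omega), if_neg (by omega)]
        rcases lt_trichotomy m (j + 1) with h | rfl | h
        · rw [if_neg (by omega), if_neg (by omega), if_pos (by omega), if_pos (by omega),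
            if_pos (by omega)]
          linear_combination w * hs - hs'
        · rw [if_pos (by omega), if_pos (by omega), if_neg (by omega), if_pos (by omega)]
          linear_combination -2 * hs'
        · rw [if_neg (by omega), if_neg (by omega : ¬(1 ≤ m + 2 ∧ m + 2 < j + 3)),
            if_neg (by omega : ¬(1 ≤ m + 1 ∧ m + 1 < j + 3))]
          rcases eq_or_ne m (j + 2) with rfl | h'
          · rw [if_pos (by omega), if_pos (by omega)]
            ring
          · rw [if_neg (by omega), if_neg (by omega)]
            ring

theorem treeBound_le_rho [Finite V] [Nonempty V] {k : ℕ} (hk : ∀ v, G.degree v = k) :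
    treeBound k ≤ G.rho := by
  have hb : 0 ≤ treeBound k := by
    unfold treeBound
    split_ifs <;> positivity
  rcases Nat.eq_zero_or_pos k with rfl | h1
  · have : treeBound 0 = 0 := by simp [treeBound]
    rw [this]
    exact Real.iSup_nonneg fun v => ENNReal.toReal_nonneg
  · obtain ⟨v⟩ := ‹Nonempty V›
    refine le_trans ?_ (le_ciSup (Set.finite_range _).bddAbove v)
    set A := (G.universalCover v).adjOperator (G.degree_universalCover_le v)
    have hmem : (treeBound k : ℂ) ∈ spectrum ℂ A := treeBound_mem_spectrum hk h1
    have h2 : (‖(treeBound k : ℂ)‖₊ : ℝ≥0∞) ≤ spectralRadius ℂ A :=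
      le_iSup₂ (f := fun c (_ : c ∈ spectrum ℂ A) => (‖c‖₊ : ℝ≥0∞)) _ hmem
    have : Nontrivial (lp (fun _ : G.TreeVertex v => ℂ) 2) := by
      by_contra hn
      rw [not_nontrivial_iff_subsingleton] at hn
      rw [spectrum.of_subsingleton] at hmem
      exact hmem
    -- Finiteness matters because `toReal` sends `⊤` to `0`.
    have h3 : spectralRadius ℂ A ≠ ⊤ :=
      ne_top_of_le_ne_top ENNReal.coe_ne_top (spectrum.spectralRadius_le_nnnorm A)
    have h4 := ENNReal.toReal_mono h3 h2
    rwa [ENNReal.coe_toReal, coe_nnnorm, Complex.norm_real, Real.norm_eq_abs,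
      abs_of_nonneg hb] at h4

end MGraph

end Radius

theorem mainTheorem10 {V E : Type*} [Fintype V] [DecidableEq V] [Fintype E]
    (G : MGraph V E) (hG : G.IsRegular) (r : ℕ) (hr : 1 ≤ r) :
    ∃ σ : E → Equiv.Perm (Fin r), G.IsOneSidedRamanujan σ := by
  classical
  obtain ⟨k, hk⟩ := hG
  obtain ⟨σ, hσ⟩ := G.exists_newSpec_le_treeBound (fun v => (hk v).le) hr
  refine ⟨σ, fun μ hμ => (hσ μ hμ).trans ?_⟩
  -- A graph without vertices has characteristic polynomial `1`, as do its coverings, so it has no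
  -- new eigenvalues.
  have hV : Nonempty V := by
    by_contra hV
    rw [not_nonempty_iff] at hV
    simp [MGraph.newSpec, MGraph.spec, Matrix.charpoly, Matrix.det_isEmpty] at hμ
  exact MGraph.treeBound_le_rho hk
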